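/- **Hexagonal systems.** A hexagonal system $(\mathbb J,\mathbb F,\#)$ consists of a commutative field $\mathbb F$, an $\mathbb F$-vector space $\mathbb J$, a map $\#:\mathbb J\to\mathbb J$ (the adjoint), a norm $\mathsf N:\mathbb J\to\mathbb F$, a symmetric bilinear form $\mathsf T:\mathbb J\times\mathbb J\to\mathbb F$, a symmetric bilinear map $\times:\mathbb J\times\mathbb J\to\mathbb J$ and an element $1\in\mathbb J\setminus\{0\}$ such that for all $a,b,c\in\mathbb J$, $t\in\mathbb F$: $(ta)^\#=t^2a^\#$, $\mathsf N(ta)=t^3\mathsf N(a)$, $\mathsf T(a,b\times c)=\mathsf T(a\times b,c)$, $(a+b)^\#=a^\#+a\times b+b^\#$, $\mathsf N(a+b)=\mathsf N(a)+\mathsf T(a^\#,b)+\mathsf T(a,b^\#)+\mathsf N(b)$, $\mathsf T(a,a^\#)=3\mathsf N(a)$, $a^{\#\#}=\mathsf N(a)a$, $a^\#\times(a\times b)=\mathsf N(a)b+\mathsf T(a^\#,b)a$, $a^\#\times b^\#+(a\times b)^\#=\mathsf T(a^\#,b)b+\mathsf T(a,b^\#)a$, $1^\#=1$, $a=\mathsf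 T(a,1)1-1\times a$, and $\mathsf N(a)=0$ only if $a=0$. Write $\mathsf T(a)=\mathsf T(a,1)$, $a^{-1}=\mathsf N(a)^{-1}a^\#$ for $a\neq0$, and identify $t\in\mathbb F$ with $t1\in\mathbb J$. An automorphism of the system is a vector space automorphism $h:a\mapsto a^h$ of $\mathbb J$ with $(a^\#)^h=(a^h)^\#$; write $z^{-h}=(z^{-1})^h$. **Hexagons.** Let $\Gamma$ be a Moufang hexagon (a thick generalised hexagon satisfying the Moufang condition) with full collineation group $G$ acting from the left, and suppose that $\Gamma$ has hexagonal system $(\mathbb J,\mathbb F,\#)$. This means that an ordinary hexagon $A=(A_j)_{j\in\mathbb Z/12}$ of points and lines, consecutive ones incident, $A_7$ a point, and isomorphisms $x_i$ from the additive group of $\mathbb J$ ($i$ odd) or $\mathbb F$ ($i$ even) onto $U_i$, $1\le i\le 6$, are fixed, where $U_i\le G$ is the root group of the root $(A_i,A_{i+1},\dots,A_{i+6})$, such that, with $[g,k]=g^{-1}k^{-1}gk$, $$[x_1(a),x_3(b)]=x_2(\mathsf T(a,b)),\quad [x_3(a),x_5(b)]=x_4(\mathsf T(a,b)),\quad [x_2(t),x_6(u)]=x_4(tu),$$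 $$[x_1(a),x_5(b)]=x_2(-\mathsf T(a^\#,b))\,x_3(a\times b)\,x_4(\mathsf T(a,b^\#)),$$ $$[x_1(a),x_6(t)]=x_2(-t\mathsf N(a))\,x_3(ta^\#)\,x_4(t^2\mathsf N(a))\,x_5(-ta),$$ and $[U_i,U_j]=1$ for all other $1\le i<j\le 6$. Let $s_1=x_7(1)x_1(1)x_7(1)$, where $x_7(1)$ is the unique element $v$ of the root group $U_7$ of $(A_7,\dots,A_{13}=A_1)$ such that $v\,x_1(1)\,v$ maps $A_j$ to $A_{2-j}$ for all $j$. An automorphism $h$ of the hexagonal system is also regarded as the unique element $h\in G$ that fixes every $A_j$ and satisfies $hx_i(c)h^{-1}=x_i(c^h)$ for $i$ odd and $hx_i(c)h^{-1}=x_i(c)$ for $i$ even, $1\le i\le 6$. An ovoid of $\Gamma$ is a set of mutually opposite points (points at distance $6$ in the incidence graph) such that every point and every line is at distance at most $3$ from some element of the set. A collineation is point-domestic if it maps no point to an opposite point. **Theorem.** Let $\theta\neq1$ be a point-domestic collineation of $\Gamma$ that fixes every point of some ovoid $O$. Then there is an automorphism $h$ of the hexagonal system $(\mathbb J,\mathbb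 F,\#)$ such that $\theta$ is conjugate in $G$ to $h\,x_1(1)\,s_1$ and 1. $h^3=1$, and $\theta$ has order $3$; 2. $\mathsf T(a)=a+a^h+a^{h^2}$ and $\mathsf T(a^\#)=\mathsf T(a,a^h)$ for all $a\in\mathbb J$; 3. the equation $z=1-z^{-h}$ has no solution $z\in\mathbb J\setminus\{0\}$. -/

import Mathlib

universe u v w z

/-! ### Point-line geometries and generalised hexagons -/

/-- A point-line geometry with point set `P` and line set `L`. -/
structure PointLineGeometry (P : Type u) (L : Type v) where
  /-- Incidence of a point with a line. -/
  inc : P → L → Prop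

namespace PointLineGeometry

variable {P : Type u} {L : Type v} (Γ : PointLineGeometry P L)

/-- The incidence graph: its vertices are the elements (points and lines) of the geometry. -/
def incidenceGraph : SimpleGraph (P ⊕ L) where
  Adj
    | .inl p, .inr l => Γ.inc p l
    | .inr l, .inl p => Γ.inc p l
    | _, _ => False
  symm := ⟨fun x y h => by rcases x with p | l <;> rcases y with q | m <;> exact h⟩
  loopless := ⟨fun x h => by rcases x with p | l <;> exact h⟩

/-- `c` runs once around an ordinary `k`-gon of the geometry (`k` points and `k` lines,
alternating), for `k ≥ 2`. -/
def IsOrdinaryGon (k : ℕ) (c : ZMod (2 * k) → P ⊕ L) : Prop :=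
  Function.Injective c ∧ ∀ i, Γ.incidenceGraph.Adj (c i) (c (i + 1))

/-- A labelled apartment: an ordinary hexagon, its elements labelled cyclically modulo `12`. -/
def IsApartment (A : ZMod 12 → P ⊕ L) : Prop :=
  Γ.IsOrdinaryGon 6 A

/-- Generalised hexagons. -/
structure IsGeneralisedHexagon : Prop where
  nonempty : Nonempty (P ⊕ L)
  no_small_gon : ∀ k : ℕ, 2 ≤ k → k ≤ 5 → ∀ c : ZMod (2 * k) → P ⊕ L, ¬ Γ.IsOrdinaryGon k c
  exists_apartment : ∀ x y : P ⊕ L,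
    ∃ A : ZMod 12 → P ⊕ L, Γ.IsApartment A ∧ x ∈ Set.range A ∧ y ∈ Set.range A

/-- Every line has at least three points, and every point is on at least three lines. -/
def IsThick : Prop :=
  (∀ l : L, 3 ≤ {p : P | Γ.inc p l}.encard) ∧ ∀ p : P, 3 ≤ {l : L | Γ.inc p l}.encard

/-- Two elements are opposite if their distance in the incidence graph is `6`. -/
def Opposite (x y : P ⊕ L) : Prop :=
  Γ.incidenceGraph.dist x y = 6

/-- An ovoid: mutually opposite points such that every element is at distance at most `3`
from one of them. -/
def IsOvoid (O : Set P) : Prop :=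
  (∀ p ∈ O, ∀ q ∈ O, p ≠ q → Γ.Opposite (.inl p) (.inl q)) ∧
    ∀ x : P ⊕ L, ∃ p ∈ O, Γ.incidenceGraph.dist x (.inl p) ≤ 3

/-! ### Collineations, root groups and the Moufang condition -/

/-- The full collineation group, as pairs of a permutation of the points and a permutation of
the lines; multiplication is composition. -/
def collineationGroup : Subgroup (Equiv.Perm P × Equiv.Perm L) where
  carrier := {g | ∀ p l, Γ.inc (g.1 p) (g.2 l) ↔ Γ.inc p l}
  one_mem' := fun _ _ => Iff.rfl
  mul_mem' := fun {g h} hg hh p l => (hg (h.1 p) (h.2 l)).trans (hh p l)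
  inv_mem' := fun {g} hg p l => by
    have := hg (g.1⁻¹ p) (g.2⁻¹ l)
    simpa using this.symm

/-- Collineations of `Γ`. -/
abbrev Collineation : Type (max u v) := Γ.collineationGroup

/-- The action of the collineations on the elements of the geometry. -/
instance : MulAction Γ.Collineation (P ⊕ L) where
  smul g := Sum.map g.1.1 g.1.2
  one_smul x := by rcases x with p | l <;> rfl
  mul_smul g h x := by rcases x with p | l <;> rfl

/-- `θ` maps no point to an opposite point. -/
def IsPointDomestic (θ : Γ.Collineation) : Prop :=
  ∀ p : P, ¬ Γ.Opposite (.inl p) (θ • .inl p)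

/-- The root group of the root `(A i, A (i + 1), …, A (i + 6))` of the apartment `A`: all
collineations that fix every element incident with one of the five interior elements
`A (i + 1), …, A (i + 5)`. -/
def rootGroup (A : ZMod 12 → P ⊕ L) (i : ZMod 12) : Subgroup Γ.Collineation :=
  fixingSubgroup Γ.Collineation
    {x : P ⊕ L | ∃ j : ℕ, 1 ≤ j ∧ j ≤ 5 ∧ Γ.incidenceGraph.Adj (A (i + (j : ZMod 12))) x}

/-- Moufang hexagons: thick generalised hexagons in which the root group of each root
`(x₀, …, x₆)` is transitive on the elements incident with `x₀` and different from `x₁`. -/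
structure IsMoufangHexagon : Prop where
  hexagon : Γ.IsGeneralisedHexagon
  thick : Γ.IsThick
  moufang : ∀ (A : ZMod 12 → P ⊕ L), Γ.IsApartment A → ∀ (i : ZMod 12) (x y : P ⊕ L),
    Γ.incidenceGraph.Adj (A i) x → x ≠ A (i + 1) →
    Γ.incidenceGraph.Adj (A i) y → y ≠ A (i + 1) →
    ∃ g ∈ Γ.rootGroup A i, g • x = y

end PointLineGeometry

/-! ### Hexagonal systems -/

/-- Hexagonal systems `(J, F, #)`, with the norm, the trace form, the cross product and the
identity that `#` determines. -/
structure HexagonalSystem (F : Type w) (J : Type z) [Field F] [AddCommGroup J] [Module F J] where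
  /-- The adjoint `#`. -/
  adj : J → J
  /-- The norm `N`. -/
  norm : J → F
  /-- The trace form `T(·,·)`. -/
  tr : J →ₗ[F] J →ₗ[F] F
  /-- The product `×`. -/
  cross : J →ₗ[F] J →ₗ[F] J
  /-- The identity `1`. -/
  one : J
  one_ne_zero : one ≠ 0
  tr_symm : ∀ a b, tr a b = tr b a
  cross_symm : ∀ a b, cross a b = cross b a
  adj_smul : ∀ (t : F) a, adj (t • a) = t ^ 2 • adj a
  norm_smul : ∀ (t : F) a, norm (t • a) = t ^ 3 * norm a
  tr_cross : ∀ a b c, tr a (cross b c) = tr (cross a b) c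
  adj_add : ∀ a b, adj (a + b) = adj a + cross a b + adj b
  norm_add : ∀ a b, norm (a + b) = norm a + tr (adj a) b + tr a (adj b) + norm b
  tr_adj : ∀ a, tr a (adj a) = 3 * norm a
  adj_adj : ∀ a, adj (adj a) = norm a • a
  adj_cross : ∀ a b, cross (adj a) (cross a b) = norm a • b + tr (adj a) b • a
  adj_cross_adj : ∀ a b,
    cross (adj a) (adj b) + adj (cross a b) = tr (adj a) b • b + tr a (adj b) • a
  adj_one : adj one = one
  one_cross : ∀ a, a = tr a one • one - cross one a
  norm_eq_zero : ∀ a, norm a = 0 ↔ a = 0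

namespace HexagonalSystem

variable {F : Type w} {J : Type z} [Field F] [AddCommGroup J] [Module F J]
  (S : HexagonalSystem F J)

/-- The trace `T(a) = T(a, 1)`. -/
def trace (a : J) : F := S.tr a S.one

/-- The inverse `a⁻¹ = N(a)⁻¹ a^#` of a nonzero element. -/
def inv (a : J) : J := (S.norm a)⁻¹ • S.adj a

/-- Automorphisms: vector space automorphisms that commute with the adjoint. -/
def IsAutomorphism (h : J ≃ₗ[F] J) : Prop :=
  ∀ a, h (S.adj a) = S.adj (h a)

end HexagonalSystem

/-! ### The hexagonal system of a Moufang hexagon -/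

/-- The commutator `[g, h] = g⁻¹ h⁻¹ g h`. -/
def groupComm {G : Type*} [Group G] (g h : G) : G := g⁻¹ * h⁻¹ * g * h

/-- `x` is an isomorphism from the additive group `M` onto the subgroup `U`. -/
def IsParametrisation {G M : Type*} [Group G] [AddCommGroup M] (x : M → G) (U : Subgroup G) :
    Prop :=
  (∀ a b, x (a + b) = x a * x b) ∧ Function.Injective x ∧ Set.range x = (U : Set G)

/-- What it means that the Moufang hexagon `Γ` has the hexagonal system `S`: there are a labelled
apartment `A` (with base point `A 7` and base line `A 6`) and isomorphisms `x₁, …, x₆` from `J`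
(odd index) and `F` (even index) onto the root groups `U₁, …, U₆` of the roots
`(A i, …, A (i + 6))` that satisfy the commutator relations of `S`. -/
structure HexagonCoordinates {P : Type u} {L : Type v} (Γ : PointLineGeometry P L)
    {F : Type w} {J : Type z} [Field F] [AddCommGroup J] [Module F J]
    (S : HexagonalSystem F J) where
  A : ZMod 12 → P ⊕ L
  isApartment : Γ.IsApartment A
  isPoint : ∃ p : P, A 7 = .inl p
  x₁ : J → Γ.Collineation
  x₂ : F → Γ.Collineation
  x₃ : J → Γ.Collineation
  x₄ : F → Γ.Collineation
  x₅ : J → Γ.Collineation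
  x₆ : F → Γ.Collineation
  param₁ : IsParametrisation x₁ (Γ.rootGroup A 1)
  param₂ : IsParametrisation x₂ (Γ.rootGroup A 2)
  param₃ : IsParametrisation x₃ (Γ.rootGroup A 3)
  param₄ : IsParametrisation x₄ (Γ.rootGroup A 4)
  param₅ : IsParametrisation x₅ (Γ.rootGroup A 5)
  param₆ : IsParametrisation x₆ (Γ.rootGroup A 6)
  comm₁₂ : ∀ a t, groupComm (x₁ a) (x₂ t) = 1
  comm₁₃ : ∀ a b, groupComm (x₁ a) (x₃ b) = x₂ (S.tr a b)
  comm₁₄ : ∀ a t, groupComm (x₁ a) (x₄ t) = 1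
  comm₁₅ : ∀ a b, groupComm (x₁ a) (x₅ b) =
    x₂ (-S.tr (S.adj a) b) * x₃ (S.cross a b) * x₄ (S.tr a (S.adj b))
  comm₁₆ : ∀ a t, groupComm (x₁ a) (x₆ t) =
    x₂ (-(t * S.norm a)) * x₃ (t • S.adj a) * x₄ (t ^ 2 * S.norm a) * x₅ (-(t • a))
  comm₂₃ : ∀ t a, groupComm (x₂ t) (x₃ a) = 1
  comm₂₄ : ∀ t u, groupComm (x₂ t) (x₄ u) = 1
  comm₂₅ : ∀ t a, groupComm (x₂ t) (x₅ a) = 1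
  comm₂₆ : ∀ t u, groupComm (x₂ t) (x₆ u) = x₄ (t * u)
  comm₃₄ : ∀ a t, groupComm (x₃ a) (x₄ t) = 1
  comm₃₅ : ∀ a b, groupComm (x₃ a) (x₅ b) = x₄ (S.tr a b)
  comm₃₆ : ∀ a t, groupComm (x₃ a) (x₆ t) = 1
  comm₄₅ : ∀ t a, groupComm (x₄ t) (x₅ a) = 1
  comm₄₆ : ∀ t u, groupComm (x₄ t) (x₆ u) = 1
  comm₅₆ : ∀ a t, groupComm (x₅ a) (x₆ t) = 1

namespace HexagonCoordinates

variable {P : Type u} {L : Type v} {Γ : PointLineGeometry P L}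
  {F : Type w} {J : Type z} [Field F] [AddCommGroup J] [Module F J]
  {S : HexagonalSystem F J} (X : HexagonCoordinates Γ S)

/-- `s` is the element `s₁ = x₇(1) x₁(1) x₇(1)`. Here `x₇(1)` is the element `v` of the root group
`U₇` opposite to `U₁` for which `v x₁(1) v` stabilises the apartment `A`, inducing on it the
reflection that fixes the base point `A 7` and interchanges `A 6` and `A 8`. There is only one
such `v`, because `U₇` acts freely on the lines through `A 7` other than `A 8`. -/
def IsS₁ (s : Γ.Collineation) : Prop :=
  (∃ v ∈ Γ.rootGroup X.A 7, s = v * X.x₁ S.one * v) ∧ ∀ j, s • X.A j = X.A (2 - j)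

/-- `η` is the collineation that the automorphism `h` of `S` induces: it fixes the apartment `A`
elementwise and `η xᵢ(c) η⁻¹ = xᵢ(c^h)`, where `h` acts on `J` and trivially on `F`. There is only
one such collineation, because every element of `Γ` is the image of some `A j` under a product of
elements `xᵢ(c)`, `1 ≤ i ≤ 6`. -/
structure IsInducedBy (η : Γ.Collineation) (h : J ≃ₗ[F] J) : Prop where
  fix : ∀ j, η • X.A j = X.A j
  conj₁ : ∀ a, η * X.x₁ a * η⁻¹ = X.x₁ (h a)
  conj₂ : ∀ t, η * X.x₂ t * η⁻¹ = X.x₂ t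
  conj₃ : ∀ a, η * X.x₃ a * η⁻¹ = X.x₃ (h a)
  conj₄ : ∀ t, η * X.x₄ t * η⁻¹ = X.x₄ t
  conj₅ : ∀ a, η * X.x₅ a * η⁻¹ = X.x₅ (h a)
  conj₆ : ∀ t, η * X.x₆ t * η⁻¹ = X.x₆ t

end HexagonCoordinates

/-!
If a collineation fixes every point of an ovoid and one line through a point of the ovoid, then the
fixed elements spread along geodesics with fixed ends, and the collineation is trivial. So `θ` fixes
no line through a point of `O`. Choose the apartment such that `A 7` and `A 1` belong to `O` and
`θ` maps `A 8` to `A 6`. Then `θ = g x₁(c) s₁`, where `g` fixes the apartment and acts on the root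
groups by linear maps `φ`, `ψ` and a scalar `l`. In coordinates, the condition that `θ` is
point-domestic and fixes `O` pointwise becomes a list of identities between `φ`, `ψ`, `l` and `c`,
such as `φ(c) = c⁻¹`, and the condition that `θ` fixes no line through `A 7` becomes
`φ(c - z⁻¹) ≠ z`. The identities show that `θ³` fixes the line `A 8`, so `θ` has order `3`.

If `c = 1`, the identities say that `φ = ψ` is the required automorphism. To reduce to this case,
let `ρ = l ψ φ`. By the identities, `1 + ρ + ρ²` maps `J` into the line spanned by `c`. Taking for
`z` a multiple of `c⁻¹` shows that `X² - X + 1` has no root in `F`; in particular `3 ≠ 0`. A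
computation in the kernel of `1 + ρ + ρ²` then gives `dim J ≤ 3`. Hence `d = c⁻¹` is a scalar or
`J` is a cubic algebra `F[d]`, and multiplication by `d` is an isotopy of the hexagonal system. The
corresponding collineation conjugates `θ` to a collineation with `c = 1`.
-/

/-! ### Distances in a generalised hexagon -/

namespace PointLineGeometry

variable {P : Type u} {L : Type v} {Γ : PointLineGeometry P L}

/-- The colouring of the incidence graph by the type (point or line) of an element. -/
def typeColoring (Γ : PointLineGeometry P L) : Γ.incidenceGraph.Coloring Bool :=
  SimpleGraph.Coloring.mk Sum.isLeft (by
    rintro (p | l) (q | m) h <;> first | exact h.elim | simp)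

theorem isLeft_ne_of_adj {x y : P ⊕ L} (h : Γ.incidenceGraph.Adj x y) : x.isLeft ≠ y.isLeft :=
  Γ.typeColoring.valid h

namespace IsGeneralisedHexagon

variable (hΓ : Γ.IsGeneralisedHexagon)
include hΓ

theorem connected : Γ.incidenceGraph.Connected := by
  have := hΓ.nonempty
  refine ⟨fun x y => ?_⟩
  obtain ⟨A, hA, ⟨i, rfl⟩, ⟨j, rfl⟩⟩ := hΓ.exists_apartment x y
  have reachable_add (n : ℕ) : Γ.incidenceGraph.Reachable (A i) (A (i + n)) := by
    induction n with
    | zero => simp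
    | succ n ih => simpa [add_assoc] using ih.trans (hA.2 (i + n)).reachable
  simpa using reachable_add (j - i).val

theorem even_dist_iff (x y : P ⊕ L) :
    Even (Γ.incidenceGraph.dist x y) ↔ (x.isLeft ↔ y.isLeft) := by
  obtain ⟨p, hp⟩ := hΓ.connected.exists_walk_length_eq_dist x y
  rw [← hp]
  exact Γ.typeColoring.even_length_iff_congr p

theorem dist_le_six (x y : P ⊕ L) : Γ.incidenceGraph.dist x y ≤ 6 := by
  obtain ⟨A, hA, ⟨i, rfl⟩, ⟨j, rfl⟩⟩ := hΓ.exists_apartment x y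
  have dist_add_le (i : ZMod 12) (n : ℕ) : Γ.incidenceGraph.dist (A i) (A (i + n)) ≤ n := by
    induction n with
    | zero => simp
    | succ n ih =>
      have hadj := SimpleGraph.dist_eq_one_iff_adj.2 (hA.2 (i + n))
      have := hΓ.connected.dist_triangle (u := A i) (v := A (i + n)) (w := A (i + n + 1))
      push_cast
      rw [← add_assoc]
      omega
  have hij := dist_add_le i (j - i).val
  have hji := dist_add_le j (i - j).val
  have hval : ∀ i j : ZMod 12, (j - i).val ≤ 6 ∨ (i - j).val ≤ 6 := by decide
  rw [ZMod.natCast_zmod_val, add_sub_cancel] at hij hji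
  rw [SimpleGraph.dist_comm] at hji
  have := hval i j
  omega

theorem twelve_le_length_of_isCycle {x : P ⊕ L} {c : Γ.incidenceGraph.Walk x x}
    (hc : c.IsCycle) : 12 ≤ c.length := by
  by_contra hlt
  obtain ⟨k, hk⟩ : Even c.length := (Γ.typeColoring.even_length_iff_congr c).2 Iff.rfl
  have h3 := hc.three_le_length
  have hk2 : 2 ≤ k := by omega
  have : NeZero (2 * k) := ⟨by omega⟩
  refine hΓ.no_small_gon k hk2 (by omega) (fun i => c.getVert i.val)
    ⟨fun i j hij => ?_, fun i => ?_⟩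
  · have hi := ZMod.val_lt i
    have hj := ZMod.val_lt j
    exact ZMod.val_injective _
      (hc.getVert_injOn' (by rw [Set.mem_ofPred_eq]; omega) (by rw [Set.mem_ofPred_eq]; omega) hij)
  · have hi := ZMod.val_lt i
    have hadj := c.adj_getVert_succ (i := i.val) (by omega)
    by_cases hlast : i.val + 1 = 2 * k
    · have hi0 : i + 1 = 0 := by
        have : ((i.val + 1 : ℕ) : ZMod (2 * k)) = 0 := by rw [hlast, ZMod.natCast_self]
        rwa [Nat.cast_succ, ZMod.natCast_zmod_val] at this
      rw [show i.val + 1 = c.length by omega, SimpleGraph.Walk.getVert_length] at hadj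
      simpa [hi0] using hadj
    · have h1 : (1 : ZMod (2 * k)).val = 1 := ZMod.val_one'' (by omega)
      have hsucc : (i + 1).val = i.val + 1 := by rw [ZMod.val_add_of_lt (by omega), h1]
      simpa only [hsucc] using hadj

theorem dist_of_adj {x z : P ⊕ L} (h : Γ.incidenceGraph.Adj x z) (y : P ⊕ L) :
    Γ.incidenceGraph.dist z y = Γ.incidenceGraph.dist x y + 1 ∨
      Γ.incidenceGraph.dist x y = Γ.incidenceGraph.dist z y + 1 := by
  have hxz := SimpleGraph.dist_eq_one_iff_adj.2 h
  have hxy := hΓ.connected.dist_triangle (u := x) (v := z) (w := y)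
  have hzy := hΓ.connected.dist_triangle (u := z) (v := x) (w := y)
  rw [SimpleGraph.dist_comm (u := z) (v := x)] at hzy
  have hne : Γ.incidenceGraph.dist x y ≠ Γ.incidenceGraph.dist z y := by
    intro heq
    have hiff := (hΓ.even_dist_iff x y).symm.trans (heq ▸ hΓ.even_dist_iff z y)
    exact isLeft_ne_of_adj h (Bool.eq_iff_iff.2 (by tauto))
  omega

/-- Two different geodesics from `x` to `y` would contain a circuit of length at most `10`. -/
theorem proj_unique {x y z z' : P ⊕ L} (hz : Γ.incidenceGraph.Adj x z)
    (hz' : Γ.incidenceGraph.Adj x z') (h5 : Γ.incidenceGraph.dist x y ≤ 5)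
    (hd : Γ.incidenceGraph.dist x y = Γ.incidenceGraph.dist z y + 1)
    (hd' : Γ.incidenceGraph.dist x y = Γ.incidenceGraph.dist z' y + 1) : z = z' := by
  by_contra hne
  obtain ⟨p, hp⟩ := hΓ.connected.exists_walk_length_eq_dist z y
  obtain ⟨q, hq⟩ := hΓ.connected.exists_walk_length_eq_dist z' y
  have hp' : (SimpleGraph.Walk.cons hz p).IsPath :=
    SimpleGraph.Walk.isPath_of_length_eq_dist _ (by simp [hp, hd])
  have hq' : (SimpleGraph.Walk.cons hz' q).IsPath :=
    SimpleGraph.Walk.isPath_of_length_eq_dist _ (by simp [hq, hd'])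
  have hne' : SimpleGraph.Walk.cons hz p ≠ SimpleGraph.Walk.cons hz' q := by
    intro h
    rw [SimpleGraph.Walk.cons.injEq] at h
    exact hne h.1
  obtain ⟨w, -, -, c, hc, hlen⟩ := hp'.exists_isCycle_length_le_add_of_ne hq' hne'
  have := hΓ.twelve_le_length_of_isCycle hc
  simp only [SimpleGraph.Walk.length_cons] at hlen
  omega

theorem dist_eq_add_one_of_ne {x y z w : P ⊕ L} (hz : Γ.incidenceGraph.Adj x z)
    (hw : Γ.incidenceGraph.Adj x w) (hne : w ≠ z) (h5 : Γ.incidenceGraph.dist x y ≤ 5)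
    (hd : Γ.incidenceGraph.dist x y = Γ.incidenceGraph.dist z y + 1) :
    Γ.incidenceGraph.dist w y = Γ.incidenceGraph.dist x y + 1 :=
  (hΓ.dist_of_adj hw y).resolve_right fun h => hne (hΓ.proj_unique hw hz h5 h hd)

theorem exists_adj_dist_eq {x y : P ⊕ L} {n : ℕ} (h : Γ.incidenceGraph.dist x y = n + 1) :
    ∃ z, Γ.incidenceGraph.Adj x z ∧ Γ.incidenceGraph.dist z y = n := by
  obtain ⟨p, hp⟩ := hΓ.connected.exists_walk_length_eq_dist x y
  cases p with
  | nil => simp at h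
  | cons hxz q =>
    refine ⟨_, hxz, ?_⟩
    have := SimpleGraph.dist_le q
    rw [SimpleGraph.Walk.length_cons] at hp
    rcases hΓ.dist_of_adj hxz y with h1 | h1 <;> omega

theorem dist_eq_five {x y z : P ⊕ L} (h : Γ.incidenceGraph.Adj x z)
    (h6 : Γ.incidenceGraph.dist x y = 6) : Γ.incidenceGraph.dist z y = 5 := by
  have := hΓ.dist_le_six z y
  rcases hΓ.dist_of_adj h y with h1 | h1 <;> omega

theorem dist_of_path {c : ℕ → P ⊕ L} {N : ℕ}
    (hadj : ∀ n < N, Γ.incidenceGraph.Adj (c n) (c (n + 1)))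
    (hne : ∀ n, n + 2 ≤ N → c (n + 2) ≠ c n) (i k : ℕ) (hN : i + k ≤ N) (hk : k ≤ 6) :
    Γ.incidenceGraph.dist (c (i + k)) (c i) = k := by
  induction k using Nat.twoStepInduction with
  | zero => simp
  | one => exact SimpleGraph.dist_eq_one_iff_adj.2 (hadj i (by omega)).symm
  | more k ih₀ ih₁ =>
    have h₀ := ih₀ (by omega) (by omega)
    have h₁ : Γ.incidenceGraph.dist (c (i + k + 1)) (c i) = k + 1 := ih₁ (by omega) (by omega)
    have := hΓ.dist_eq_add_one_of_ne (hadj (i + k) (by omega)).symm (hadj (i + k + 1) (by omega))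
      (hne (i + k) (by omega)) (y := c i) (by omega) (by omega)
    change Γ.incidenceGraph.dist (c (i + k + 1 + 1)) (c i) = k + 2
    omega

theorem dist_of_circuit {A : ZMod 12 → P ⊕ L}
    (hadj : ∀ i, Γ.incidenceGraph.Adj (A i) (A (i + 1))) (hne : ∀ i, A (i + 2) ≠ A i)
    (i : ZMod 12) (k : ℕ) (hk : k ≤ 6) : Γ.incidenceGraph.dist (A i) (A (i + k)) = k := by
  have := hΓ.dist_of_path (c := fun n => A (i + n)) (N := k)
    (fun n _ => by simpa [add_assoc] using hadj (i + n))
    (fun n _ => by simpa [add_assoc] using hne (i + n)) 0 k (by omega) hk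
  rw [SimpleGraph.dist_comm]
  simpa using this

theorem isApartment_of_circuit {A : ZMod 12 → P ⊕ L}
    (hadj : ∀ i, Γ.incidenceGraph.Adj (A i) (A (i + 1))) (hne : ∀ i, A (i + 2) ≠ A i) :
    Γ.IsApartment A := by
  refine ⟨fun i j hij => ?_, hadj⟩
  have h₁ := hΓ.dist_of_circuit hadj hne i (j - i).val
  have h₂ := hΓ.dist_of_circuit hadj hne j (i - j).val
  rw [ZMod.natCast_zmod_val, add_sub_cancel, hij, SimpleGraph.dist_self] at h₁ h₂
  have hval : ∀ i j : ZMod 12, ((j - i).val ≤ 6 → 0 = (j - i).val) →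
      ((i - j).val ≤ 6 → 0 = (i - j).val) → i = j := by decide
  exact hval i j h₁ h₂

/-- The path is closed by the geodesic from its last element `c 7` to `c 0`. -/
theorem exists_isApartment_of_path {c : ℕ → P ⊕ L}
    (hadj : ∀ n < 7, Γ.incidenceGraph.Adj (c n) (c (n + 1)))
    (hne : ∀ n, n + 2 ≤ 7 → c (n + 2) ≠ c n) :
    ∃ A : ZMod 12 → P ⊕ L, Γ.IsApartment A ∧ ∀ n : ℕ, n ≤ 7 → A n = c n := by
  have h₆ : Γ.incidenceGraph.dist (c 6) (c 0) = 6 :=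
    hΓ.dist_of_path hadj hne 0 6 (by omega) le_rfl
  have h₁₇ : Γ.incidenceGraph.dist (c 7) (c 1) = 6 :=
    hΓ.dist_of_path hadj hne 1 6 (by omega) le_rfl
  have h₇ := hΓ.dist_eq_five (hadj 6 (by omega)) h₆
  obtain ⟨e₈, adj₈, d₈⟩ := hΓ.exists_adj_dist_eq h₇
  obtain ⟨e₉, adj₉, d₉⟩ := hΓ.exists_adj_dist_eq d₈
  obtain ⟨e₁₀, adj₁₀, d₁₀⟩ := hΓ.exists_adj_dist_eq d₉
  obtain ⟨e₁₁, adj₁₁, d₁₁⟩ := hΓ.exists_adj_dist_eq d₁₀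
  have adj₀ := SimpleGraph.dist_eq_one_iff_adj.1 d₁₁
  have ne_of_dist_ne {x y z : P ⊕ L}
      (h : Γ.incidenceGraph.dist x z ≠ Γ.incidenceGraph.dist y z) : x ≠ y :=
    fun hxy => h (hxy ▸ rfl)
  have ne₁ : c 1 ≠ e₁₁ := ne_of_dist_ne (z := c 7) (by
    have f₈ := hΓ.dist_of_adj adj₈ (c 7)
    have f₉ := hΓ.dist_of_adj adj₉ (c 7)
    have f₁₀ := hΓ.dist_of_adj adj₁₀ (c 7)
    have f₁₁ := hΓ.dist_of_adj adj₁₁ (c 7)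
    rw [SimpleGraph.dist_self] at f₈
    rw [SimpleGraph.dist_comm, h₁₇]
    omega)
  have ne_of_dist {x y : P ⊕ L} {m : ℕ} (hx : Γ.incidenceGraph.dist x (c 0) = m)
      (hy : Γ.incidenceGraph.dist y (c 0) = m + 2) : x ≠ y := ne_of_dist_ne (z := c 0) (by omega)
  refine ⟨![c 0, c 1, c 2, c 3, c 4, c 5, c 6, c 7, e₈, e₉, e₁₀, e₁₁],
    hΓ.isApartment_of_circuit (fun i => ?_) (fun i => ?_), fun n hn => ?_⟩
  · fin_cases i
    exacts [hadj 0 (by omega), hadj 1 (by omega), hadj 2 (by omega), hadj 3 (by omega),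
      hadj 4 (by omega), hadj 5 (by omega), hadj 6 (by omega), adj₈, adj₉, adj₁₀, adj₁₁, adj₀]
  · fin_cases i
    exacts [hne 0 (by omega), hne 1 (by omega), hne 2 (by omega), hne 3 (by omega),
      hne 4 (by omega), hne 5 (by omega), ne_of_dist d₈ h₆, ne_of_dist d₉ h₇, ne_of_dist d₁₀ d₈,
      ne_of_dist d₁₁ d₉, ne_of_dist SimpleGraph.dist_self d₁₀, ne₁]
  · interval_cases n <;> rfl

end IsGeneralisedHexagon

namespace IsApartment

variable {A B : ZMod 12 → P ⊕ L}

theorem ne_add_two (hA : Γ.IsApartment A) (i : ZMod 12) : A (i + 2) ≠ A i :=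
  fun h => (by decide : ∀ i : ZMod 12, i + 2 ≠ i) i (hA.1 h)

theorem dist_add (hA : Γ.IsApartment A) (hΓ : Γ.IsGeneralisedHexagon) (i : ZMod 12) (k : ℕ)
    (hk : k ≤ 6) : Γ.incidenceGraph.dist (A i) (A (i + k)) = k :=
  hΓ.dist_of_circuit hA.2 hA.ne_add_two i k hk

theorem dist_eq (hA : Γ.IsApartment A) (hΓ : Γ.IsGeneralisedHexagon) (i j : ZMod 12) :
    Γ.incidenceGraph.dist (A i) (A j) = min (j - i).val (i - j).val := by
  have hij := hA.dist_add hΓ i (j - i).val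
  have hji := hA.dist_add hΓ j (i - j).val
  rw [ZMod.natCast_zmod_val, add_sub_cancel] at hij hji
  rw [SimpleGraph.dist_comm] at hji
  have hval : ∀ i j : ZMod 12, ((j - i).val ≤ 6 ∧ (j - i).val ≤ (i - j).val) ∨
    ((i - j).val ≤ 6 ∧ (i - j).val ≤ (j - i).val) := by decide
  rcases hval i j with h | h
  · rw [hij h.1, min_eq_left h.2]
  · rw [hji h.1, min_eq_right h.2]

theorem shift (hA : Γ.IsApartment A) (k : ZMod 12) : Γ.IsApartment fun i => A (i + k) := by
  refine ⟨fun i j h => add_right_cancel (hA.1 h), fun i => ?_⟩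
  simpa only [add_right_comm i k 1] using hA.2 (i + k)

theorem reflect (hA : Γ.IsApartment A) (k : ZMod 12) : Γ.IsApartment fun i => A (k - i) := by
  refine ⟨fun i j h => sub_right_injective (hA.1 h), fun i => ?_⟩
  have := hA.2 (k - (i + 1))
  rw [show k - (i + 1) + 1 = k - i by ring] at this
  exact this.symm

theorem eq_between (hA : Γ.IsApartment A) (hB : Γ.IsApartment B) (hΓ : Γ.IsGeneralisedHexagon)
    {i : ZMod 12} {n : ℕ} (hn : n ≤ 5) (h0 : A i = B i) (h1 : A (i + n) = B (i + n)) :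
    ∀ k ≤ n, A (i + k) = B (i + k) := by
  induction n generalizing i with
  | zero =>
    intro k hk
    obtain rfl : k = 0 := by omega
    exact h1
  | succ n ih =>
    have cast_succ (k : ℕ) : i + ((k + 1 : ℕ) : ZMod 12) = i + 1 + k := by push_cast; ring
    have dA := hA.dist_add hΓ i (n + 1) (by omega)
    have dB := hB.dist_add hΓ i (n + 1) (by omega)
    have dA' := hA.dist_add hΓ (i + 1) n (by omega)
    have dB' := hB.dist_add hΓ (i + 1) n (by omega)
    have adjB := hB.2 i
    rw [cast_succ] at dA dB h1
    rw [← h0, ← h1] at dB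
    rw [← h1] at dB'
    rw [← h0] at adjB
    have hstep : A (i + 1) = B (i + 1) :=
      hΓ.proj_unique (y := A (i + 1 + n)) (hA.2 i) adjB (by omega) (by omega) (by omega)
    intro k hk
    rcases k with _ | k
    · simpa using h0
    · rw [cast_succ]
      exact ih (by omega) hstep h1 k (by omega)

theorem eq_of_eq_on_path (hA : Γ.IsApartment A) (hB : Γ.IsApartment B)
    (hΓ : Γ.IsGeneralisedHexagon) {i : ZMod 12} (h : ∀ k : ℕ, k ≤ 6 → A (i + k) = B (i + k))
    (h' : A (i - 1) = B (i - 1)) : A = B := by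
  have hlast : i + 6 + (5 : ℕ) = i - 1 := by
    rw [add_assoc, sub_eq_add_neg]
    exact congrArg (i + ·) (by decide)
  have hrest := hA.eq_between hB hΓ (i := i + 6) (n := 5) le_rfl (h 6 le_rfl) (by rw [hlast, h'])
  funext j
  have hval := ZMod.val_lt (j - i)
  obtain ⟨k, hk, rfl⟩ : ∃ k : ℕ, k < 12 ∧ i + k = j := ⟨(j - i).val, hval, by simp⟩
  rcases le_or_gt k 6 with hk6 | hk6
  · exact h k hk6
  · obtain ⟨m, rfl⟩ := Nat.exists_eq_add_of_le hk6.le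
    simpa [add_assoc] using hrest m (by omega)

end IsApartment

/-! ### Collineations -/

theorem smul_adj (g : Γ.Collineation) {x y : P ⊕ L} :
    Γ.incidenceGraph.Adj (g • x) (g • y) ↔ Γ.incidenceGraph.Adj x y := by
  rcases x with p | l <;> rcases y with q | m
  · exact Iff.rfl
  · exact g.2 p m
  · exact g.2 q l
  · exact Iff.rfl

theorem isLeft_smul (g : Γ.Collineation) (x : P ⊕ L) : (g • x).isLeft = x.isLeft := by
  rcases x with p | l <;> rfl

theorem collineation_ext {g h : Γ.Collineation} (H : ∀ x : P ⊕ L, g • x = h • x) : g = h :=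
  Subtype.ext (Prod.ext (Equiv.ext fun p => Sum.inl_injective (H (.inl p)))
    (Equiv.ext fun l => Sum.inr_injective (H (.inr l))))

/-- A collineation as an endomorphism of the incidence graph, used to map walks. -/
def Collineation.toHom (g : Γ.Collineation) : Γ.incidenceGraph →g Γ.incidenceGraph where
  toFun x := g • x
  map_rel' h := (smul_adj g).2 h

theorem smul_dist (hΓ : Γ.IsGeneralisedHexagon) (g : Γ.Collineation) (x y : P ⊕ L) :
    Γ.incidenceGraph.dist (g • x) (g • y) = Γ.incidenceGraph.dist x y := by
  have dist_smul_le (g : Γ.Collineation) (x y : P ⊕ L) :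
      Γ.incidenceGraph.dist (g • x) (g • y) ≤ Γ.incidenceGraph.dist x y := by
    obtain ⟨p, hp⟩ := hΓ.connected.exists_walk_length_eq_dist x y
    rw [← hp, ← SimpleGraph.Walk.length_map (Collineation.toHom g) p]
    exact SimpleGraph.dist_le _
  refine le_antisymm (dist_smul_le g x y) ?_
  simpa using dist_smul_le g⁻¹ (g • x) (g • y)

theorem IsApartment.smul {A : ZMod 12 → P ⊕ L} (hA : Γ.IsApartment A) (g : Γ.Collineation) :
    Γ.IsApartment fun i => g • A i :=
  ⟨fun _ _ h => hA.1 (smul_left_cancel g h), fun i => (smul_adj g).2 (hA.2 i)⟩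

theorem IsApartment.exists_bend {A : ZMod 12 → P ⊕ L} (hA : Γ.IsApartment A)
    (hΓ : Γ.IsGeneralisedHexagon) (i : ZMod 12) {x : P ⊕ L}
    (hx : Γ.incidenceGraph.Adj (A i) x) (hne : x ≠ A (i + 1)) :
    ∃ B : ZMod 12 → P ⊕ L, Γ.IsApartment B ∧ B (i - 1) = x ∧
      ∀ k : ℕ, k ≤ 6 → B (i + k) = A (i + k) := by
  have cast_succ (k : ℕ) : i - 1 + ((k + 1 : ℕ) : ZMod 12) = i + k := by push_cast; ring
  obtain ⟨B, hB, hBx⟩ := hΓ.exists_isApartment_of_path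
    (c := fun n => if n = 0 then x else A (i - 1 + n))
    (fun n _ => by
      rcases n with _ | n
      · simpa using hx.symm
      · rw [if_neg n.succ_ne_zero, if_neg (n + 1).succ_ne_zero, cast_succ, cast_succ,
          Nat.cast_succ, ← add_assoc]
        exact hA.2 (i + n))
    (fun n _ => by
      rcases n with _ | n
      · simpa [show i - 1 + 2 = i + 1 by ring] using hne.symm
      · rw [if_neg n.succ_ne_zero, if_neg (n + 2).succ_ne_zero, cast_succ, cast_succ,
          Nat.cast_add, ← add_assoc]
        exact hA.ne_add_two (i + n))
  refine ⟨fun j => B (j + (1 - i)), hB.shift _, by simpa using hBx 0 (by omega), fun k hk => ?_⟩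
  have := hBx (k + 1) (by omega)
  rw [if_neg k.succ_ne_zero, cast_succ] at this
  rw [← this]
  exact congrArg B (by push_cast; ring)

end PointLineGeometry

/-! ### Rigidity -/

namespace PointLineGeometry

variable {P : Type u} {L : Type v} {Γ : PointLineGeometry P L}

/-- `g` fixes every element incident with `x`. These are the local conditions out of which root
groups are made. -/
def FixesNeighbours (g : Γ.Collineation) (x : P ⊕ L) : Prop :=
  ∀ y, Γ.incidenceGraph.Adj x y → g • y = y

theorem smul_proj (hΓ : Γ.IsGeneralisedHexagon) {g : Γ.Collineation} {x y z : P ⊕ L}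
    (hx : g • x = x) (hy : g • y = y) (hz : Γ.incidenceGraph.Adj x z)
    (h5 : Γ.incidenceGraph.dist x y ≤ 5)
    (hd : Γ.incidenceGraph.dist x y = Γ.incidenceGraph.dist z y + 1) : g • z = z := by
  refine hΓ.proj_unique (y := y) ?_ hz h5 ?_ hd
  · have := (smul_adj g).2 hz
    rwa [hx] at this
  · rw [hd, ← smul_dist hΓ g z y, hy]

theorem FixesNeighbours.of_opposite (hΓ : Γ.IsGeneralisedHexagon) {g : Γ.Collineation}
    {x y : P ⊕ L} (hx : FixesNeighbours g x) (hy : g • y = y)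
    (h6 : Γ.incidenceGraph.dist x y = 6) : FixesNeighbours g y := by
  intro z hz
  have h5 : Γ.incidenceGraph.dist z x = 5 :=
    hΓ.dist_eq_five hz (by rwa [SimpleGraph.dist_comm])
  obtain ⟨w, hw, hwz⟩ := hΓ.exists_adj_dist_eq (by rwa [SimpleGraph.dist_comm] : _ = 4 + 1)
  have hwy := hΓ.dist_eq_five hw h6
  rw [SimpleGraph.dist_comm] at hwy hwz
  exact smul_proj hΓ hy (hx w hw) hz hwy.le (by omega)

theorem exists_mem_ne_ne {α : Type*} {s : Set α} (hs : 3 ≤ s.encard) (a b : α) :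
    ∃ c ∈ s, c ≠ a ∧ c ≠ b := by
  by_contra! hcon
  have hsub : s ⊆ {a, b} := fun c hc => or_iff_not_imp_left.2 (hcon c hc)
  have h3 := (hs.trans (Set.encard_le_encard hsub)).trans (Set.encard_insert_le {b} a)
  rw [Set.encard_singleton] at h3
  exact absurd h3 (by decide)

theorem IsThick.exists_adj_ne_ne (ht : Γ.IsThick) (x y y' : P ⊕ L) :
    ∃ z, Γ.incidenceGraph.Adj x z ∧ z ≠ y ∧ z ≠ y' := by
  refine exists_mem_ne_ne (s := {z | Γ.incidenceGraph.Adj x z}) ?_ y y'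
  rcases x with p | l
  · have himage : {z | Γ.incidenceGraph.Adj (.inl p) z} = Sum.inr '' {l : L | Γ.inc p l} := by
      ext (q | m) <;> simp [incidenceGraph]
    rw [himage, Sum.inr_injective.encard_image]
    exact ht.2 p
  · have himage : {z | Γ.incidenceGraph.Adj (.inr l) z} = Sum.inl '' {p : P | Γ.inc p l} := by
      ext (q | m) <;> simp [incidenceGraph]
    rw [himage, Sum.inl_injective.encard_image]
    exact ht.1 l

section rigidity

variable (hΓ : Γ.IsGeneralisedHexagon) (ht : Γ.IsThick) {A : ZMod 12 → P ⊕ L}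
  (hA : Γ.IsApartment A) {g : Γ.Collineation}
include hΓ hA

theorem smul_eq_between {i : ZMod 12} {n : ℕ} (hn : n ≤ 5) (h : g • A i = A i)
    (h' : g • A (i + n) = A (i + n)) : ∀ k ≤ n, g • A (i + k) = A (i + k) :=
  (hA.smul g).eq_between hA hΓ hn h h'

theorem smul_eq_of_smul_eq_on_path {i : ZMod 12} (h : ∀ k : ℕ, k ≤ 6 → g • A (i + k) = A (i + k))
    (h' : g • A (i - 1) = A (i - 1)) (j : ZMod 12) : g • A j = A j :=
  congrFun ((hA.smul g).eq_of_eq_on_path hA hΓ h h') j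

include ht

/-- A second apartment `B` through `A (i + 1), …, A (i + 7)` is fixed as well, and passing to
opposite elements leads from `A (i + 2)` to `B (i + 8)` and from there to `A i`. -/
theorem fixesNeighbours_of_root_end (hg : ∀ j, g • A j = A j) (i : ZMod 12)
    (h : ∀ k : ℕ, 1 ≤ k → k ≤ 5 → FixesNeighbours g (A (i + k))) :
    FixesNeighbours g (A i) := by
  obtain ⟨x, hx, hxi, hxi'⟩ := ht.exists_adj_ne_ne (A (i + 1)) (A i) (A (i + 1 + 1))
  obtain ⟨B, hB, hBx, hBA⟩ := hA.exists_bend hΓ (i + 1) hx hxi'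
  have hgx : g • x = x := h 1 le_rfl (by omega) x (by simpa using hx)
  have hgB := smul_eq_of_smul_eq_on_path hΓ hB (g := g) (i := i + 1)
    (fun k hk => by rw [hBA k hk, hg]) (by rw [hBx, hgx])
  have hBA₁ : B (i + 1) = A (i + 1) := by simpa using hBA 0 (by omega)
  have hBA₂ : B (i + 2) = A (i + 2) := by
    simpa [add_assoc, one_add_one_eq_two] using hBA 1 (by omega)
  have hopp : Γ.incidenceGraph.dist (B (i + 2)) (B (i + 8)) = 6 := by
    rw [hB.dist_eq hΓ]
    ring_nf
    decide
  have hB₈ : FixesNeighbours g (B (i + 8)) :=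
    FixesNeighbours.of_opposite hΓ (hBA₂ ▸ h 2 (by omega) (by omega)) (hgB _) hopp
  refine hB₈.of_opposite hΓ (hg i) ?_
  have d₁ : Γ.incidenceGraph.dist (A (i + 1)) (B (i + 8)) = 5 := by
    rw [← hBA₁, hB.dist_eq hΓ]
    ring_nf
    decide
  have dx : Γ.incidenceGraph.dist x (B (i + 8)) = 4 := by
    rw [← hBx, hB.dist_eq hΓ]
    ring_nf
    decide
  rw [SimpleGraph.dist_comm, hΓ.dist_eq_add_one_of_ne hx (hA.2 i).symm hxi.symm
    (y := B (i + 8)) (by omega) (by omega), d₁]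

theorem fixesNeighbours_of_root (hg : ∀ j, g • A j = A j) (i : ZMod 12)
    (h : ∀ k : ℕ, 1 ≤ k → k ≤ 5 → FixesNeighbours g (A (i + k))) (j : ZMod 12) :
    FixesNeighbours g (A j) := by
  have h₀ := fixesNeighbours_of_root_end hΓ ht hA hg i h
  have h₆ : FixesNeighbours g (A (i + 6)) := by
    have := fixesNeighbours_of_root_end hΓ ht (hA.reflect (2 * i + 6)) (fun j => hg _) i
      fun k hk1 hk5 => by
        convert h (6 - k) (by omega) (by omega) using 2
        rw [Nat.cast_sub (by omega)]
        push_cast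
        ring
    convert this using 2
    ring
  have hlow : ∀ k : ℕ, k ≤ 6 → FixesNeighbours g (A (i + k)) := by
    intro k hk
    rcases Nat.eq_zero_or_pos k with rfl | hk0
    · simpa using h₀
    · rcases hk.eq_or_lt with rfl | hk6
      · exact_mod_cast h₆
      · exact h k hk0 (by omega)
  have hval := ZMod.val_lt (j - i)
  obtain ⟨k, hk, rfl⟩ : ∃ k : ℕ, k < 12 ∧ i + k = j := ⟨(j - i).val, hval, by simp⟩
  rcases le_or_gt k 6 with hk6 | hk6
  · exact hlow k hk6
  · refine (hlow (k - 6) (by omega)).of_opposite hΓ (hg _) ?_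
    have := hA.dist_add hΓ (i + (k - 6 : ℕ)) 6 le_rfl
    rwa [add_assoc, ← Nat.cast_add, Nat.sub_add_cancel (by omega)] at this

/-- Apartments fixed together with all neighbours of their elements spread along paths. -/
theorem exists_fixed_apartment (hg : ∀ j, g • A j = A j) (hN : ∀ j, FixesNeighbours g (A j))
    (x : P ⊕ L) : ∃ B : ZMod 12 → P ⊕ L, Γ.IsApartment B ∧ (∀ j, g • B j = B j) ∧
      (∀ j, FixesNeighbours g (B j)) ∧ x ∈ Set.range B := by
  obtain ⟨y, hy⟩ : ∃ y, y = A 0 := ⟨_, rfl⟩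
  obtain ⟨p⟩ := hΓ.connected.preconnected x y
  induction p with
  | nil => exact ⟨A, hA, hg, hN, 0, hy.symm⟩
  | @cons x _ _ hxy _ ih =>
    obtain ⟨B, hB, hgB, hNB, j, rfl⟩ := ih hy
    by_cases hx : x = B (j + 1)
    · exact ⟨B, hB, hgB, hNB, j + 1, hx.symm⟩
    · obtain ⟨C, hC, hCx, hCB⟩ := hB.exists_bend hΓ j hxy.symm hx
      have hgx : g • x = x := hNB j x hxy.symm
      have hgC := smul_eq_of_smul_eq_on_path hΓ hC (g := g) (i := j)
        (fun k hk => by rw [hCB k hk, hgB]) (by rw [hCx, hgx])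
      refine ⟨C, hC, hgC, fixesNeighbours_of_root hΓ ht hC hgC j fun k _ hk5 => ?_, j - 1, hCx⟩
      rw [hCB k (by omega)]
      exact hNB _

theorem eq_one_of_root (hg : ∀ j, g • A j = A j) (i : ZMod 12)
    (h : ∀ k : ℕ, 1 ≤ k → k ≤ 5 → FixesNeighbours g (A (i + k))) : g = 1 := by
  refine collineation_ext fun x => ?_
  obtain ⟨B, -, hgB, -, j, rfl⟩ := exists_fixed_apartment hΓ ht hA hg
    (fixesNeighbours_of_root hΓ ht hA hg i h) x
  rw [hgB, one_smul]

end rigidity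

/-! ### Root groups -/

section rootGroup

variable {A : ZMod 12 → P ⊕ L} {i : ZMod 12} {g : Γ.Collineation}

theorem mem_rootGroup : g ∈ Γ.rootGroup A i ↔
    ∀ k : ℕ, 1 ≤ k → k ≤ 5 → FixesNeighbours g (A (i + k)) := by
  rw [rootGroup, mem_fixingSubgroup_iff]
  constructor
  · intro h k h1 h5 y hy
    exact h y ⟨k, h1, h5, hy⟩
  · rintro h y ⟨k, h1, h5, hy⟩
    exact h k h1 h5 y hy

theorem smul_of_mem_rootGroup_of_adj (hg : g ∈ Γ.rootGroup A i) (j : ZMod 12)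
    (hj : 1 ≤ (j - i).val ∧ (j - i).val ≤ 5) {y : P ⊕ L}
    (hy : Γ.incidenceGraph.Adj (A j) y) : g • y = y :=
  mem_rootGroup.1 hg (j - i).val hj.1 hj.2 y (by rwa [ZMod.natCast_zmod_val, add_sub_cancel])

theorem smul_of_mem_rootGroup (hA : Γ.IsApartment A) (hg : g ∈ Γ.rootGroup A i) (j : ZMod 12)
    (hj : (j - i).val ≤ 6) : g • A j = A j := by
  have hval : ∀ i j : ZMod 12, (j - i).val ≤ 6 →
      (1 ≤ (j + 1 - i).val ∧ (j + 1 - i).val ≤ 5) ∨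
      (1 ≤ (j - 1 - i).val ∧ (j - 1 - i).val ≤ 5) := by decide
  rcases hval i j hj with h | h
  · exact smul_of_mem_rootGroup_of_adj hg _ h (hA.2 j).symm
  · have hadj := hA.2 (j - 1)
    rw [sub_add_cancel] at hadj
    exact smul_of_mem_rootGroup_of_adj hg _ h hadj

theorem eq_one_of_mem_rootGroup (hΓ : Γ.IsGeneralisedHexagon) (ht : Γ.IsThick)
    (hA : Γ.IsApartment A) (hg : g ∈ Γ.rootGroup A i) (h : g • A (i - 1) = A (i - 1)) :
    g = 1 := by
  refine eq_one_of_root hΓ ht hA (smul_eq_of_smul_eq_on_path hΓ hA (fun k hk => ?_) h) i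
    (mem_rootGroup.1 hg)
  refine smul_of_mem_rootGroup hA hg _ ?_
  rw [add_sub_cancel_left, ZMod.val_natCast]
  omega

theorem rootGroup_reflect (A : ZMod 12 → P ⊕ L) (c i : ZMod 12) :
    Γ.rootGroup (fun j => A (c - j)) i = Γ.rootGroup A (c - i - 6) := by
  have hle (A : ZMod 12 → P ⊕ L) (i : ZMod 12) :
      Γ.rootGroup A (c - i - 6) ≤ Γ.rootGroup (fun j => A (c - j)) i := by
    intro g hg
    rw [mem_rootGroup] at hg ⊢
    intro k h1 h5
    convert hg (6 - k) (by omega) (by omega) using 2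
    rw [Nat.cast_sub (by omega)]
    push_cast
    ring
  refine le_antisymm ?_ (hle A i)
  have h := hle (fun j => A (c - j)) (c - i - 6)
  simp only [sub_sub_cancel] at h
  rwa [show c - (c - i - 6) - 6 = i by ring] at h

theorem eq_one_of_mem_rootGroup_of_smul_add_seven (hΓ : Γ.IsGeneralisedHexagon) (ht : Γ.IsThick)
    (hA : Γ.IsApartment A) (hg : g ∈ Γ.rootGroup A i) (h : g • A (i + 7) = A (i + 7)) :
    g = 1 := by
  refine eq_one_of_mem_rootGroup (i := i) hΓ ht (hA.reflect (2 * i + 6)) ?_ ?_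
  · rwa [rootGroup_reflect, show 2 * i + 6 - i - 6 = i by ring]
  · rwa [show 2 * i + 6 - (i - 1) = i + 7 by ring]

theorem conj_mem_rootGroup {B : ZMod 12 → P ⊕ L} {j : ZMod 12} {n : Γ.Collineation}
    (hg : g ∈ Γ.rootGroup A i)
    (h : ∀ k : ℕ, 1 ≤ k → k ≤ 5 → ∃ k' : ℕ, 1 ≤ k' ∧ k' ≤ 5 ∧ B (j + k) = n • A (i + k')) :
    n * g * n⁻¹ ∈ Γ.rootGroup B j := by
  rw [mem_rootGroup] at hg ⊢
  intro k h1 h5 y hy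
  obtain ⟨k', h1', h5', hB⟩ := h k h1 h5
  rw [hB] at hy
  have := hg k' h1' h5' (n⁻¹ • y) (by rw [← smul_adj n]; simpa using hy)
  rw [mul_smul, mul_smul, this, smul_inv_smul]

end rootGroup

namespace IsMoufangHexagon

variable (hΓ : Γ.IsMoufangHexagon) {A B : ZMod 12 → P ⊕ L}
include hΓ

theorem exists_mem_rootGroup_smul_eq (hA : Γ.IsApartment A) (i : ZMod 12) {x y : P ⊕ L}
    (hx : Γ.incidenceGraph.Adj (A i) x) (hx' : x ≠ A (i - 1))
    (hy : Γ.incidenceGraph.Adj (A i) y) (hy' : y ≠ A (i - 1)) :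
    ∃ g ∈ Γ.rootGroup A (i - 6), g • x = y := by
  have hend : 2 * i - i = i := by ring
  have hprev : 2 * i - (i + 1) = i - 1 := by ring
  have := hΓ.moufang _ (hA.reflect (2 * i)) i x y (by rwa [hend]) (by rwa [hprev])
    (by rwa [hend]) (by rwa [hprev])
  rwa [rootGroup_reflect, hend] at this

theorem exists_smul_eq_on_path_succ (hA : Γ.IsApartment A) (hB : Γ.IsApartment B) {i : ZMod 12}
    {n : ℕ} (hn : n ≤ 5) (h : ∀ k : ℕ, k ≤ n + 1 → A (i + k) = B (i + k)) :
    ∃ g : Γ.Collineation, ∀ k : ℕ, k ≤ n + 2 → g • A (i + k) = B (i + k) := by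
  have hend := h (n + 1) le_rfl
  have hprev := h n (by omega)
  have cast_prev : i + ((n + 1 : ℕ) : ZMod 12) - 1 = i + n := by push_cast; ring
  have cast_next : i + ((n + 1 : ℕ) : ZMod 12) + 1 = i + (n + 2 : ℕ) := by push_cast; ring
  have cast_add_two : i + (n : ZMod 12) + 2 = i + (n + 2 : ℕ) := by push_cast; ring
  have hadjA := hA.2 (i + (n + 1 : ℕ))
  have hadjB := hB.2 (i + (n + 1 : ℕ))
  have hneA := hA.ne_add_two (i + n)
  have hneB := hB.ne_add_two (i + n)
  rw [cast_next] at hadjA hadjB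
  rw [cast_add_two] at hneA hneB
  obtain ⟨u, hu, hsmul⟩ := hΓ.exists_mem_rootGroup_smul_eq hA (i + (n + 1 : ℕ)) hadjA
    (by rwa [cast_prev]) (by rwa [hend]) (by rwa [cast_prev, hprev])
  refine ⟨u, fun k hk => ?_⟩
  rcases Nat.lt_or_ge k (n + 2) with hk' | hk'
  · rw [← h k (by omega)]
    refine smul_of_mem_rootGroup hA hu (i + k) ?_
    have : i + k - (i + (n + 1 : ℕ) - 6) = ((5 + k - n : ℕ) : ZMod 12) := by
      rw [Nat.cast_sub (by omega)]
      push_cast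
      ring
    rw [this, ZMod.val_natCast]
    omega
  · obtain rfl : k = n + 2 := by omega
    exact hsmul

theorem exists_smul_eq_of_flag (hA : Γ.IsApartment A) (hB : Γ.IsApartment B)
    (h6 : A 6 = B 6) (h7 : A 7 = B 7) : ∃ g : Γ.Collineation, ∀ j, g • A j = B j := by
  have exists_smul_eq_on_path (n : ℕ) (hn : n ≤ 6) :
      ∃ g : Γ.Collineation, ∀ k : ℕ, k ≤ n + 1 → g • A (6 + k) = B (6 + k) := by
    induction n with
    | zero =>
      refine ⟨1, fun k hk => ?_⟩
      rw [one_smul]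
      interval_cases k
      · simpa using h6
      · norm_num
        exact h7
    | succ n ih =>
      obtain ⟨g, hg⟩ := ih (by omega)
      obtain ⟨u, hu⟩ := hΓ.exists_smul_eq_on_path_succ (hA.smul g) hB (by omega) hg
      exact ⟨u * g, fun k hk => by rw [mul_smul]; exact hu k hk⟩
  obtain ⟨g, hg⟩ := exists_smul_eq_on_path 6 le_rfl
  refine ⟨g, congrFun ((hA.smul g).eq_of_eq_on_path hB hΓ.hexagon (i := 7) (fun k hk => ?_) ?_)⟩
  · have := hg (k + 1) (by omega)
    rwa [show (6 : ZMod 12) + (k + 1 : ℕ) = 7 + k by push_cast; ring] at this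
  · have := hg 0 (by omega)
    rwa [show (6 : ZMod 12) + (0 : ℕ) = 7 - 1 by decide] at this

theorem exists_isApartment_of_adj {x y : P ⊕ L} (h : Γ.incidenceGraph.Adj x y) :
    ∃ A : ZMod 12 → P ⊕ L, Γ.IsApartment A ∧ A 0 = x ∧ A 1 = y := by
  have exists_next (x y : P ⊕ L) : ∃ z, Γ.incidenceGraph.Adj y z ∧ z ≠ x := by
    obtain ⟨z, hyz, hzx, -⟩ := hΓ.thick.exists_adj_ne_ne y x x
    exact ⟨z, hyz, hzx⟩
  choose next adj_next next_ne using exists_next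
  let c : ℕ → (P ⊕ L) × (P ⊕ L) := fun n => (fun p => (p.2, next p.1 p.2))^[n] (x, y)
  have c_succ (n : ℕ) : c (n + 1) = ((c n).2, next (c n).1 (c n).2) :=
    Function.iterate_succ_apply' _ _ _
  have hadj (n : ℕ) : Γ.incidenceGraph.Adj (c n).1 (c n).2 := by
    induction n with
    | zero => exact h
    | succ n _ => rw [c_succ]; exact adj_next _ _
  obtain ⟨A, hA, hAc⟩ := hΓ.hexagon.exists_isApartment_of_path (c := fun n => (c n).1)
    (fun n _ => by simpa [c_succ] using hadj n)
    (fun n _ => by simpa [c_succ] using next_ne _ _)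
  refine ⟨A, hA, by simpa [c] using hAc 0 (by omega), ?_⟩
  simpa [c_succ, c] using hAc 1 (by omega)

theorem exists_smul_eq_of_adj {x y y' : P ⊕ L} (hy : Γ.incidenceGraph.Adj x y)
    (hy' : Γ.incidenceGraph.Adj x y') : ∃ g : Γ.Collineation, g • x = x ∧ g • y = y' := by
  obtain ⟨w, hw, hwy, hwy'⟩ := hΓ.thick.exists_adj_ne_ne x y y'
  obtain ⟨A, hA, rfl, rfl⟩ := hΓ.exists_isApartment_of_adj hw
  obtain ⟨g, hg, hgy⟩ := hΓ.moufang A hA 0 y y' hy hwy.symm hy' hwy'.symm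
  exact ⟨g, smul_of_mem_rootGroup hA hg 0 (by decide), hgy⟩

theorem exists_smul_eq_or {x₀ y₀ : P ⊕ L} (h : Γ.incidenceGraph.Adj x₀ y₀) (x : P ⊕ L) :
    ∃ g : Γ.Collineation, x = g • x₀ ∨ x = g • y₀ := by
  obtain ⟨p⟩ := hΓ.hexagon.connected.preconnected x x₀
  induction p with
  | nil => exact ⟨1, Or.inl (one_smul _ _).symm⟩
  | cons hxy _ ih =>
    obtain ⟨g, hg⟩ := ih h
    have hyx := (smul_adj g⁻¹).2 hxy.symm
    rcases hg with hg | hg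
    · rw [hg, inv_smul_smul] at hyx
      obtain ⟨k, -, hk⟩ := hΓ.exists_smul_eq_of_adj h hyx
      exact ⟨g * k, Or.inr (by rw [mul_smul, hk, smul_inv_smul])⟩
    · rw [hg, inv_smul_smul] at hyx
      obtain ⟨k, -, hk⟩ := hΓ.exists_smul_eq_of_adj h.symm hyx
      exact ⟨g * k, Or.inl (by rw [mul_smul, hk, smul_inv_smul])⟩

theorem exists_smul_eq (hA : Γ.IsApartment A) (hB : Γ.IsApartment B)
    (h : (A 7).isLeft = (B 7).isLeft) : ∃ g : Γ.Collineation, ∀ j, g • A j = B j := by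
  have hA7 : Γ.incidenceGraph.Adj (A 7) (A 6) := (hA.2 6).symm
  have hB7 : Γ.incidenceGraph.Adj (B 7) (B 6) := (hB.2 6).symm
  obtain ⟨g, hg⟩ := hΓ.exists_smul_eq_or hA7 (B 7)
  have hgA7 : B 7 = g • A 7 := by
    refine hg.resolve_right fun hgA6 => isLeft_ne_of_adj hA7 ?_
    rw [h, hgA6, isLeft_smul]
  have hgA6 := (smul_adj g).2 hA7
  rw [← hgA7] at hgA6
  obtain ⟨k, hk7, hk6⟩ := hΓ.exists_smul_eq_of_adj hgA6 hB7
  obtain ⟨m, hm⟩ := hΓ.exists_smul_eq_of_flag (hA.smul (k * g)) hB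
    (by rw [mul_smul, hk6]) (by rw [mul_smul, ← hgA7, hk7])
  exact ⟨m * (k * g), fun j => by rw [mul_smul]; exact hm j⟩

end IsMoufangHexagon

/-! ### Collineations fixing an ovoid pointwise -/

theorem IsOvoid.exists_dist_eq_two (hΓ : Γ.IsGeneralisedHexagon) {O : Set P} (hO : Γ.IsOvoid O)
    {o : P} (ho : o ∈ O) {y : P ⊕ L} (hy : Γ.incidenceGraph.dist y (.inl o) = 4) :
    ∃ o' ∈ O, Γ.incidenceGraph.dist y (.inl o') = 2 ∧
      Γ.incidenceGraph.dist (.inl o' : P ⊕ L) (.inl o) = 6 := by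
  obtain ⟨o', ho', hd⟩ := hO.2 y
  have hne : o' ≠ o := by
    rintro rfl
    omega
  have h6 : Γ.incidenceGraph.dist (.inl o' : P ⊕ L) (.inl o) = 6 := hO.1 o' ho' o ho hne
  have htri := hΓ.connected.dist_triangle (u := (.inl o' : P ⊕ L)) (v := y) (w := .inl o)
  rw [SimpleGraph.dist_comm (v := y)] at htri
  have hpoint : y.isLeft = true ↔ (Sum.inl o : P ⊕ L).isLeft = true :=
    (hΓ.even_dist_iff y (.inl o)).1 (by rw [hy]; decide)
  obtain ⟨m, hm⟩ := (hΓ.even_dist_iff y (.inl o')).2 hpoint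
  exact ⟨o', ho', by omega, h6⟩

/-- `x` lies outside the ovoid `O`, and `N` is a line fixed by `g` that joins `x` to a point of
`O`. This is the state of the walk along which the fixed elements of `g` spread. -/
def IsTangentFixed (Γ : PointLineGeometry P L) (O : Set P) (g : Γ.Collineation) (x N : P ⊕ L) :
    Prop :=
  ∃ o ∈ O, Γ.incidenceGraph.Adj N (.inl o) ∧ Γ.incidenceGraph.Adj N x ∧ x ≠ .inl o ∧ g • N = N

section ovoid

variable (hΓ : Γ.IsGeneralisedHexagon) {O : Set P} (hO : Γ.IsOvoid O) {g : Γ.Collineation}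
  (hfix : ∀ p ∈ O, g • (Sum.inl p : P ⊕ L) = Sum.inl p)
include hΓ hO hfix

/-- The point `y` is at distance `4` from the ovoid point `o` on `N`, hence at distance `2` from a
second one `o'`, and `(N, x, M, y, N', o')` is a geodesic with fixed ends. -/
theorem IsTangentFixed.step {x N M y : P ⊕ L} (h : IsTangentFixed Γ O g x N)
    (hM : Γ.incidenceGraph.Adj x M) (hMN : M ≠ N) (hy : Γ.incidenceGraph.Adj M y) (hyx : y ≠ x) :
    g • x = x ∧ g • M = M ∧ g • y = y ∧ ∃ N', IsTangentFixed Γ O g y N' := by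
  obtain ⟨o, ho, hNo, hNx, hxo, hgN⟩ := h
  have dN := SimpleGraph.dist_eq_one_iff_adj.2 hNo
  have dx := hΓ.dist_eq_add_one_of_ne hNo hNx hxo (y := .inl o) (by omega) (by simp [dN])
  have dM := hΓ.dist_eq_add_one_of_ne hNx.symm hM hMN (y := .inl o) (by omega) (by omega)
  have dy := hΓ.dist_eq_add_one_of_ne hM.symm hy hyx (y := .inl o) (by omega) (by omega)
  obtain ⟨o', ho', dy', d6⟩ := hO.exists_dist_eq_two hΓ ho (y := y) (by omega)
  obtain ⟨N', hyN', dN'⟩ := hΓ.exists_adj_dist_eq dy'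
  have hyo : y ≠ .inl o' := by
    rintro rfl
    omega
  have hMN' : M ≠ N' := by
    rintro rfl
    have := hΓ.connected.dist_triangle (u := (.inl o' : P ⊕ L)) (v := M) (w := .inl o)
    rw [SimpleGraph.dist_comm (v := M)] at this
    omega
  have dM' := hΓ.dist_eq_add_one_of_ne hyN' hy.symm hMN' (y := .inl o') (by omega) (by omega)
  have dx' := hΓ.dist_eq_add_one_of_ne hy hM.symm hyx.symm (y := .inl o') (by omega) (by omega)
  have dN'' := hΓ.dist_eq_add_one_of_ne hM hNx.symm hMN.symm (y := .inl o') (by omega) (by omega)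
  have hgo' := hfix o' ho'
  have hgx := smul_proj hΓ hgN hgo' hNx (by omega) (by omega)
  have hgM := smul_proj hΓ hgx hgo' hM (by omega) (by omega)
  have hgy := smul_proj hΓ hgM hgo' hy (by omega) (by omega)
  have hgN' := smul_proj hΓ hgy hgo' hyN' (by omega) (by omega)
  exact ⟨hgx, hgM, hgy, N', o', ho', SimpleGraph.dist_eq_one_iff_adj.1 dN', hyN'.symm, hyo, hgN'⟩

theorem IsTangentFixed.exists_step (ht : Γ.IsThick) {x N : P ⊕ L} (h : IsTangentFixed Γ O g x N)
    (M₀ : P ⊕ L) : ∃ M y N', Γ.incidenceGraph.Adj x M ∧ M ≠ M₀ ∧ Γ.incidenceGraph.Adj M y ∧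
      y ≠ x ∧ FixesNeighbours g x ∧ FixesNeighbours g M ∧ IsTangentFixed Γ O g y N' := by
  obtain ⟨M, hM, hMN, hMM₀⟩ := ht.exists_adj_ne_ne x N M₀
  obtain ⟨y, hy, hyx, -⟩ := ht.exists_adj_ne_ne M x x
  obtain ⟨hgx, -, -, N', hy'⟩ := h.step hΓ hO hfix hM hMN hy hyx
  refine ⟨M, y, N', hM, hMM₀, hy, hyx, fun M' hM' => ?_, fun y' hy' => ?_, hy'⟩
  · by_cases hM'N : M' = N
    · obtain ⟨_, _, _, _, _, hgN⟩ := h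
      rwa [hM'N]
    · obtain ⟨y', hy', hyx', -⟩ := ht.exists_adj_ne_ne M' x x
      exact (h.step hΓ hO hfix hM' hM'N hy' hyx').2.1
  · by_cases hyx' : y' = x
    · rwa [hyx']
    · exact (h.step hΓ hO hfix hM hMN hy' hyx').2.2.1

theorem eq_one_of_fixes_ovoid (ht : Γ.IsThick) {p : P} (hp : p ∈ O) {l : P ⊕ L}
    (hl : Γ.incidenceGraph.Adj (.inl p) l) (hgl : g • l = l) : g = 1 := by
  obtain ⟨q, hq, hqp, -⟩ := ht.exists_adj_ne_ne l (.inl p) (.inl p)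
  have tangent₁ : IsTangentFixed Γ O g q l := ⟨p, hp, hl.symm, hq, hqp, hgl⟩
  obtain ⟨m₁, r₁, n₁, hm₁, hm₁l, hr₁, hr₁q, -, fix_m₁, tangent₂⟩ :=
    tangent₁.exists_step hΓ hO hfix ht l
  obtain ⟨m₂, r₂, n₂, hm₂, hm₂m, hr₂, hr₂r, fix_r₁, fix_m₂, tangent₃⟩ :=
    tangent₂.exists_step hΓ hO hfix ht m₁
  obtain ⟨m₃, r₃, -, hm₃, hm₃m, hr₃, hr₃r, fix_r₂, fix_m₃, -⟩ :=
    tangent₃.exists_step hΓ hO hfix ht m₂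
  let c : ℕ → P ⊕ L := fun n => match n with
    | 0 => l | 1 => q | 2 => m₁ | 3 => r₁ | 4 => m₂ | 5 => r₂ | 6 => m₃ | _ => r₃
  obtain ⟨A, hA, hAc⟩ := hΓ.exists_isApartment_of_path (c := c)
    (by intro n hn; interval_cases n <;> assumption)
    (by
      intro n hn
      replace hn : n ≤ 5 := by omega
      interval_cases n <;> assumption)
  refine eq_one_of_mem_rootGroup hΓ ht hA (i := 1) (mem_rootGroup.2 fun k hk1 hk5 => ?_) ?_
  · have hAk := hAc (1 + k) (by omega)
    rw [Nat.cast_add, Nat.cast_one] at hAk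
    rw [hAk]
    interval_cases k <;> assumption
  · have hA0 := hAc 0 (by omega)
    rwa [show (1 : ZMod 12) - 1 = (0 : ℕ) by decide, hA0]

end ovoid

end PointLineGeometry

/-! ### Hexagonal systems and their commutator relations -/

namespace HexagonalSystem

variable {F : Type w} {J : Type z} [Field F] [AddCommGroup J] [Module F J]
  (S : HexagonalSystem F J)

theorem adj_neg (a : J) : S.adj (-a) = S.adj a := by
  simpa using S.adj_smul (-1) a

theorem norm_neg (a : J) : S.norm (-a) = -S.norm a := by
  simpa [Odd.neg_one_pow (by decide : Odd 3)] using S.norm_smul (-1) a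

theorem adj_zero : S.adj 0 = 0 := by simpa using S.adj_smul 0 0

theorem norm_zero : S.norm 0 = 0 := (S.norm_eq_zero 0).2 rfl

theorem norm_ne_zero {a : J} (ha : a ≠ 0) : S.norm a ≠ 0 := mt (S.norm_eq_zero a).1 ha

theorem adj_ne_zero {a : J} (ha : a ≠ 0) : S.adj a ≠ 0 := fun h =>
  smul_ne_zero (S.norm_ne_zero ha) ha (by rw [← S.adj_adj, h, S.adj_zero])

theorem cross_self (a : J) : S.cross a a = (2 : F) • S.adj a := by
  have h := S.adj_add a a
  rw [← two_smul F a, S.adj_smul] at h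
  calc S.cross a a = (2 ^ 2 : F) • S.adj a - S.adj a - S.adj a := by rw [h]; abel
    _ = (2 : F) • S.adj a := by module

theorem norm_one : S.norm S.one = 1 := by
  refine smul_left_injective F S.one_ne_zero ?_
  simp only [← S.adj_adj, S.adj_one, one_smul]

theorem norm_adj (a : J) : S.norm (S.adj a) = S.norm a ^ 2 := by
  rcases eq_or_ne a 0 with rfl | ha
  · simp [S.adj_zero, S.norm_zero]
  · refine smul_left_injective F (S.adj_ne_zero ha) ?_
    simp only [← S.adj_adj (S.adj a), S.adj_adj a, S.adj_smul]

end HexagonalSystem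

/-- Six families of elements of a group `H` that satisfy the commutator relations of the
hexagonal system `S`. Nothing is said about the action on a hexagon, so that two such families
in different groups give a third one in the product. -/
structure RootData {F : Type w} {J : Type z} [Field F] [AddCommGroup J] [Module F J]
    (S : HexagonalSystem F J) (H : Type*) [Group H] where
  x₁ : J → H
  x₂ : F → H
  x₃ : J → H
  x₄ : F → H
  x₅ : J → H
  x₆ : F → H
  add₁ : ∀ a b, x₁ (a + b) = x₁ a * x₁ b
  add₂ : ∀ a b, x₂ (a + b) = x₂ a * x₂ b
  add₃ : ∀ a b, x₃ (a + b) = x₃ a * x₃ b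
  add₄ : ∀ a b, x₄ (a + b) = x₄ a * x₄ b
  add₅ : ∀ a b, x₅ (a + b) = x₅ a * x₅ b
  add₆ : ∀ a b, x₆ (a + b) = x₆ a * x₆ b
  comm₁₂ : ∀ a t, groupComm (x₁ a) (x₂ t) = 1
  comm₁₃ : ∀ a b, groupComm (x₁ a) (x₃ b) = x₂ (S.tr a b)
  comm₁₄ : ∀ a t, groupComm (x₁ a) (x₄ t) = 1
  comm₁₅ : ∀ a b, groupComm (x₁ a) (x₅ b) =
    x₂ (-S.tr (S.adj a) b) * x₃ (S.cross a b) * x₄ (S.tr a (S.adj b))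
  comm₁₆ : ∀ a t, groupComm (x₁ a) (x₆ t) =
    x₂ (-(t * S.norm a)) * x₃ (t • S.adj a) * x₄ (t ^ 2 * S.norm a) * x₅ (-(t • a))
  comm₂₃ : ∀ t a, groupComm (x₂ t) (x₃ a) = 1
  comm₂₄ : ∀ t u, groupComm (x₂ t) (x₄ u) = 1
  comm₂₅ : ∀ t a, groupComm (x₂ t) (x₅ a) = 1
  comm₂₆ : ∀ t u, groupComm (x₂ t) (x₆ u) = x₄ (t * u)
  comm₃₄ : ∀ a t, groupComm (x₃ a) (x₄ t) = 1
  comm₃₅ : ∀ a b, groupComm (x₃ a) (x₅ b) = x₄ (S.tr a b)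
  comm₃₆ : ∀ a t, groupComm (x₃ a) (x₆ t) = 1
  comm₄₅ : ∀ t a, groupComm (x₄ t) (x₅ a) = 1
  comm₄₆ : ∀ t u, groupComm (x₄ t) (x₆ u) = 1
  comm₅₆ : ∀ a t, groupComm (x₅ a) (x₆ t) = 1

theorem mul_eq_of_groupComm {H : Type*} [Group H] {g h k : H} (e : groupComm g h = k) :
    h * g = g * h * k⁻¹ := by
  rw [← e, groupComm]
  group

theorem mul_eq_of_groupComm_one {H : Type*} [Group H] {g h : H} (e : groupComm g h = 1) :
    h * g = g * h := by
  rw [mul_eq_of_groupComm e, inv_one, mul_one]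

theorem conj_eq_of_groupComm {H : Type*} [Group H] {g h k : H} (e : groupComm g⁻¹ h = k) :
    g * h * g⁻¹ = h * k⁻¹ := by
  rw [← e, groupComm]
  group

theorem map_zero_of_map_add {H M : Type*} [Group H] [AddCommGroup M] {x : M → H}
    (h : ∀ a b, x (a + b) = x a * x b) : x 0 = 1 := by
  simpa using h 0 0

theorem map_neg_of_map_add {H M : Type*} [Group H] [AddCommGroup M] {x : M → H}
    (h : ∀ a b, x (a + b) = x a * x b) (a : M) : x (-a) = (x a)⁻¹ := by
  rw [eq_inv_iff_mul_eq_one, ← h, neg_add_cancel, map_zero_of_map_add h]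

namespace RootData

variable {F : Type w} {J : Type z} [Field F] [AddCommGroup J] [Module F J]
  {S : HexagonalSystem F J} {H : Type*} [Group H] (D : RootData S H)

theorem x₁_neg (a : J) : D.x₁ (-a) = (D.x₁ a)⁻¹ := map_neg_of_map_add D.add₁ a

theorem x₂_neg (a : F) : D.x₂ (-a) = (D.x₂ a)⁻¹ := map_neg_of_map_add D.add₂ a

theorem x₃_neg (a : J) : D.x₃ (-a) = (D.x₃ a)⁻¹ := map_neg_of_map_add D.add₃ a

theorem x₄_neg (a : F) : D.x₄ (-a) = (D.x₄ a)⁻¹ := map_neg_of_map_add D.add₄ a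

theorem x₅_neg (a : J) : D.x₅ (-a) = (D.x₅ a)⁻¹ := map_neg_of_map_add D.add₅ a

theorem x₁_zero : D.x₁ 0 = 1 := map_zero_of_map_add D.add₁

theorem x₂_zero : D.x₂ 0 = 1 := map_zero_of_map_add D.add₂

theorem x₃_zero : D.x₃ 0 = 1 := map_zero_of_map_add D.add₃

theorem x₄_zero : D.x₄ 0 = 1 := map_zero_of_map_add D.add₄

theorem x₅_zero : D.x₅ 0 = 1 := map_zero_of_map_add D.add₅

theorem x₆_zero : D.x₆ 0 = 1 := map_zero_of_map_add D.add₆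

/-- The element of `U₂ U₃ U₄ U₅ U₆` with the given coordinates. -/
def tail (t : F) (a : J) (r : F) (b : J) (u : F) : H :=
  D.x₂ t * D.x₃ a * D.x₄ r * D.x₅ b * D.x₆ u

theorem x₂_eq_tail (t : F) : D.x₂ t = D.tail t 0 0 0 0 := by
  simp [tail, x₃_zero, x₄_zero, x₅_zero, x₆_zero]

theorem x₃_eq_tail (a : J) : D.x₃ a = D.tail 0 a 0 0 0 := by
  simp [tail, x₂_zero, x₄_zero, x₅_zero, x₆_zero]

theorem x₄_eq_tail (r : F) : D.x₄ r = D.tail 0 0 r 0 0 := by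
  simp [tail, x₂_zero, x₃_zero, x₅_zero, x₆_zero]

theorem x₅_eq_tail (b : J) : D.x₅ b = D.tail 0 0 0 b 0 := by
  simp [tail, x₂_zero, x₃_zero, x₄_zero, x₆_zero]

theorem x₆_eq_tail (u : F) : D.x₆ u = D.tail 0 0 0 0 u := by
  simp [tail, x₂_zero, x₃_zero, x₄_zero, x₅_zero]

theorem tail_zero : D.tail 0 0 0 0 0 = 1 := by rw [← x₂_eq_tail, x₂_zero]

theorem tail_mul_x₆ (t : F) (a : J) (r : F) (b : J) (u u' : F) :
    D.tail t a r b u * D.x₆ u' = D.tail t a r b (u + u') := by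
  simp only [tail, D.add₆, mul_assoc]

theorem tail_mul_x₅ (t : F) (a : J) (r : F) (b : J) (u : F) (b' : J) :
    D.tail t a r b u * D.x₅ b' = D.tail t a r (b + b') u := by
  simp only [tail, D.add₅, mul_assoc, mul_eq_of_groupComm_one (D.comm₅₆ b' u)]

theorem tail_mul_x₄ (t : F) (a : J) (r : F) (b : J) (u r' : F) :
    D.tail t a r b u * D.x₄ r' = D.tail t a (r + r') b u := by
  simp only [tail]
  rw [mul_assoc _ (D.x₆ u), mul_eq_of_groupComm_one (D.comm₄₆ r' u), ← mul_assoc,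
    mul_assoc _ (D.x₅ b), mul_eq_of_groupComm_one (D.comm₄₅ r' b), ← mul_assoc,
    mul_assoc _ (D.x₄ r), ← D.add₄]

theorem tail_mul_x₃ (t : F) (a : J) (r : F) (b : J) (u : F) (a' : J) :
    D.tail t a r b u * D.x₃ a' = D.tail t (a + a') (r - S.tr a' b) b u := by
  have h : D.tail t a r b u * D.x₃ a' = D.tail t (a + a') r b u * D.x₄ (-S.tr a' b) := by
    simp only [tail]
    rw [mul_assoc _ (D.x₆ u), mul_eq_of_groupComm_one (D.comm₃₆ a' u), ← mul_assoc,
      mul_assoc _ (D.x₅ b), mul_eq_of_groupComm (D.comm₃₅ a' b), ← mul_assoc, ← mul_assoc,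
      mul_assoc _ (D.x₄ r), mul_eq_of_groupComm_one (D.comm₃₄ a' r), ← mul_assoc,
      mul_assoc (D.x₂ t), ← D.add₃, ← D.x₄_neg, mul_assoc _ (D.x₆ u),
      mul_eq_of_groupComm_one (D.comm₄₆ _ u), ← mul_assoc]
  rw [h, tail_mul_x₄, ← sub_eq_add_neg]

theorem tail_mul_x₂ (t : F) (a : J) (r : F) (b : J) (u t' : F) :
    D.tail t a r b u * D.x₂ t' = D.tail (t + t') a (r - t' * u) b u := by
  have h : D.tail t a r b u * D.x₂ t' = D.tail (t + t') a r b u * D.x₄ (-(t' * u)) := by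
    simp only [tail]
    rw [mul_assoc _ (D.x₆ u), mul_eq_of_groupComm (D.comm₂₆ t' u), ← mul_assoc, ← mul_assoc,
      mul_assoc _ (D.x₅ b), mul_eq_of_groupComm_one (D.comm₂₅ t' b), ← mul_assoc,
      mul_assoc _ (D.x₄ r), mul_eq_of_groupComm_one (D.comm₂₄ t' r), ← mul_assoc,
      mul_assoc _ (D.x₃ a), mul_eq_of_groupComm_one (D.comm₂₃ t' a), ← mul_assoc,
      ← D.add₂, ← D.x₄_neg]
  rw [h, tail_mul_x₄, ← sub_eq_add_neg]

theorem tail_mul_tail (t : F) (a : J) (r : F) (b : J) (u t' : F) (a' : J) (r' : F) (b' : J)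
    (u' : F) : D.tail t a r b u * D.tail t' a' r' b' u' =
      D.tail (t + t') (a + a') (r + r' - S.tr a' b - t' * u) (b + b') (u + u') := by
  rw [show D.tail t' a' r' b' u' = D.x₂ t' * D.x₃ a' * D.x₄ r' * D.x₅ b' * D.x₆ u' from rfl]
  simp only [← mul_assoc]
  rw [tail_mul_x₂, tail_mul_x₃, tail_mul_x₄, tail_mul_x₅, tail_mul_x₆]
  congr 1
  ring

theorem tail_inv (t : F) (a : J) (r : F) (b : J) (u : F) :
    (D.tail t a r b u)⁻¹ = D.tail (-t) (-a) (-r - S.tr a b - t * u) (-b) (-u) := by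
  rw [inv_eq_iff_mul_eq_one, tail_mul_tail, ← D.tail_zero]
  congr 1 <;> simp
  ring

theorem conj₂ (c : J) (t : F) : D.x₁ c * D.x₂ t * (D.x₁ c)⁻¹ = D.tail t 0 0 0 0 := by
  rw [conj_eq_of_groupComm (k := 1) (by rw [← x₁_neg, comm₁₂]), inv_one, mul_one, x₂_eq_tail]

theorem conj₄ (c : J) (t : F) : D.x₁ c * D.x₄ t * (D.x₁ c)⁻¹ = D.tail 0 0 t 0 0 := by
  rw [conj_eq_of_groupComm (k := 1) (by rw [← x₁_neg, comm₁₄]), inv_one, mul_one, x₄_eq_tail]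

theorem conj₃ (c b : J) : D.x₁ c * D.x₃ b * (D.x₁ c)⁻¹ = D.tail (S.tr c b) b 0 0 0 := by
  rw [conj_eq_of_groupComm (k := _) (by rw [← x₁_neg, comm₁₃]), ← x₂_neg, x₂_eq_tail,
    x₃_eq_tail, tail_mul_tail]
  congr 1 <;> simp

theorem conj₅ (c b : J) : D.x₁ c * D.x₅ b * (D.x₁ c)⁻¹ =
    D.tail (S.tr (S.adj c) b) (S.cross c b) (-S.tr c (S.adj b)) b 0 := by
  rw [conj_eq_of_groupComm (k := _) (by rw [← x₁_neg, comm₁₅]), mul_inv_rev, mul_inv_rev,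
    ← x₂_neg, ← x₃_neg, ← x₄_neg, x₂_eq_tail, x₃_eq_tail, x₄_eq_tail, x₅_eq_tail, tail_mul_tail,
    tail_mul_tail, tail_mul_tail, S.adj_neg]
  have h : S.tr (S.cross c b) b = 2 * S.tr c (S.adj b) := by
    rw [← S.tr_cross, S.cross_self, map_smul, smul_eq_mul]
  congr 1 <;> simp [h]
  ring

theorem conj₆ (c : J) (t : F) : D.x₁ c * D.x₆ t * (D.x₁ c)⁻¹ =
    D.tail (-(t * S.norm c)) (-(t • S.adj c)) (-(t ^ 2 * S.norm c)) (-(t • c)) t := by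
  rw [conj_eq_of_groupComm (k := _) (by rw [← x₁_neg, comm₁₆]), mul_inv_rev, mul_inv_rev,
    mul_inv_rev, ← x₂_neg, ← x₃_neg, ← x₄_neg, ← x₅_neg, x₂_eq_tail, x₃_eq_tail, x₄_eq_tail,
    x₅_eq_tail, x₆_eq_tail, tail_mul_tail, tail_mul_tail, tail_mul_tail, tail_mul_tail,
    S.adj_neg, S.norm_neg]
  have h : S.tr (S.adj c) c = 3 * S.norm c := by rw [S.tr_symm, S.tr_adj]
  congr 1 <;> simp [h]
  ring

theorem conj_tail (c : J) (t : F) (a : J) (r : F) (b : J) (u : F) :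
    D.x₁ c * D.tail t a r b u * (D.x₁ c)⁻¹ =
      D.tail (t + S.tr c a + S.tr (S.adj c) b - u * S.norm c) (a + S.cross c b - u • S.adj c)
        (r - S.tr c (S.adj b) - u ^ 2 * S.norm c + u * S.tr (S.adj c) b) (b - u • c) u := by
  have h : D.x₁ c * D.tail t a r b u * (D.x₁ c)⁻¹ = (D.x₁ c * D.x₂ t * (D.x₁ c)⁻¹) *
      (D.x₁ c * D.x₃ a * (D.x₁ c)⁻¹) * (D.x₁ c * D.x₄ r * (D.x₁ c)⁻¹) *
      (D.x₁ c * D.x₅ b * (D.x₁ c)⁻¹) * (D.x₁ c * D.x₆ u * (D.x₁ c)⁻¹) := by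
    rw [tail]; group
  rw [h, conj₂, conj₃, conj₄, conj₅, conj₆, tail_mul_tail, tail_mul_tail, tail_mul_tail,
    tail_mul_tail]
  congr 1 <;> simp [sub_eq_add_neg]

theorem exists_tail_mul_x₁ (t : F) (a : J) (r : F) (b : J) (u : F) (c : J) :
    ∃ t' a' r' b' u', D.tail t a r b u * D.x₁ c = D.x₁ c * D.tail t' a' r' b' u' := by
  have h := D.conj_tail (-c) t a r b u
  rw [x₁_neg, inv_inv, mul_assoc, inv_mul_eq_iff_eq_mul] at h
  exact ⟨_, _, _, _, _, h⟩

/-- The subgroup `U₁ U₂ U₃ U₄ U₅ U₆` generated by the six families. -/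
def unipotent : Subgroup H where
  carrier := {g | ∃ c t a r b u, g = D.x₁ c * D.tail t a r b u}
  one_mem' := ⟨0, 0, 0, 0, 0, 0, by rw [x₁_zero, tail_zero, one_mul]⟩
  mul_mem' := by
    rintro _ _ ⟨c, t, a, r, b, u, rfl⟩ ⟨c', t', a', r', b', u', rfl⟩
    obtain ⟨_, _, _, _, _, h⟩ := D.exists_tail_mul_x₁ t a r b u c'
    rw [← mul_assoc, mul_assoc (D.x₁ c), h, ← mul_assoc, ← D.add₁, mul_assoc, tail_mul_tail]
    exact ⟨_, _, _, _, _, _, rfl⟩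
  inv_mem' := by
    rintro _ ⟨c, t, a, r, b, u, rfl⟩
    rw [mul_inv_rev, tail_inv, ← x₁_neg]
    obtain ⟨_, _, _, _, _, h⟩ := D.exists_tail_mul_x₁ (-t) (-a) (-r - S.tr a b - t * u) (-b) (-u)
      (-c)
    exact ⟨_, _, _, _, _, _, h⟩

theorem tail_mem (t : F) (a : J) (r : F) (b : J) (u : F) : D.tail t a r b u ∈ D.unipotent :=
  ⟨0, t, a, r, b, u, by rw [x₁_zero, one_mul]⟩

theorem x₁_mem (a : J) : D.x₁ a ∈ D.unipotent :=
  ⟨a, 0, 0, 0, 0, 0, by rw [tail_zero, mul_one]⟩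

theorem x₂_mem (a : F) : D.x₂ a ∈ D.unipotent := D.x₂_eq_tail a ▸ D.tail_mem ..

theorem x₃_mem (a : J) : D.x₃ a ∈ D.unipotent := D.x₃_eq_tail a ▸ D.tail_mem ..

theorem x₄_mem (a : F) : D.x₄ a ∈ D.unipotent := D.x₄_eq_tail a ▸ D.tail_mem ..

theorem x₅_mem (a : J) : D.x₅ a ∈ D.unipotent := D.x₅_eq_tail a ▸ D.tail_mem ..

theorem x₆_mem (a : F) : D.x₆ a ∈ D.unipotent := D.x₆_eq_tail a ▸ D.tail_mem ..

/-- The diagonal root data in the product of two groups. Its subgroup `unipotent` is the graph of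
a correspondence between the subgroups `unipotent` of the factors. -/
def prod {H' : Type*} [Group H'] (D' : RootData S H') : RootData S (H × H') where
  x₁ a := (D.x₁ a, D'.x₁ a)
  x₂ a := (D.x₂ a, D'.x₂ a)
  x₃ a := (D.x₃ a, D'.x₃ a)
  x₄ a := (D.x₄ a, D'.x₄ a)
  x₅ a := (D.x₅ a, D'.x₅ a)
  x₆ a := (D.x₆ a, D'.x₆ a)
  add₁ a b := Prod.ext (D.add₁ a b) (D'.add₁ a b)
  add₂ a b := Prod.ext (D.add₂ a b) (D'.add₂ a b)
  add₃ a b := Prod.ext (D.add₃ a b) (D'.add₃ a b)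
  add₄ a b := Prod.ext (D.add₄ a b) (D'.add₄ a b)
  add₅ a b := Prod.ext (D.add₅ a b) (D'.add₅ a b)
  add₆ a b := Prod.ext (D.add₆ a b) (D'.add₆ a b)
  comm₁₂ a b := Prod.ext (D.comm₁₂ a b) (D'.comm₁₂ a b)
  comm₁₃ a b := Prod.ext (D.comm₁₃ a b) (D'.comm₁₃ a b)
  comm₁₄ a b := Prod.ext (D.comm₁₄ a b) (D'.comm₁₄ a b)
  comm₁₅ a b := Prod.ext (D.comm₁₅ a b) (D'.comm₁₅ a b)
  comm₁₆ a b := Prod.ext (D.comm₁₆ a b) (D'.comm₁₆ a b)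
  comm₂₃ a b := Prod.ext (D.comm₂₃ a b) (D'.comm₂₃ a b)
  comm₂₄ a b := Prod.ext (D.comm₂₄ a b) (D'.comm₂₄ a b)
  comm₂₅ a b := Prod.ext (D.comm₂₅ a b) (D'.comm₂₅ a b)
  comm₂₆ a b := Prod.ext (D.comm₂₆ a b) (D'.comm₂₆ a b)
  comm₃₄ a b := Prod.ext (D.comm₃₄ a b) (D'.comm₃₄ a b)
  comm₃₅ a b := Prod.ext (D.comm₃₅ a b) (D'.comm₃₅ a b)
  comm₃₆ a b := Prod.ext (D.comm₃₆ a b) (D'.comm₃₆ a b)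
  comm₄₅ a b := Prod.ext (D.comm₄₅ a b) (D'.comm₄₅ a b)
  comm₄₆ a b := Prod.ext (D.comm₄₆ a b) (D'.comm₄₆ a b)
  comm₅₆ a b := Prod.ext (D.comm₅₆ a b) (D'.comm₅₆ a b)

theorem swap_mem_unipotent_prod {H' : Type*} [Group H'] (D' : RootData S H') {g : H × H'}
    (hg : g ∈ (D.prod D').unipotent) : g.swap ∈ (D'.prod D).unipotent := by
  obtain ⟨c, t, a, r, b, u, rfl⟩ := hg
  exact ⟨c, t, a, r, b, u, rfl⟩

end RootData

/-! ### Products of root elements -/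

open PointLineGeometry

namespace PointLineGeometry

variable {P : Type u} {L : Type v} {Γ : PointLineGeometry P L} {A : ZMod 12 → P ⊕ L}

theorem prod_smul_of_forall_mem {l : List Γ.Collineation} {x : P ⊕ L}
    (h : ∀ g ∈ l, g • x = x) : l.prod • x = x := by
  induction l with
  | nil => exact one_smul _ x
  | cons g l ih =>
    rw [List.forall_mem_cons] at h
    rw [List.prod_cons, mul_smul, ih h.2, h.1]

variable (hΓ : Γ.IsGeneralisedHexagon) (ht : Γ.IsThick) (hA : Γ.IsApartment A)
include hΓ ht hA

omit hΓ ht in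
theorem smul_of_mem_rootGroup_add {g : Γ.Collineation} {i : ZMod 12} {k : ℕ}
    (hg : g ∈ Γ.rootGroup A (i + k)) {d : ℕ} (hk : k ≤ d) (hd : d ≤ k + 6) :
    g • A (i + d) = A (i + d) := by
  refine smul_of_mem_rootGroup hA hg _ ?_
  rw [show i + (d : ZMod 12) - (i + k) = ((d - k : ℕ) : ZMod 12) by
    rw [Nat.cast_sub hk]; ring, ZMod.val_natCast]
  omega

theorem forall_mem_smul_eq_of_prod_smul {l : List Γ.Collineation} (hlen : l.length ≤ 6)
    {i : ZMod 12} (hl : ∀ k (hk : k < l.length), l[k] ∈ Γ.rootGroup A (i + k)) {n : ℕ} (hn : n ≤ 5)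
    (h : l.prod • A (i + 6 + n) = A (i + 6 + n)) : ∀ g ∈ l, g • A (i + 6 + n) = A (i + 6 + n) := by
  induction l generalizing i n with
  | nil => simp
  | cons g l ih =>
    rw [List.length_cons] at hlen
    have hroot (d : ℕ) (h6 : 6 ≤ d) (h7 : d ≤ 7) : ∀ g' ∈ l, g' • A (i + d) = A (i + d) := by
      intro g' hg'
      obtain ⟨k, hk, rfl⟩ := List.getElem_of_mem hg'
      exact smul_of_mem_rootGroup_add hA (hl (k + 1) (by simpa using hk)) (by omega) (by omega)
    have hg : g ∈ Γ.rootGroup A (i + (0 : ℕ)) := hl 0 (by simp)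
    have h6 := smul_of_mem_rootGroup_add hA hg (d := 6) (by omega) (by omega)
    cases n with
    | zero =>
      rw [Nat.cast_zero, add_zero, List.forall_mem_cons]
      exact ⟨h6, hroot 6 (by omega) (by omega)⟩
    | succ n =>
      have h7 := smul_eq_between hΓ hA hn (g := (g :: l).prod) (by
        rw [List.prod_cons, mul_smul, show (6 : ZMod 12) = (6 : ℕ) from rfl,
          prod_smul_of_forall_mem (hroot 6 (by omega) (by omega)), h6]) h 1 (by omega)
      obtain rfl : g = 1 := by
        rw [Nat.cast_zero, add_zero] at hg
        refine eq_one_of_mem_rootGroup_of_smul_add_seven hΓ ht hA hg ?_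
        rwa [List.prod_cons, mul_smul, show i + 6 + (1 : ℕ) = i + (7 : ℕ) by push_cast; ring,
          prod_smul_of_forall_mem (hroot 7 (by omega) (by omega))] at h7
      rw [List.prod_cons, one_mul] at h
      rw [List.forall_mem_cons]
      refine ⟨one_smul _ _, ?_⟩
      rw [show i + 6 + (n + 1 : ℕ) = i + 1 + 6 + n by push_cast; ring] at h ⊢
      refine ih (by omega) (fun k hk => ?_) (by omega) h
      have := hl (k + 1) (by simpa using hk)
      rwa [List.getElem_cons_succ, Nat.cast_succ, ← add_assoc, add_right_comm] at this

theorem prod_smul_eq_iff {l : List Γ.Collineation} (hlen : l.length = 6) {i : ZMod 12}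
    (hl : ∀ k (hk : k < l.length), l[k] ∈ Γ.rootGroup A (i + k)) (j : ZMod 12) :
    l.prod • A j = A j ↔ ∀ g ∈ l, g • A j = A j := by
  refine ⟨fun h => ?_, prod_smul_of_forall_mem⟩
  have hj : ∀ i j : ZMod 12, (∃ n ≤ 5, j = i + 6 + (n : ℕ)) ∨ ∃ n ≤ 5, j = i + 5 - (n : ℕ) := by
    decide
  obtain ⟨n, hn, rfl⟩ | ⟨n, hn, rfl⟩ := hj i j
  · exact forall_mem_smul_eq_of_prod_smul hΓ ht hA hlen.le hl hn h
  -- The reflection that interchanges `A (i + 5)` and `A (i + 6)` reverses the order of the roots.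
  · have hinv := forall_mem_smul_eq_of_prod_smul (l := (l.map (·⁻¹)).reverse) (i := i) hΓ ht
      (hA.reflect (2 * i + 11)) (by simp [hlen]) (fun k hk => ?_) hn ?_
    · intro g hg
      have := hinv g⁻¹ (by simpa using hg)
      rw [inv_smul_eq_iff] at this
      convert this.symm using 2 <;> ring_nf
    · simp only [List.length_reverse, List.length_map, hlen] at hk
      rw [rootGroup_reflect, List.getElem_reverse, List.getElem_map]
      refine inv_mem ?_
      convert hl (5 - k) (by omega) using 2
      · rw [Nat.cast_sub (by omega)]
        push_cast
        ring
      · simp [hlen]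
    · rw [← List.prod_inv_reverse, inv_smul_eq_iff]
      convert h.symm using 2 <;> ring_nf

end PointLineGeometry

namespace IsParametrisation

variable {P : Type u} {L : Type v} {Γ : PointLineGeometry P L} {A : ZMod 12 → P ⊕ L}
  {M : Type*} [AddCommGroup M] {i : ZMod 12} {x : M → Γ.Collineation}

theorem mem {G : Type*} [Group G] {U : Subgroup G} {x : M → G} (h : IsParametrisation x U)
    (a : M) : x a ∈ U :=
  h.2.2.le ⟨a, rfl⟩

theorem exists_eq {G : Type*} [Group G] {U : Subgroup G} {x : M → G} (h : IsParametrisation x U)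
    {g : G} (hg : g ∈ U) : ∃ a, x a = g :=
  h.2.2.ge hg

theorem smul_eq_iff (h : IsParametrisation x (Γ.rootGroup A i)) (hΓ : Γ.IsMoufangHexagon)
    (hA : Γ.IsApartment A) (a : M) (j : ZMod 12) :
    x a • A j = A j ↔ (j - i).val ≤ 6 ∨ a = 0 := by
  have h6 := smul_of_mem_rootGroup hA (h.mem a) (i + 6) (by rw [add_sub_cancel_left]; decide)
  have h0 : x 0 = 1 := map_zero_of_map_add h.1
  refine ⟨fun hj => or_iff_not_imp_left.2 fun hi => h.2.1 (h0.symm ▸ ?_), ?_⟩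
  · have hji : ∀ k : ZMod 12, ¬ k.val ≤ 6 → k = 6 + (k.val - 6 : ℕ) ∧ k.val - 6 ≤ 5 := by decide
    obtain ⟨e, hn⟩ := hji _ hi
    rw [sub_eq_iff_eq_add', ← add_assoc] at e
    refine eq_one_of_mem_rootGroup_of_smul_add_seven hΓ.hexagon hΓ.thick hA (h.mem a) ?_
    have := smul_eq_between hΓ.hexagon hA hn h6 (e ▸ hj) 1 (by omega)
    rwa [Nat.cast_one, add_assoc, show (6 + 1 : ZMod 12) = 7 by decide] at this
  · rintro (hj | rfl)
    · exact smul_of_mem_rootGroup hA (h.mem a) j hj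
    · rw [h0, one_smul]

theorem eq_zero_of_smul (h : IsParametrisation x (Γ.rootGroup A i)) (hΓ : Γ.IsMoufangHexagon)
    (hA : Γ.IsApartment A) {a : M} {j : ZMod 12} (ha : x a • A j = A j)
    (hj : ¬ (j - i).val ≤ 6 := by decide) : a = 0 :=
  ((h.smul_eq_iff hΓ hA a j).1 ha).resolve_left hj

theorem smul_inj (h : IsParametrisation x (Γ.rootGroup A i)) (hΓ : Γ.IsMoufangHexagon)
    (hA : Γ.IsApartment A) {a b : M} {j : ZMod 12} (hab : x a • A j = x b • A j)
    (hj : ¬ (j - i).val ≤ 6 := by decide) : a = b := by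
  refine eq_of_sub_eq_zero (h.eq_zero_of_smul hΓ hA (j := j) ?_ hj)
  rw [sub_eq_neg_add, h.1, mul_smul, hab, map_neg_of_map_add h.1, inv_smul_smul]

end IsParametrisation

namespace HexagonCoordinates

variable {P : Type u} {L : Type v} {Γ : PointLineGeometry P L}
  {F : Type w} {J : Type z} [Field F] [AddCommGroup J] [Module F J]
  {S : HexagonalSystem F J} (X : HexagonCoordinates Γ S)

/-- The root group elements of coordinates, as a family in the collineation group. -/
def root : RootData S Γ.Collineation where
  x₁ := X.x₁
  x₂ := X.x₂
  x₃ := X.x₃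
  x₄ := X.x₄
  x₅ := X.x₅
  x₆ := X.x₆
  add₁ := X.param₁.1
  add₂ := X.param₂.1
  add₃ := X.param₃.1
  add₄ := X.param₄.1
  add₅ := X.param₅.1
  add₆ := X.param₆.1
  comm₁₂ := X.comm₁₂
  comm₁₃ := X.comm₁₃
  comm₁₄ := X.comm₁₄
  comm₁₅ := X.comm₁₅
  comm₁₆ := X.comm₁₆
  comm₂₃ := X.comm₂₃
  comm₂₄ := X.comm₂₄
  comm₂₅ := X.comm₂₅
  comm₂₆ := X.comm₂₆
  comm₃₄ := X.comm₃₄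
  comm₃₅ := X.comm₃₅
  comm₃₆ := X.comm₃₆
  comm₄₅ := X.comm₄₅
  comm₄₆ := X.comm₄₆
  comm₅₆ := X.comm₅₆

theorem x₁_smul (a : J) (j : ZMod 12) (hj : (j - 1).val ≤ 6 := by decide) :
    X.root.x₁ a • X.A j = X.A j := smul_of_mem_rootGroup X.isApartment (X.param₁.mem a) j hj

theorem x₂_smul (a : F) (j : ZMod 12) (hj : (j - 2).val ≤ 6 := by decide) :
    X.root.x₂ a • X.A j = X.A j := smul_of_mem_rootGroup X.isApartment (X.param₂.mem a) j hj

theorem x₃_smul (a : J) (j : ZMod 12) (hj : (j - 3).val ≤ 6 := by decide) :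
    X.root.x₃ a • X.A j = X.A j := smul_of_mem_rootGroup X.isApartment (X.param₃.mem a) j hj

theorem x₄_smul (a : F) (j : ZMod 12) (hj : (j - 4).val ≤ 6 := by decide) :
    X.root.x₄ a • X.A j = X.A j := smul_of_mem_rootGroup X.isApartment (X.param₄.mem a) j hj

theorem x₅_smul (a : J) (j : ZMod 12) (hj : (j - 5).val ≤ 6 := by decide) :
    X.root.x₅ a • X.A j = X.A j := smul_of_mem_rootGroup X.isApartment (X.param₅.mem a) j hj

theorem x₆_smul (a : F) (j : ZMod 12) (hj : (j - 6).val ≤ 6 := by decide) :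
    X.root.x₆ a • X.A j = X.A j := smul_of_mem_rootGroup X.isApartment (X.param₆.mem a) j hj

theorem x₁_smul_eq_iff (hΓ : Γ.IsMoufangHexagon) {a b : J} :
    X.root.x₁ a • X.A 8 = X.root.x₁ b • X.A 8 ↔ a = b :=
  ⟨fun h => X.param₁.smul_inj hΓ X.isApartment h, fun h => by rw [h]⟩

section Tail

variable {t : F} {a : J} {r : F} {b : J} {u : F}

theorem tail_smul (j : ZMod 12) (hj : (j - 2).val ≤ 6 ∧ (j - 3).val ≤ 6 ∧ (j - 4).val ≤ 6 ∧
    (j - 5).val ≤ 6 ∧ (j - 6).val ≤ 6 := by decide) : X.root.tail t a r b u • X.A j = X.A j := by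
  simp only [RootData.tail, mul_smul]
  rw [X.x₆_smul u j hj.2.2.2.2, X.x₅_smul b j hj.2.2.2.1, X.x₄_smul r j hj.2.2.1,
    X.x₃_smul a j hj.2.1, X.x₂_smul t j hj.1]

theorem tail_smul_nine : X.root.tail t a r b u • X.A 9 = X.root.x₂ t • X.A 9 := by
  simp only [RootData.tail, mul_smul]
  rw [X.x₆_smul u 9, X.x₅_smul b 9, X.x₄_smul r 9, X.x₃_smul a 9]

theorem tail_smul_ten : X.root.tail t a r b u • X.A 10 = X.root.x₂ t • X.root.x₃ a • X.A 10 := by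
  simp only [RootData.tail, mul_smul]
  rw [X.x₆_smul u 10, X.x₅_smul b 10, X.x₄_smul r 10]

theorem x₁_mul_tail_smul_eq_iff (hΓ : Γ.IsMoufangHexagon) (c : J) (j : ZMod 12) :
    (X.root.x₁ c * X.root.tail t a r b u) • X.A j = X.A j ↔
      ((j - 1).val ≤ 6 ∨ c = 0) ∧ ((j - 2).val ≤ 6 ∨ t = 0) ∧ ((j - 3).val ≤ 6 ∨ a = 0) ∧
        ((j - 4).val ≤ 6 ∨ r = 0) ∧ ((j - 5).val ≤ 6 ∨ b = 0) ∧ ((j - 6).val ≤ 6 ∨ u = 0) := by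
  have h := prod_smul_eq_iff hΓ.hexagon hΓ.thick X.isApartment (i := 1)
    (l := [X.x₁ c, X.x₂ t, X.x₃ a, X.x₄ r, X.x₅ b, X.x₆ u]) rfl (fun k hk => by
      match k, hk with
      | 0, _ => exact X.param₁.mem c
      | 1, _ => exact X.param₂.mem t
      | 2, _ => exact X.param₃.mem a
      | 3, _ => exact X.param₄.mem r
      | 4, _ => exact X.param₅.mem b
      | 5, _ => exact X.param₆.mem u) j
  simp only [List.prod_cons, List.prod_nil, mul_one, List.forall_mem_cons, List.not_mem_nil,
    IsEmpty.forall_iff, implies_true, and_true, X.param₁.smul_eq_iff hΓ X.isApartment,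
    X.param₂.smul_eq_iff hΓ X.isApartment, X.param₃.smul_eq_iff hΓ X.isApartment,
    X.param₄.smul_eq_iff hΓ X.isApartment, X.param₅.smul_eq_iff hΓ X.isApartment,
    X.param₆.smul_eq_iff hΓ X.isApartment] at h
  rw [← h]
  simp only [RootData.tail, mul_assoc]
  rfl

theorem tail_eq_zero (hΓ : Γ.IsMoufangHexagon) (h : X.root.tail t a r b u • X.A 1 = X.A 1) :
    t = 0 ∧ a = 0 ∧ r = 0 ∧ b = 0 ∧ u = 0 := by
  rw [← one_mul (X.root.tail _ _ _ _ _), ← X.root.x₁_zero, X.x₁_mul_tail_smul_eq_iff hΓ] at h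
  have hn : ¬ ((1 : ZMod 12) - 2).val ≤ 6 ∧ ¬ ((1 : ZMod 12) - 3).val ≤ 6 ∧
      ¬ ((1 : ZMod 12) - 4).val ≤ 6 ∧ ¬ ((1 : ZMod 12) - 5).val ≤ 6 ∧
      ¬ ((1 : ZMod 12) - 6).val ≤ 6 := by decide
  simpa only [hn, false_or] using h.2

theorem tail_smul_inj (hΓ : Γ.IsMoufangHexagon) {t' : F} {a' : J} {r' : F} {b' : J} {u' : F}
    (h : X.root.tail t a r b u • X.A 1 = X.root.tail t' a' r' b' u' • X.A 1) :
    t = t' ∧ a = a' ∧ r = r' ∧ b = b' ∧ u = u' := by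
  have e : X.root.tail t a r b u = X.root.tail t' a' r' b' u' *
      X.root.tail (t - t') (a - a') (r - r' + S.tr (a - a') b' + (t - t') * u') (b - b')
        (u - u') := by
    rw [X.root.tail_mul_tail]
    congr 1 <;> first | ring | abel
  rw [e, mul_smul] at h
  obtain ⟨ht, ha, hr, hb, hu⟩ := X.tail_eq_zero hΓ (smul_left_cancel _ h)
  rw [ht, ha, map_zero, LinearMap.zero_apply, zero_mul, add_zero, add_zero] at hr
  simp only [sub_eq_zero] at ht ha hr hb hu
  exact ⟨ht, ha, hr, hb, hu⟩

theorem tail_inj (hΓ : Γ.IsMoufangHexagon) {t' : F} {a' : J} {r' : F} {b' : J} {u' : F}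
    (h : X.root.tail t a r b u = X.root.tail t' a' r' b' u') :
    t = t' ∧ a = a' ∧ r = r' ∧ b = b' ∧ u = u' :=
  X.tail_smul_inj hΓ (by rw [h])

end Tail

end HexagonCoordinates

/-! ### Changing coordinates -/

namespace PointLineGeometry

variable {P : Type u} {L : Type v} {Γ : PointLineGeometry P L}

theorem exists_collineation (e : P ⊕ L ≃ P ⊕ L) (he : ∀ x, (e x).isLeft = x.isLeft)
    (hadj : ∀ x y, Γ.incidenceGraph.Adj (e x) (e y) ↔ Γ.incidenceGraph.Adj x y) :
    ∃ g : Γ.Collineation, ∀ x, g • x = e x := by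
  have he' x : (e.symm x).isLeft = x.isLeft := by rw [← he, e.apply_symm_apply]
  have hp (e' : P ⊕ L ≃ P ⊕ L) (h : ∀ x, (e' x).isLeft = x.isLeft) (p : P) :
      ∃ q, e' (.inl p) = .inl q := Sum.isLeft_iff.1 (h (.inl p))
  have hl (e' : P ⊕ L ≃ P ⊕ L) (h : ∀ x, (e' x).isLeft = x.isLeft) (l : L) :
      ∃ m, e' (.inr l) = .inr m := Sum.isRight_iff.1 (Sum.isLeft_eq_false.1 (h (.inr l)))
  choose f hf using hp e he
  choose f' hf' using hp e.symm he'
  choose k hk using hl e he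
  choose k' hk' using hl e.symm he'
  let eP : Equiv.Perm P := ⟨f, f',
    fun p => Sum.inl_injective (β := L) (by rw [← hf', ← hf, e.symm_apply_apply]),
    fun p => Sum.inl_injective (β := L) (by rw [← hf, ← hf', e.apply_symm_apply])⟩
  let eL : Equiv.Perm L := ⟨k, k',
    fun l => Sum.inr_injective (α := P) (by rw [← hk', ← hk, e.symm_apply_apply]),
    fun l => Sum.inr_injective (α := P) (by rw [← hk, ← hk', e.apply_symm_apply])⟩
  refine ⟨⟨(eP, eL), fun p l => ?_⟩, ?_⟩
  · have := hadj (.inl p) (.inr l)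
    rw [hf, hk] at this
    exact this
  · rintro (p | l)
    · exact (hf p).symm
    · exact (hk l).symm

theorem IsApartment.eq_of_smul_eq {A : ZMod 12 → P ⊕ L} (hA : Γ.IsApartment A)
    (hΓ : Γ.IsGeneralisedHexagon) {g : Γ.Collineation} (h6 : g • A 6 = A 6) (h7 : g • A 7 = A 7)
    {j k : ZMod 12} (h : g • A j = A k) : j = k := by
  have d6 := smul_dist hΓ g (A 6) (A j)
  have d7 := smul_dist hΓ g (A 7) (A j)
  rw [h6, h, hA.dist_eq hΓ, hA.dist_eq hΓ] at d6
  rw [h7, h, hA.dist_eq hΓ, hA.dist_eq hΓ] at d7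
  clear h
  revert j k
  decide

end PointLineGeometry

namespace HexagonCoordinates

variable {P : Type u} {L : Type v} {Γ : PointLineGeometry P L}
  {F : Type w} {J : Type z} [Field F] [AddCommGroup J] [Module F J]
  {S : HexagonalSystem F J}

theorem isLeft_iff (X : HexagonCoordinates Γ S) (hΓ : Γ.IsMoufangHexagon) (j : ZMod 12) :
    (X.A j).isLeft ↔ Even (min (j - 7).val (7 - j).val) := by
  obtain ⟨p, hp⟩ := X.isPoint
  rw [← X.isApartment.dist_eq hΓ.hexagon 7 j, hΓ.hexagon.even_dist_iff, hp]
  simp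

/-- The elements `x` and `y` have the same coordinates in `X` and `X'`, respectively. -/
def Corresponds (X X' : HexagonCoordinates Γ S) (x y : P ⊕ L) : Prop :=
  ∃ g ∈ (X.root.prod X'.root).unipotent, ∃ j, x = g.1 • X.A j ∧ y = g.2 • X'.A j

theorem exists_mem_unipotent_prod (X X' : HexagonCoordinates Γ S) {i : ZMod 12} (h1 : 1 ≤ i.val)
    (h6 : i.val ≤ 6) {g : Γ.Collineation} (hg : g ∈ Γ.rootGroup X.A i) :
    ∃ u ∈ (X.root.prod X'.root).unipotent, u.1 = g := by
  have hi : ∀ i : ZMod 12, 1 ≤ i.val → i.val ≤ 6 →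
      i = 1 ∨ i = 2 ∨ i = 3 ∨ i = 4 ∨ i = 5 ∨ i = 6 := by decide
  rcases hi i h1 h6 with rfl | rfl | rfl | rfl | rfl | rfl
  · obtain ⟨c, rfl⟩ := X.param₁.exists_eq hg
    exact ⟨_, (X.root.prod X'.root).x₁_mem c, rfl⟩
  · obtain ⟨c, rfl⟩ := X.param₂.exists_eq hg
    exact ⟨_, (X.root.prod X'.root).x₂_mem c, rfl⟩
  · obtain ⟨c, rfl⟩ := X.param₃.exists_eq hg
    exact ⟨_, (X.root.prod X'.root).x₃_mem c, rfl⟩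
  · obtain ⟨c, rfl⟩ := X.param₄.exists_eq hg
    exact ⟨_, (X.root.prod X'.root).x₄_mem c, rfl⟩
  · obtain ⟨c, rfl⟩ := X.param₅.exists_eq hg
    exact ⟨_, (X.root.prod X'.root).x₅_mem c, rfl⟩
  · obtain ⟨c, rfl⟩ := X.param₆.exists_eq hg
    exact ⟨_, (X.root.prod X'.root).x₆_mem c, rfl⟩

theorem smul_eq_of_mem_unipotent_prod (hΓ : Γ.IsMoufangHexagon) (X X' : HexagonCoordinates Γ S)
    {g : Γ.Collineation × Γ.Collineation} (hg : g ∈ (X.root.prod X'.root).unipotent)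
    {j k : ZMod 12} (h : g.1 • X.A j = X.A k) : j = k ∧ g.2 • X'.A j = X'.A j := by
  obtain ⟨c, t, a, r, b, u, rfl⟩ := hg
  replace h : (X.root.x₁ c * X.root.tail t a r b u) • X.A j = X.A k := h
  obtain rfl := X.isApartment.eq_of_smul_eq hΓ.hexagon
    (by rw [mul_smul, X.tail_smul 6, X.x₁_smul c 6])
    (by rw [mul_smul, X.tail_smul 7, X.x₁_smul c 7]) h
  exact ⟨rfl, (X'.x₁_mul_tail_smul_eq_iff hΓ c j).2 ((X.x₁_mul_tail_smul_eq_iff hΓ c j).1 h)⟩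

theorem exists_adj_eq (hΓ : Γ.IsMoufangHexagon) (X X' : HexagonCoordinates Γ S) (j : ZMod 12)
    {y : P ⊕ L} (hy : Γ.incidenceGraph.Adj (X.A j) y) :
    ∃ g ∈ (X.root.prod X'.root).unipotent, g.1 • X.A j = X.A j ∧
      ∃ k, Γ.incidenceGraph.Adj (X'.A j) (X'.A k) ∧ y = g.1 • X.A k := by
  have next := X.isApartment.2 j
  have prev := X.isApartment.2 (j - 1)
  have prev' := X'.isApartment.2 (j - 1)
  have hne := X.isApartment.ne_add_two (j - 1)
  rw [show j - 1 + 2 = j + 1 by ring] at hne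
  rw [sub_add_cancel] at prev prev'
  have hj : ∀ j : ZMod 12, (1 ≤ j.val ∧ j.val ≤ 6) ∨ (1 ≤ (j - 6).val ∧ (j - 6).val ≤ 6) := by
    decide
  obtain ⟨h1, h6⟩ | ⟨h1, h6⟩ := hj j
  · obtain rfl | hy' := eq_or_ne y (X.A (j + 1))
    · exact ⟨1, one_mem _, one_smul _ _, j + 1, X'.isApartment.2 j, (one_smul _ _).symm⟩
    obtain ⟨g, hg, e⟩ := hΓ.moufang X.A X.isApartment j (X.A (j - 1)) y prev.symm hne.symm hy hy'
    obtain ⟨u, hu, rfl⟩ := exists_mem_unipotent_prod X X' h1 h6 hg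
    exact ⟨u, hu, smul_of_mem_rootGroup X.isApartment hg j (by simp), j - 1, prev'.symm, e.symm⟩
  · obtain rfl | hy' := eq_or_ne y (X.A (j - 1))
    · exact ⟨1, one_mem _, one_smul _ _, j - 1, prev'.symm, (one_smul _ _).symm⟩
    obtain ⟨g, hg, e⟩ := hΓ.exists_mem_rootGroup_smul_eq X.isApartment j next hne hy hy'
    obtain ⟨u, hu, rfl⟩ := exists_mem_unipotent_prod X X' h1 h6 hg
    exact ⟨u, hu, smul_of_mem_rootGroup X.isApartment hg j (by rw [sub_sub_cancel]; decide),
      j + 1, X'.isApartment.2 j, e.symm⟩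

namespace Corresponds

variable {X X' : HexagonCoordinates Γ S} {x y : P ⊕ L}

theorem symm (h : Corresponds X X' x y) : Corresponds X' X y x := by
  obtain ⟨g, hg, j, hx, hy⟩ := h
  exact ⟨g.swap, RootData.swap_mem_unipotent_prod _ _ hg, j, hy, hx⟩

theorem isLeft_eq (hΓ : Γ.IsMoufangHexagon) (h : Corresponds X X' x y) :
    y.isLeft = x.isLeft := by
  obtain ⟨g, -, j, rfl, rfl⟩ := h
  rw [isLeft_smul, isLeft_smul, Bool.eq_iff_iff, X.isLeft_iff hΓ, X'.isLeft_iff hΓ]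

theorem unique (hΓ : Γ.IsMoufangHexagon) {y' : P ⊕ L} (h : Corresponds X X' x y)
    (h' : Corresponds X X' x y') : y = y' := by
  obtain ⟨g, hg, j, rfl, rfl⟩ := h
  obtain ⟨g', hg', k, e, rfl⟩ := h'
  have := smul_eq_of_mem_unipotent_prod hΓ X X' (mul_mem (inv_mem hg') hg) (j := j) (k := k) (by
    rw [Prod.fst_mul, mul_smul, Prod.fst_inv, inv_smul_eq_iff, e])
  obtain ⟨rfl, e'⟩ := this
  rwa [Prod.snd_mul, mul_smul, Prod.snd_inv, inv_smul_eq_iff] at e'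

theorem exists_adj (hΓ : Γ.IsMoufangHexagon) (h : Corresponds X X' x y) {x' : P ⊕ L}
    (hx : Γ.incidenceGraph.Adj x x') :
    ∃ y', Corresponds X X' x' y' ∧ Γ.incidenceGraph.Adj y y' := by
  obtain ⟨g, hg, j, rfl, rfl⟩ := h
  have hadj := (smul_adj g.1⁻¹).2 hx
  rw [inv_smul_smul] at hadj
  obtain ⟨u, hu, huj, k, hk, e⟩ := exists_adj_eq hΓ X X' j hadj
  have huj' := (smul_eq_of_mem_unipotent_prod hΓ X X' hu huj).2
  refine ⟨(g * u).2 • X'.A k, ⟨g * u, mul_mem hg hu, k, ?_, rfl⟩, ?_⟩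
  · rw [Prod.fst_mul, mul_smul, ← e, smul_inv_smul]
  · rw [Prod.snd_mul, mul_smul, smul_adj, ← huj', smul_adj]
    exact hk

theorem exists_left (hΓ : Γ.IsMoufangHexagon) (X X' : HexagonCoordinates Γ S) (x : P ⊕ L) :
    ∃ y, Corresponds X X' x y := by
  obtain ⟨p⟩ := hΓ.hexagon.connected.preconnected (X.A 0) x
  have hp {y z : P ⊕ L} (p : Γ.incidenceGraph.Walk y z) (hy : ∃ y', Corresponds X X' y y') :
      ∃ z', Corresponds X X' z z' := by
    induction p with
    | nil => exact hy
    | cons hadj _ ih =>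
      obtain ⟨y', h⟩ := hy
      obtain ⟨z', h', -⟩ := h.exists_adj hΓ hadj
      exact ih ⟨z', h'⟩
  exact hp p ⟨X'.A 0, 1, one_mem _, 0, (one_smul _ _).symm, (one_smul _ _).symm⟩

theorem adj (hΓ : Γ.IsMoufangHexagon) {x' y' : P ⊕ L} (h : Corresponds X X' x y)
    (h' : Corresponds X X' x' y') (hx : Γ.incidenceGraph.Adj x x') :
    Γ.incidenceGraph.Adj y y' := by
  obtain ⟨z, hz, hy⟩ := h.exists_adj hΓ hx
  rwa [hz.unique hΓ h'] at hy

end Corresponds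

theorem exists_collineation_of_coordinates (hΓ : Γ.IsMoufangHexagon)
    (X X' : HexagonCoordinates Γ S) :
    ∃ g : Γ.Collineation, (∀ j, g • X.A j = X'.A j) ∧
      ∀ c j, g • X.root.x₁ c • X.A j = X'.root.x₁ c • X'.A j := by
  choose f hf using Corresponds.exists_left hΓ X X'
  choose f' hf' using Corresponds.exists_left hΓ X' X
  obtain ⟨g, hg⟩ := exists_collineation (Γ := Γ)
    ⟨f, f', fun x => (hf' _).unique hΓ (hf x).symm, fun y => (hf _).unique hΓ (hf' y).symm⟩
    (fun x => (hf x).isLeft_eq hΓ)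
    (fun x y => ⟨(hf x).symm.adj hΓ (hf y).symm, (hf x).adj hΓ (hf y)⟩)
  have hcorr {x y : P ⊕ L} (h : Corresponds X X' x y) : g • x = y := by
    rw [hg]
    exact (hf x).unique hΓ h
  exact ⟨g, fun j => hcorr ⟨1, one_mem _, j, (one_smul _ _).symm, (one_smul _ _).symm⟩,
    fun c j => hcorr ⟨_, (X.root.prod X'.root).x₁_mem c, j, rfl, rfl⟩⟩

end HexagonCoordinates

/-! ### The element `s₁` -/

namespace HexagonalSystem

variable {F : Type w} {J : Type z} [Field F] [AddCommGroup J] [Module F J]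
  (S : HexagonalSystem F J)

theorem norm_inv {a : J} (ha : a ≠ 0) : S.norm (S.inv a) = (S.norm a)⁻¹ := by
  have := S.norm_ne_zero ha
  rw [inv, S.norm_smul, S.norm_adj]
  field_simp

theorem adj_inv {a : J} (ha : a ≠ 0) : S.adj (S.inv a) = (S.norm a)⁻¹ • a := by
  have := S.norm_ne_zero ha
  rw [inv, S.adj_smul, S.adj_adj, smul_smul]
  congr 1
  field_simp

theorem inv_inv {a : J} (ha : a ≠ 0) : S.inv (S.inv a) = a := by
  rw [inv, S.norm_inv ha, S.adj_inv ha, smul_smul, _root_.inv_inv,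
    mul_inv_cancel₀ (S.norm_ne_zero ha), one_smul]

theorem inv_ne_zero {a : J} (ha : a ≠ 0) : S.inv a ≠ 0 :=
  smul_ne_zero (_root_.inv_ne_zero (S.norm_ne_zero ha)) (S.adj_ne_zero ha)

theorem inv_neg (a : J) : S.inv (-a) = -S.inv a := by
  rw [inv, inv, S.norm_neg, S.adj_neg, _root_.inv_neg, neg_smul]

end HexagonalSystem

open scoped commutatorElement

namespace PointLineGeometry

variable {P : Type u} {L : Type v} {Γ : PointLineGeometry P L} {A : ZMod 12 → P ⊕ L}
  {g h : Γ.Collineation} {i : ZMod 12}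

theorem smul_smul_of_mem_rootGroup (hA : Γ.IsApartment A) (hg : g ∈ Γ.rootGroup A i)
    {j : ZMod 12} (hj : 1 ≤ (j - i).val ∧ (j - i).val ≤ 5) (hh : h • A j = A j) :
    g • h • A (j + 1) = h • A (j + 1) := by
  refine smul_of_mem_rootGroup_of_adj hg j hj ?_
  have := (smul_adj h).2 (hA.2 j)
  rwa [hh] at this

theorem FixesNeighbours.commutator_left {x : P ⊕ L} (hg : FixesNeighbours g x) (hh : h • x = x) :
    FixesNeighbours ⁅g, h⁆ x := by
  intro y hy
  have hy' := (smul_adj h⁻¹).2 hy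
  rw [inv_smul_eq_iff.2 hh.symm] at hy'
  have hfix {z : P ⊕ L} (hz : Γ.incidenceGraph.Adj x z) : g⁻¹ • z = z :=
    inv_smul_eq_iff.2 (hg z hz).symm
  rw [commutatorElement_def, mul_smul, mul_smul, mul_smul, hfix hy', smul_inv_smul, hg y hy]

theorem FixesNeighbours.inv {x : P ⊕ L} (hg : FixesNeighbours g x) : FixesNeighbours g⁻¹ x :=
  fun y hy => inv_smul_eq_iff.2 (hg y hy).symm

theorem FixesNeighbours.commutator_right {x : P ⊕ L} (hg : g • x = x)
    (hh : FixesNeighbours h x) : FixesNeighbours ⁅g, h⁆ x :=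
  commutatorElement_inv h g ▸ (hh.commutator_left hg).inv

theorem commutator_mem_rootGroup (hA : Γ.IsApartment A) (hg : g ∈ Γ.rootGroup A (i + 2))
    (hh : h ∈ Γ.rootGroup A i) : ⁅g, h⁆ ∈ Γ.rootGroup A (i + 1) := by
  rw [mem_rootGroup]
  intro k h1 h5
  have hi : i + 1 + k - i = 1 + k := by ring
  have hi' : i + 1 + k - (i + 2) = k - 1 := by ring
  obtain hk | rfl : k ≤ 4 ∨ k = 5 := by omega
  · refine .commutator_right (smul_of_mem_rootGroup hA hg _ ?_) fun y hy =>
      smul_of_mem_rootGroup_of_adj hh _ ?_ hy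
    · rw [hi']; interval_cases k <;> decide
    · rw [hi]; interval_cases k <;> decide
  · refine .commutator_left (fun y hy => smul_of_mem_rootGroup_of_adj hg _ ?_ hy)
      (smul_of_mem_rootGroup hA hh _ ?_)
    · rw [hi']; decide
    · rw [hi]; decide

end PointLineGeometry

namespace HexagonCoordinates

variable {P : Type u} {L : Type v} {Γ : PointLineGeometry P L}
  {F : Type w} {J : Type z} [Field F] [AddCommGroup J] [Module F J]
  {S : HexagonalSystem F J} (X : HexagonCoordinates Γ S)

theorem conj_mem_of_reflection {s g : Γ.Collineation} (hs : ∀ j, s • X.A j = X.A (2 - j))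
    {i : ZMod 12} (i' : ZMod 12) (hi : i' = 8 - i) (hg : g ∈ Γ.rootGroup X.A i) :
    s * g * s⁻¹ ∈ Γ.rootGroup X.A i' := by
  refine conj_mem_rootGroup hg fun k h1 h5 => ⟨6 - k, by omega, by omega, ?_⟩
  rw [hs, hi, Nat.cast_sub (by omega)]
  congr 1
  push_cast
  have h12 : (12 : ZMod 12) = 0 := rfl
  linear_combination h12

variable (hΓ : Γ.IsMoufangHexagon)
include hΓ

theorem exists_x₁_smul {y : P ⊕ L} (h : Γ.incidenceGraph.Adj (X.A 7) y) (hy : y ≠ X.A 6) :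
    ∃ a, X.root.x₁ a • X.A 8 = y := by
  obtain ⟨g, hg, e⟩ := hΓ.exists_mem_rootGroup_smul_eq X.isApartment 7 (X.isApartment.2 7)
    (X.isApartment.1.ne (show (8 : ZMod 12) ≠ 7 - 1 by decide)) h hy
  obtain ⟨a, rfl⟩ := X.param₁.exists_eq hg
  exact ⟨a, e⟩

theorem smul_seven_sub {g : Γ.Collineation} (h6 : g • X.A 6 = X.A 8) (h7 : g • X.A 7 = X.A 7)
    (h1 : g • X.A 1 = X.A 1) {k : ℕ} (hk : k ≤ 6) : g • X.A (7 - k) = X.A (7 + k) := by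
  have h := ((X.isApartment.smul g).reflect 14).eq_between X.isApartment hΓ.hexagon
    (i := 8) (n := 5) le_rfl h6 h1
  obtain _ | k := k
  · simpa using h7
  · rw [Nat.cast_succ, show (7 - (k + 1) : ZMod 12) = 14 - (8 + k) by ring,
      show (7 + (k + 1) : ZMod 12) = 8 + k by ring]
    exact h k (by omega)

theorem smul_eq_of_reflection {g : Γ.Collineation} (h6 : g • X.A 6 = X.A 8)
    (h8 : g • X.A 8 = X.A 6) (h7 : g • X.A 7 = X.A 7) (h1 : g • X.A 1 = X.A 1) (j : ZMod 12) :
    g • X.A j = X.A (2 - j) := by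
  have h := ((X.isApartment.smul g).reflect 2).eq_of_eq_on_path X.isApartment hΓ.hexagon
    (i := 7) (fun k hk => by
      rw [← X.smul_seven_sub hΓ h6 h7 h1 hk]
      congr 2
      rw [← sub_sub]
      exact congrArg (· - (k : ZMod 12)) (by decide)) h8
  simpa using congrFun h (2 - j)

section Opposite

variable {v : Γ.Collineation} (hv : v ∈ Γ.rootGroup X.A 7)
include hv

omit hΓ in
theorem smul_x₂_nine (t : F) : v • X.root.x₂ t • X.A 9 = X.root.x₂ t • X.A 9 :=
  smul_smul_of_mem_rootGroup X.isApartment hv (by decide) (X.x₂_smul t 8)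

omit hΓ in
theorem smul_x₃_ten (a : J) : v • X.root.x₃ a • X.A 10 = X.root.x₃ a • X.A 10 :=
  smul_smul_of_mem_rootGroup X.isApartment hv (by decide) (X.x₃_smul a 9)

omit hΓ in
theorem smul_x₆_one (t : F) : v • X.root.x₆ t • X.A 1 = X.root.x₆ t • X.A 1 :=
  smul_smul_of_mem_rootGroup X.isApartment hv (by decide) (X.x₆_smul t 0)

theorem conj_x₂ {e : J} (he : v • X.A 6 = X.root.x₁ e • X.A 8) (t : F) :
    ∃ τ, t = -(τ * S.norm e) ∧
      v * X.root.x₂ t * v⁻¹ = X.root.x₁ e * X.root.x₆ τ * (X.root.x₁ e)⁻¹ := by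
  have hvA : ∀ j : ZMod 12, (j - 7).val ≤ 6 → v • X.A j = X.A j :=
    smul_of_mem_rootGroup X.isApartment hv
  set h := (X.root.x₁ e)⁻¹ * v with hh
  have h6 : h • X.A 6 = X.A 8 := by rw [mul_smul, he, inv_smul_smul]
  have h1 : h • X.A 1 = X.A 1 := by
    rw [mul_smul, hvA 1 (by decide), inv_smul_eq_iff, X.x₁_smul e 1]
  have h7 : h • X.A 7 = X.A 7 := by
    rw [mul_smul, hvA 7 (by decide), inv_smul_eq_iff, X.x₁_smul e 7]
  have hm : h * X.root.x₂ t * h⁻¹ ∈ Γ.rootGroup X.A 6 := by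
    refine conj_mem_rootGroup (X.param₂.mem t) fun k hk1 hk5 => ⟨6 - k, by omega, by omega, ?_⟩
    have := X.smul_seven_sub hΓ h6 h7 h1 (k := k - 1) (by omega)
    rw [Nat.cast_sub hk1] at this
    rw [Nat.cast_sub (by omega)]
    convert this.symm using 2
    · push_cast; ring
    · congr 1; push_cast; ring
  obtain ⟨τ, hτ⟩ := X.param₆.exists_eq hm
  have hconj : v * X.root.x₂ t * v⁻¹ = X.root.x₁ e * X.root.x₆ τ * (X.root.x₁ e)⁻¹ := by
    change X.root.x₆ τ = _ at hτ
    rw [hτ, hh]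
    group
  refine ⟨τ, X.param₂.smul_inj hΓ X.isApartment (j := 9) ?_, hconj⟩
  calc X.root.x₂ t • X.A 9 = (v * X.root.x₂ t * v⁻¹) • X.A 9 := by
        rw [mul_smul, mul_smul, inv_smul_eq_iff.2 (hvA 9 (by decide)).symm, X.smul_x₂_nine hv]
    _ = X.root.x₂ (-(τ * S.norm e)) • X.A 9 := by rw [hconj, X.root.conj₆, X.tail_smul_nine]

theorem smul_x₂_x₃_ten {e : J} (he : v • X.A 6 = X.root.x₁ e • X.A 8) (he0 : e ≠ 0) (b : J) :
    v • X.root.x₂ 1 • X.root.x₃ b • X.A 10 =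
      X.root.x₂ 1 • X.root.x₃ (S.inv e + b) • X.A 10 := by
  have hN := S.norm_ne_zero he0
  obtain ⟨τ, h1, h2⟩ := X.conj_x₂ hΓ hv he 1
  have hτ : τ = -(S.norm e)⁻¹ := by field_simp; linear_combination h1
  rw [← mul_smul v, show v * X.root.x₂ 1 = v * X.root.x₂ 1 * v⁻¹ * v by group, h2, X.root.conj₆,
    ← h1, mul_smul, X.smul_x₃_ten hv, ← mul_smul, X.root.tail_mul_x₃, X.tail_smul_ten, hτ,
    neg_smul, neg_neg]
  rfl

theorem smul_x₁_neg_eight {e : J} (he : v • X.A 6 = X.root.x₁ e • X.A 8) (he0 : e ≠ 0) :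
    v • X.root.x₁ (-e) • X.A 8 = X.A 6 := by
  have hv' := (Γ.rootGroup X.A 7).inv_mem hv
  have hv7 : v • X.A 7 = X.A 7 := smul_of_mem_rootGroup X.isApartment hv 7 (by decide)
  have hv8 : v • X.A 8 = X.A 8 := smul_of_mem_rootGroup X.isApartment hv 8 (by decide)
  have h86 : X.A 8 ≠ X.A 6 := X.isApartment.1.ne (by decide)
  have hne : v⁻¹ • X.A 6 ≠ X.A 6 := fun h => by
    rw [inv_smul_eq_iff, he] at h
    exact h86 (smul_left_cancel _ ((X.x₁_smul e 6).trans h)).symm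
  have hadj := (smul_adj v⁻¹).2 (X.isApartment.2 6).symm
  rw [show (6 + 1 : ZMod 12) = 7 by decide, inv_smul_eq_iff.2 hv7.symm] at hadj
  obtain ⟨e', he'⟩ := X.exists_x₁_smul hΓ hadj hne
  have he'0 : e' ≠ 0 := by
    rintro rfl
    rw [X.root.x₁_zero, one_smul, eq_inv_smul_iff, hv8] at he'
    exact h86 he'
  have h1 := X.smul_x₂_x₃_ten hΓ hv' he'.symm he'0 0
  rw [inv_smul_eq_iff, X.smul_x₂_x₃_ten hΓ hv he he0, add_zero] at h1
  have h2 : 0 = S.inv e + S.inv e' := X.param₃.smul_inj hΓ X.isApartment (smul_left_cancel _ h1)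
  have h3 : S.inv e' = S.inv (-e) := by
    rw [S.inv_neg, eq_neg_iff_add_eq_zero, add_comm, ← h2]
  rw [← S.inv_inv (neg_ne_zero.2 he0), ← h3, S.inv_inv he'0, he', smul_inv_smul]

end Opposite

end HexagonCoordinates

theorem map_groupComm {G H : Type*} [Group G] [Group H] (f : G →* H) (g h : G) :
    f (groupComm g h) = groupComm (f g) (f h) := by
  simp [groupComm]

theorem groupComm_inv {G : Type*} [Group G] (g h : G) : (groupComm g h)⁻¹ = groupComm h g := by
  simp [groupComm, mul_assoc]

namespace HexagonCoordinates

variable {P : Type u} {L : Type v} {Γ : PointLineGeometry P L}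
  {F : Type w} {J : Type z} [Field F] [AddCommGroup J] [Module F J]
  {S : HexagonalSystem F J} (X : HexagonCoordinates Γ S) (hΓ : Γ.IsMoufangHexagon)
include hΓ

theorem exists_isS₁ : ∃ s, X.IsS₁ s := by
  have h1 : -S.one ≠ 0 := neg_ne_zero.2 S.one_ne_zero
  have hadj := (smul_adj (X.root.x₁ (-S.one))).2 (X.isApartment.2 7)
  rw [X.x₁_smul _ 7] at hadj
  obtain ⟨v, hv, he⟩ := hΓ.moufang X.A X.isApartment 7 (X.A 6) (X.root.x₁ (-S.one) • X.A 8)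
    (X.isApartment.2 6).symm (X.isApartment.1.ne (show (6 : ZMod 12) ≠ 8 by decide)) hadj
    (fun h => h1 (X.param₁.eq_zero_of_smul hΓ X.isApartment h))
  have he' : v • X.root.x₁ S.one • X.A 8 = X.A 6 := by
    simpa only [neg_neg] using X.smul_x₁_neg_eight hΓ hv he h1
  have hvA : ∀ j : ZMod 12, (j - 7).val ≤ 6 → v • X.A j = X.A j :=
    smul_of_mem_rootGroup X.isApartment hv
  refine ⟨v * X.root.x₁ S.one * v, ⟨v, hv, rfl⟩, X.smul_eq_of_reflection hΓ ?_ ?_ ?_ ?_⟩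
  · rw [mul_smul, mul_smul, he, X.root.x₁_neg, smul_inv_smul, hvA 8 (by decide)]
  · rw [mul_smul, mul_smul, hvA 8 (by decide), he']
  · rw [mul_smul, mul_smul, hvA 7 (by decide), X.x₁_smul _ 7, hvA 7 (by decide)]
  · rw [mul_smul, mul_smul, hvA 1 (by decide), X.x₁_smul _ 1, hvA 1 (by decide)]

namespace IsS₁

variable {X} {s : Γ.Collineation} (hs : X.IsS₁ s)
include hs

omit hΓ in
theorem smul_seven : s • X.A 7 = X.A 7 := hs.2 7

omit hΓ in
theorem smul_eight : s • X.A 8 = X.A 6 := hs.2 8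

omit hΓ in
theorem exists_eq_mul : ∃ v ∈ Γ.rootGroup X.A 7, s = v * X.root.x₁ S.one * v ∧
    v • X.A 6 = X.root.x₁ (-S.one) • X.A 8 := by
  obtain ⟨⟨v, hv, rfl⟩, hs⟩ := hs
  refine ⟨v, hv, rfl, ?_⟩
  have h6 : (v * X.root.x₁ S.one * v) • X.A 6 = X.A 8 := hs 6
  have h8 : v⁻¹ • X.A 8 = X.A 8 :=
    smul_of_mem_rootGroup X.isApartment (inv_mem hv) 8 (by decide)
  rwa [mul_smul, mul_smul, ← eq_inv_smul_iff, h8, ← eq_inv_smul_iff, ← X.root.x₁_neg] at h6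

theorem exists_conj_eq : ∃ v ∈ Γ.rootGroup X.A 7,
    (∀ g, s * g * s⁻¹ = v * (X.root.x₁ S.one * (v * g * v⁻¹) * (X.root.x₁ S.one)⁻¹) * v⁻¹) ∧
      ∀ t, v * X.root.x₆ t * v⁻¹ = s * X.root.x₂ t * s⁻¹ := by
  obtain ⟨v, hv, rfl, he⟩ := hs.exists_eq_mul
  have hconj g : v * X.root.x₁ S.one * v * g * (v * X.root.x₁ S.one * v)⁻¹ =
      v * (X.root.x₁ S.one * (v * g * v⁻¹) * (X.root.x₁ S.one)⁻¹) * v⁻¹ := by group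
  refine ⟨v, hv, hconj, fun t => ?_⟩
  obtain ⟨τ, hτ, e⟩ := X.conj_x₂ hΓ hv he t
  rw [S.norm_neg, S.norm_one, mul_neg, mul_one, neg_neg] at hτ
  rw [hconj, e, hτ, X.root.x₁_neg]
  group

theorem conj₂ (t : F) : s * X.root.x₂ t * s⁻¹ = X.root.x₆ t := by
  obtain ⟨v, hv, -, h⟩ := hs.exists_conj_eq hΓ
  obtain ⟨t', ht' : X.root.x₆ t' = _⟩ :=
    X.param₆.exists_eq (X.conj_mem_of_reflection hs.2 6 (by decide) (X.param₂.mem t))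
  refine ht'.symm.trans (congrArg _ (X.param₆.smul_inj hΓ X.isApartment (j := 1) ?_))
  calc X.root.x₆ t' • X.A 1 = (v * X.root.x₆ t * v⁻¹) • X.A 1 := by rw [ht', h]; rfl
    _ = v • X.root.x₆ t • X.A 1 := by
        rw [mul_smul, mul_smul,
          smul_of_mem_rootGroup X.isApartment (inv_mem hv) 1 (by decide)]
    _ = X.root.x₆ t • X.A 1 := X.smul_x₆_one hv t

theorem conj₆ (t : F) : s * X.root.x₆ t * s⁻¹ = X.root.x₂ (-t) := by
  obtain ⟨v, hv, hconj, h⟩ := hs.exists_conj_eq hΓ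
  obtain ⟨t', ht' : X.root.x₂ t' = _⟩ :=
    X.param₂.exists_eq (X.conj_mem_of_reflection hs.2 2 (by decide) (X.param₆.mem t))
  refine ht'.symm.trans (congrArg _ (X.param₂.smul_inj hΓ X.isApartment (j := 9) ?_))
  calc X.root.x₂ t' • X.A 9 = (s * X.root.x₆ t * s⁻¹) • X.A 9 := by rw [ht']; rfl
    _ = v • X.root.x₂ (-t) • X.A 9 := by
        rw [hconj, h, hs.conj₂ hΓ, X.root.conj₆, mul_smul, mul_smul,
          smul_of_mem_rootGroup X.isApartment (inv_mem hv) 9 (by decide), X.tail_smul_nine,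
          S.norm_one, mul_one]
    _ = X.root.x₂ (-t) • X.A 9 := X.smul_x₂_nine hv _

theorem conj₄ (t : F) : s * X.root.x₄ t * s⁻¹ = X.root.x₄ t := by
  have h := map_groupComm (MulAut.conj s).toMonoidHom (X.root.x₂ t) (X.root.x₆ 1)
  rw [X.root.comm₂₆, mul_one] at h
  simp only [MulEquiv.toMonoidHom_eq_coe, MonoidHom.coe_coe, MulAut.conj_apply] at h
  rw [h, hs.conj₂ hΓ, hs.conj₆ hΓ, ← groupComm_inv, X.root.comm₂₆, neg_mul, one_mul,
    X.root.x₄_neg, inv_inv]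

theorem conj₅ (b : J) : s * X.root.x₅ b * s⁻¹ = X.root.x₃ (-b) := by
  obtain ⟨v, hv, hconj, -⟩ := hs.exists_conj_eq hΓ
  have hviA : ∀ j : ZMod 12, (j - 7).val ≤ 6 → v⁻¹ • X.A j = X.A j :=
    smul_of_mem_rootGroup X.isApartment (inv_mem hv)
  obtain ⟨b', hb' : X.root.x₃ b' = _⟩ :=
    X.param₃.exists_eq (X.conj_mem_of_reflection hs.2 3 (by decide) (X.param₅.mem b))
  obtain ⟨ξ, hξ : X.root.x₆ ξ = v * X.root.x₅ b * v⁻¹ * (X.root.x₅ b)⁻¹⟩ := X.param₆.exists_eq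
    (commutator_mem_rootGroup (i := 5) X.isApartment hv (X.param₅.mem b))
  have e : X.root.x₃ b' = v * (X.root.x₁ S.one * X.root.x₆ ξ * (X.root.x₁ S.one)⁻¹ *
      (X.root.x₁ S.one * X.root.x₅ b * (X.root.x₁ S.one)⁻¹)) * v⁻¹ := by
    rw [hb', hξ]
    exact (hconj (X.root.x₅ b)).trans (by group)
  rw [X.root.conj₆, X.root.conj₅, X.root.tail_mul_tail, S.norm_one, S.adj_one, mul_one] at e
  have h9 := congrArg (· • X.A 9) e
  have h10 := congrArg (· • X.A 10) e
  simp only [mul_smul] at h9 h10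
  rw [X.x₃_smul _ 9, hviA 9 (by decide), X.tail_smul_nine,
    X.smul_x₂_nine hv] at h9
  have hξb := X.param₂.eq_zero_of_smul hΓ X.isApartment h9.symm
  rw [hviA 10 (by decide), X.tail_smul_ten, hξb, X.root.x₂_zero, one_smul,
    X.smul_x₃_ten hv] at h10
  have hb'ξ := X.param₃.smul_inj hΓ X.isApartment h10
  refine hb'.symm.trans (congrArg _ ?_)
  have hξ' : ξ = S.tr S.one b := by linear_combination -hξb
  rw [hb'ξ, hξ', S.tr_symm]
  nth_rw 3 [S.one_cross b]
  abel

omit hΓ in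
theorem exists_smul_x₁ (hΓ : Γ.IsMoufangHexagon) {α : J} (hα : α ≠ 0) :
    ∃ κ, s • X.root.x₁ α • X.A 8 = X.root.x₁ κ • X.A 8 := by
  have hadj := (smul_adj s).2 ((smul_adj (X.root.x₁ α)).2 (X.isApartment.2 7))
  rw [X.x₁_smul _ 7, hs.smul_seven] at hadj
  obtain ⟨κ, hκ⟩ := X.exists_x₁_smul hΓ hadj fun h => hα <|
    X.param₁.eq_zero_of_smul hΓ X.isApartment (smul_left_cancel s (h.trans hs.smul_eight.symm))
  exact ⟨κ, hκ.symm⟩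

theorem exists_conj_conj_x₆ {α κ : J} (h : s • X.root.x₁ α • X.A 8 = X.root.x₁ κ • X.A 8)
    (t : F) : ∃ τ, s * (X.root.x₁ α * X.root.x₆ t * (X.root.x₁ α)⁻¹) * s⁻¹ =
      X.root.x₁ κ * X.root.x₆ τ * (X.root.x₁ κ)⁻¹ := by
  set k := (X.root.x₁ κ)⁻¹ * s * X.root.x₁ α with hk
  have h8 : k • X.A 8 = X.A 8 := by rw [mul_smul, mul_smul, h, inv_smul_smul]
  have h7 : k • X.A 7 = X.A 7 := by
    rw [mul_smul, mul_smul, X.x₁_smul _ 7, hs.smul_seven, inv_smul_eq_iff, X.x₁_smul _ 7]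
  have h1 : k • X.A 1 = X.A 1 := by
    rw [mul_smul, mul_smul, X.x₁_smul _ 1, hs.2 1, inv_smul_eq_iff]
    exact (X.x₁_smul _ 1).symm
  have hbetween := smul_eq_between hΓ.hexagon X.isApartment (i := 8) (n := 5) le_rfl h8 h1
  have hmem : k * X.root.x₆ t * k⁻¹ ∈ Γ.rootGroup X.A 6 := by
    refine conj_mem_rootGroup (X.param₆.mem t) fun i hi1 hi5 => ⟨i, hi1, hi5, ?_⟩
    obtain rfl | hi : i = 1 ∨ 2 ≤ i := by omega
    · exact h7.symm
    · have := hbetween (i - 2) (by omega)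
      rw [Nat.cast_sub hi, show (8 + (i - (2 : ℕ)) : ZMod 12) = 6 + i by push_cast; ring] at this
      exact this.symm
  obtain ⟨τ, hτ : X.root.x₆ τ = _⟩ := X.param₆.exists_eq hmem
  exact ⟨τ, by rw [hτ, hk]; group⟩

theorem conj_tail (t : F) (a : J) {a' : J} (ha : s * X.root.x₃ a * s⁻¹ = X.root.x₅ a')
    (r : F) (b : J) (u : F) : s * X.root.tail t a r b u * s⁻¹ =
      X.root.tail (-u) (-b) (r + S.tr b a' + u * t) a' t := by
  have h : s * X.root.tail t a r b u * s⁻¹ = s * X.root.x₂ t * s⁻¹ * (s * X.root.x₃ a * s⁻¹) *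
      (s * X.root.x₄ r * s⁻¹) * (s * X.root.x₅ b * s⁻¹) * (s * X.root.x₆ u * s⁻¹) := by
    rw [RootData.tail]
    group
  rw [h, hs.conj₂ hΓ, ha, hs.conj₄ hΓ, hs.conj₅ hΓ, hs.conj₆ hΓ, X.root.x₂_eq_tail,
    X.root.x₃_eq_tail, X.root.x₄_eq_tail, X.root.x₅_eq_tail, X.root.x₆_eq_tail]
  simp only [X.root.tail_mul_tail]
  congr 1 <;> simp

theorem coordinates_of_smul_x₁ {α κ : J} (h : s • X.root.x₁ α • X.A 8 = X.root.x₁ κ • X.A 8)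
    (t : F) : t = -(t * S.norm α) * S.norm κ ∧ t • α = (t * S.norm α) • S.adj κ ∧
      s * X.root.x₃ (-(t • S.adj α)) * s⁻¹ = X.root.x₅ ((t * S.norm α) • κ) := by
  obtain ⟨a', ha' : X.root.x₅ a' = _⟩ := X.param₅.exists_eq
    (X.conj_mem_of_reflection hs.2 5 (by decide) (X.param₃.mem (-(t • S.adj α))))
  obtain ⟨τ, hτ⟩ := hs.exists_conj_conj_x₆ hΓ h t
  rw [X.root.conj₆, X.root.conj₆, hs.conj_tail hΓ _ _ ha'.symm] at hτ
  obtain ⟨h₂, h₃, -, h₅, rfl⟩ := X.tail_inj hΓ hτ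
  refine ⟨by linear_combination -h₂, ?_, ?_⟩
  · rwa [neg_neg, neg_smul, neg_neg] at h₃
  · rw [neg_smul, neg_neg] at h₅
    rw [← h₅, ha']
    rfl

theorem smul_x₁ {α : J} (hα : α ≠ 0) :
    s • X.root.x₁ α • X.A 8 = X.root.x₁ (-S.inv α) • X.A 8 := by
  obtain ⟨κ, h⟩ := hs.exists_smul_x₁ hΓ hα
  obtain ⟨hN, hadj, -⟩ := hs.coordinates_of_smul_x₁ hΓ h 1
  have hκ : κ ≠ 0 := by
    rintro rfl
    simp [S.norm_zero] at hN
  have hinv : S.inv κ = -α := by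
    have := S.norm_ne_zero hκ
    rw [← one_smul F α, hadj, HexagonalSystem.inv, ← neg_smul]
    congr 1
    field_simp
    linear_combination hN
  rw [h, ← S.inv_neg, ← hinv, S.inv_inv hκ]

theorem conj₃ (a : J) : s * X.root.x₃ a * s⁻¹ = X.root.x₅ a := by
  obtain rfl | ha := eq_or_ne a 0
  · rw [X.root.x₃_zero, X.root.x₅_zero, mul_one, mul_inv_cancel]
  · have hN := S.norm_ne_zero ha
    have h := (hs.coordinates_of_smul_x₁ hΓ (hs.smul_x₁ hΓ (S.adj_ne_zero ha)) (-(S.norm a)⁻¹)).2.2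
    have hinv : S.inv (S.adj a) = (S.norm a)⁻¹ • a := by
      rw [HexagonalSystem.inv, S.norm_adj, S.adj_adj, smul_smul]
      congr 1
      field_simp
    rw [S.adj_adj, hinv, S.norm_adj, smul_smul, smul_neg, smul_smul, ← neg_smul, ← neg_smul] at h
    convert h using 3 <;> field_simp <;> simp

end IsS₁

end HexagonCoordinates

/-! ### Collineations that fix the apartment -/

theorem IsParametrisation.exists_conj {G M : Type*} [Group G] [AddCommGroup M] {x : M → G}
    {U : Subgroup G} (hx : IsParametrisation x U) {g : G}
    (hg : g ∈ Subgroup.normalizer (U : Set G)) :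
    ∃ φ : M ≃+ M, ∀ a, g * x a * g⁻¹ = x (φ a) := by
  rw [Subgroup.mem_normalizer_iff] at hg
  choose f hf using fun a => hx.exists_eq ((hg _).1 (hx.mem a))
  choose f' hf' using fun a => hx.exists_eq (g := g⁻¹ * x a * g)
    ((hg _).2 (by simpa [mul_assoc] using hx.mem a))
  refine ⟨⟨⟨f, f', fun a => hx.2.1 ?_, fun a => hx.2.1 ?_⟩, fun a b => hx.2.1 ?_⟩,
    fun a => (hf a).symm⟩
  · rw [hf', hf]; group
  · rw [hf, hf']; group
  · simp only [hf, hx.1]; group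

theorem PointLineGeometry.mem_normalizer_rootGroup {P : Type u} {L : Type v}
    {Γ : PointLineGeometry P L} {A : ZMod 12 → P ⊕ L} {g : Γ.Collineation}
    (hg : ∀ j, g • A j = A j) (i : ZMod 12) :
    g ∈ Subgroup.normalizer (Γ.rootGroup A i : Set Γ.Collineation) := by
  refine Subgroup.mem_normalizer_iff.2 fun y =>
    ⟨fun hy => conj_mem_rootGroup hy fun k h1 h5 => ⟨k, h1, h5, (hg _).symm⟩, fun hy => ?_⟩
  have := conj_mem_rootGroup (B := A) (j := i) (n := g⁻¹) hy
    fun k h1 h5 => ⟨k, h1, h5, eq_inv_smul_iff.2 (hg _)⟩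
  simpa [mul_assoc] using this

namespace HexagonalSystem

variable {F : Type w} {J : Type z} [Field F] [AddCommGroup J] [Module F J]

/-- Pairs of linear automorphisms that preserve the structure of `S` up to the scalar `l`: these are
the actions on `U₁` and `U₃` of the collineations that fix the apartment and centralise `U₄`. -/
structure IsSimilitude (S : HexagonalSystem F J) (φ ψ : J ≃ₗ[F] J) (l : F) : Prop where
  ne_zero : l ≠ 0
  norm : ∀ a, l ^ 2 * S.norm (φ a) = S.norm a
  adj : ∀ a, ψ (S.adj a) = l • S.adj (φ a)
  tr : ∀ a b, l * S.tr (φ a) (ψ b) = S.tr a b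

theorem exists_isSimilitude_of_addEquiv (S : HexagonalSystem F J) {f₁ f₃ f₅ : J ≃+ J}
    {f₂ f₆ : F ≃+ F} (h₂₆ : ∀ t u, f₂ t * f₆ u = t * u)
    (h₁₃ : ∀ a b, f₂ (S.tr a b) = S.tr (f₁ a) (f₃ b))
    (hnorm : ∀ a t, f₂ (t * S.norm a) = f₆ t * S.norm (f₁ a))
    (hadj : ∀ a t, f₃ (t • S.adj a) = f₆ t • S.adj (f₁ a))
    (h₅ : ∀ a t, f₅ (t • a) = f₆ t • f₁ a) :
    ∃ φ ψ l, S.IsSimilitude φ ψ l ∧ ⇑φ = f₁ ∧ ⇑ψ = f₃ ∧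
      (∀ t, f₂ t = l⁻¹ * t) ∧ (∀ a, f₅ a = l • φ a) ∧ ∀ t, f₆ t = l * t := by
  have hl : f₂ 1 * f₆ 1 = 1 := by rw [h₂₆, one_mul]
  have hl0 : f₆ 1 ≠ 0 := right_ne_zero_of_mul_eq_one hl
  have h₂ t : f₂ t = (f₆ 1)⁻¹ * t := by rw [eq_inv_mul_iff_mul_eq₀ hl0, mul_comm, h₂₆, mul_one]
  have h₆ t : f₆ t = f₆ 1 * t := by linear_combination (-f₆ t) * hl + f₆ 1 * h₂₆ 1 t
  have h₁ a : f₅ a = f₆ 1 • f₁ a := by rw [← h₅, one_smul]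
  have lin₁ (t : F) (a : J) : f₁ (t • a) = t • f₁ a :=
    smul_right_injective J hl0 (by simp only [← h₁, h₅, h₆ t, mul_smul])
  have lin₃ (t : F) (a : J) : f₃ (t • a) = t • f₃ a := by
    have h (t : F) (a : J) : f₃ (t • S.adj a) = t • f₃ (S.adj a) := by
      rw [hadj, h₆, mul_comm, mul_smul, ← hadj, one_smul]
    rcases eq_or_ne a 0 with rfl | ha
    · simp
    rw [show a = (S.norm a)⁻¹ • S.adj (S.adj a) by
      rw [S.adj_adj, inv_smul_smul₀ (S.norm_ne_zero ha)], smul_smul, h, h, mul_smul]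
  refine ⟨f₁.toLinearEquiv lin₁, f₃.toLinearEquiv lin₃, f₆ 1,
    ⟨hl0, fun a => ?_, fun a => ?_, fun a b => ?_⟩, rfl, rfl, h₂, h₁, h₆⟩
  · have h := hnorm a 1
    rw [one_mul, h₂, inv_mul_eq_iff_eq_mul₀ hl0] at h
    rw [h, pow_two, mul_assoc]
    rfl
  · have h := hadj a 1
    rwa [one_smul] at h
  · have h := h₁₃ a b
    rw [h₂, inv_mul_eq_iff_eq_mul₀ hl0] at h
    exact h.symm

namespace IsSimilitude

variable {S : HexagonalSystem F J} {φ ψ : J ≃ₗ[F] J} {l : F} (hg : S.IsSimilitude φ ψ l)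
include hg

theorem cross (a b : J) : ψ (S.cross a b) = l • S.cross (φ a) (φ b) := by
  have h := hg.adj (a + b)
  rw [S.adj_add, map_add, map_add, hg.adj, hg.adj, map_add φ, S.adj_add, smul_add, smul_add] at h
  exact add_left_cancel (add_right_cancel h)

theorem map_adj (a : J) : φ (S.adj a) = S.adj (ψ a) := by
  rcases eq_or_ne a 0 with rfl | ha
  · simp [S.adj_zero]
  have hN := S.norm_ne_zero ha
  have hψ : ψ a = (S.norm a)⁻¹ • l • S.adj (φ (S.adj a)) := by
    rw [← hg.adj, S.adj_adj, map_smul, inv_smul_smul₀ hN]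
  have hnorm := hg.norm (S.adj a)
  rw [S.norm_adj] at hnorm
  rw [hψ, S.adj_smul, S.adj_smul, S.adj_adj, smul_smul, smul_smul, mul_assoc, hnorm, inv_pow,
    inv_mul_cancel₀ (pow_ne_zero 2 hN), one_smul]

theorem map_cross (a b : J) : φ (S.cross a b) = S.cross (ψ a) (ψ b) := by
  have h := hg.map_adj (a + b)
  rw [S.adj_add, map_add, map_add, hg.map_adj, hg.map_adj, map_add ψ, S.adj_add] at h
  exact add_left_cancel (add_right_cancel h)

end IsSimilitude

end HexagonalSystem

namespace HexagonCoordinates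

variable {P : Type u} {L : Type v} {Γ : PointLineGeometry P L}
  {F : Type w} {J : Type z} [Field F] [AddCommGroup J] [Module F J]
  {S : HexagonalSystem F J} (X : HexagonCoordinates Γ S)

/-- `g` fixes the apartment and centralises `U₄`; its action on the root groups is given by
`φ`, `ψ` and `l`. -/
structure IsTorus (g : Γ.Collineation) (φ ψ : J ≃ₗ[F] J) (l : F) : Prop extends
    S.IsSimilitude φ ψ l where
  fix : ∀ j, g • X.A j = X.A j
  conj₁ : ∀ a, g * X.root.x₁ a * g⁻¹ = X.root.x₁ (φ a)
  conj₂ : ∀ t, g * X.root.x₂ t * g⁻¹ = X.root.x₂ (l⁻¹ * t)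
  conj₃ : ∀ a, g * X.root.x₃ a * g⁻¹ = X.root.x₃ (ψ a)
  conj₄ : ∀ t, g * X.root.x₄ t * g⁻¹ = X.root.x₄ t
  conj₅ : ∀ a, g * X.root.x₅ a * g⁻¹ = X.root.x₅ (l • φ a)
  conj₆ : ∀ t, g * X.root.x₆ t * g⁻¹ = X.root.x₆ (l * t)

theorem exists_isTorus (hΓ : Γ.IsMoufangHexagon) {g : Γ.Collineation}
    (hg : ∀ j, g • X.A j = X.A j) (h₄ : ∀ t, g * X.root.x₄ t * g⁻¹ = X.root.x₄ t) :
    ∃ φ ψ l, X.IsTorus g φ ψ l := by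
  have hn := mem_normalizer_rootGroup hg
  obtain ⟨f₁, (e₁ : ∀ a, g * X.root.x₁ a * g⁻¹ = X.root.x₁ (f₁ a))⟩ := X.param₁.exists_conj (hn 1)
  obtain ⟨f₂, (e₂ : ∀ a, g * X.root.x₂ a * g⁻¹ = X.root.x₂ (f₂ a))⟩ := X.param₂.exists_conj (hn 2)
  obtain ⟨f₃, (e₃ : ∀ a, g * X.root.x₃ a * g⁻¹ = X.root.x₃ (f₃ a))⟩ := X.param₃.exists_conj (hn 3)
  obtain ⟨f₅, (e₅ : ∀ a, g * X.root.x₅ a * g⁻¹ = X.root.x₅ (f₅ a))⟩ := X.param₅.exists_conj (hn 5)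
  obtain ⟨f₆, (e₆ : ∀ a, g * X.root.x₆ a * g⁻¹ = X.root.x₆ (f₆ a))⟩ := X.param₆.exists_conj (hn 6)
  have hcomm y z : g * groupComm y z * g⁻¹ = groupComm (g * y * g⁻¹) (g * z * g⁻¹) :=
    map_groupComm (MulAut.conj g).toMonoidHom y z
  have h₂₆ t u : f₂ t * f₆ u = t * u := by
    have h := hcomm (X.root.x₂ t) (X.root.x₆ u)
    rw [e₂, e₆, X.root.comm₂₆, X.root.comm₂₆, h₄] at h
    exact (X.param₄.2.1 h).symm
  have h₁₃ a b : f₂ (S.tr a b) = S.tr (f₁ a) (f₃ b) := by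
    have h := hcomm (X.root.x₁ a) (X.root.x₃ b)
    rw [e₁, e₃, X.root.comm₁₃, X.root.comm₁₃, e₂] at h
    exact X.param₂.2.1 h
  have h₁₆ a t : f₂ (-(t * S.norm a)) = -(f₆ t * S.norm (f₁ a)) ∧
      f₃ (t • S.adj a) = f₆ t • S.adj (f₁ a) ∧ f₅ (-(t • a)) = -(f₆ t • f₁ a) := by
    have h := hcomm (X.root.x₁ a) (X.root.x₆ t)
    have hconj (y₂ y₃ y₄ y₅ : Γ.Collineation) : g * (y₂ * y₃ * y₄ * y₅) * g⁻¹ =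
        (g * y₂ * g⁻¹) * (g * y₃ * g⁻¹) * (g * y₄ * g⁻¹) * (g * y₅ * g⁻¹) := by group
    have htail t a r b : X.root.x₂ t * X.root.x₃ a * X.root.x₄ r * X.root.x₅ b =
        X.root.tail t a r b 0 := by rw [RootData.tail, X.root.x₆_zero, mul_one]
    rw [e₁, e₆, X.root.comm₁₆, X.root.comm₁₆, hconj, e₂, e₃, e₅, h₄, htail, htail] at h
    obtain ⟨h₂, h₃, -, h₅, -⟩ := X.tail_inj hΓ h
    exact ⟨h₂, h₃, h₅⟩
  obtain ⟨φ, ψ, l, hsim, hφ, hψ, h₂, h₅, h₆⟩ := S.exists_isSimilitude_of_addEquiv h₂₆ h₁₃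
    (fun a t => by simpa using (h₁₆ a t).1) (fun a t => (h₁₆ a t).2.1)
    (fun a t => by simpa using (h₁₆ a t).2.2)
  exact ⟨φ, ψ, l, hsim, hg, fun a => by rw [e₁, hφ], fun t => by rw [e₂, h₂],
    fun a => by rw [e₃, hψ], h₄, fun a => by rw [e₅, h₅], fun t => by rw [e₆, h₆]⟩

end HexagonCoordinates

/-! ### Point-domestic collineations fixing an ovoid pointwise -/

namespace PointLineGeometry

variable {P : Type u} {L : Type v} {Γ : PointLineGeometry P L}

theorem IsGeneralisedHexagon.exists_isApartment_of_dist_eq_six (hΓ : Γ.IsGeneralisedHexagon)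
    {x y : P ⊕ L} (h : Γ.incidenceGraph.dist x y = 6) :
    ∃ A : ZMod 12 → P ⊕ L, Γ.IsApartment A ∧ A 7 = x ∧ A 1 = y := by
  obtain ⟨A, hA, ⟨i, rfl⟩, ⟨j, rfl⟩⟩ := hΓ.exists_apartment x y
  rw [hA.dist_eq hΓ] at h
  have hj : ∀ i j : ZMod 12, min (j - i).val (i - j).val = 6 →
      7 + (i - 7) = i ∧ 1 + (i - 7) = j := by decide
  exact ⟨_, hA.shift (i - 7), congrArg A (hj i j h).1, congrArg A (hj i j h).2⟩

theorem IsApartment.exists_fold {A : ZMod 12 → P ⊕ L} (hA : Γ.IsApartment A)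
    (hΓ : Γ.IsGeneralisedHexagon) {g : Γ.Collineation} (h₇ : g • A 7 = A 7) (h₁ : g • A 1 = A 1)
    (h₈ : g • A 8 ≠ A 8) :
    ∃ B : ZMod 12 → P ⊕ L, Γ.IsApartment B ∧ B 7 = A 7 ∧ B 1 = A 1 ∧ B 8 = A 8 ∧
      B 6 = g • A 8 := by
  have h₀ : g • A 0 ≠ A 0 := fun e =>
    h₈ (smul_eq_between hΓ hA (g := g) (i := 7) (n := 5) le_rfl h₇ e 1 (by omega))
  have hadj (i) : Γ.incidenceGraph.Adj (g • A (i + 1)) (g • A i) :=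
    ((smul_adj g).2 (hA.2 i)).symm
  have hne (i) : g • A i ≠ g • A (i + 2) := fun e => hA.ne_add_two i (smul_left_cancel g e).symm
  have hadj₀ : Γ.incidenceGraph.Adj (A 1) (g • A 0) := by simpa [h₁] using hadj 0
  have hadj₇ : Γ.incidenceGraph.Adj (g • A 8) (A 7) := by have := hadj 7; rwa [h₇] at this
  have hne₁₁ : g • A 11 ≠ A 1 := h₁ ▸ hne 11
  have hne₇ : A 7 ≠ g • A 9 := by have := hne 7; rwa [h₇] at this
  refine ⟨![A 0, A 1, g • A 0, g • A 11, g • A 10, g • A 9, g • A 8, A 7, A 8, A 9, A 10, A 11],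
    hΓ.isApartment_of_circuit (fun i => ?_) (fun i => ?_), rfl, rfl, rfl, rfl⟩
  · fin_cases i
    exacts [hA.2 0, hadj₀, hadj 11, hadj 10, hadj 9, hadj 8, hadj₇, hA.2 7, hA.2 8, hA.2 9,
      hA.2 10, hA.2 11]
  · fin_cases i
    exacts [h₀, hne₁₁, hne 10, hne 9, hne 8, hne₇, h₈.symm, hA.ne_add_two 7, hA.ne_add_two 8,
      hA.ne_add_two 9, hA.ne_add_two 10, hA.ne_add_two 11]

/-- `θ` is a nontrivial point-domestic collineation that fixes the ovoid `O` pointwise. -/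
structure IsDomesticFixing (Γ : PointLineGeometry P L) (θ : Γ.Collineation) (O : Set P) :
    Prop where
  ne_one : θ ≠ 1
  domestic : Γ.IsPointDomestic θ
  ovoid : Γ.IsOvoid O
  smul : ∀ x ∈ Sum.inl '' O, θ • (x : P ⊕ L) = x

namespace IsDomesticFixing

variable {θ : Γ.Collineation} {O : Set P} (h : Γ.IsDomesticFixing θ O)
include h

theorem conj (hΓ : Γ.IsGeneralisedHexagon) (n : Γ.Collineation) :
    Γ.IsDomesticFixing (n * θ * n⁻¹) (n.1.1 '' O) := by
  have hn (p : P) : n • (Sum.inl p : P ⊕ L) = Sum.inl (n.1.1 p) := rfl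
  have hdist (x y : P ⊕ L) : Γ.incidenceGraph.dist (n⁻¹ • x) y =
      Γ.incidenceGraph.dist x (n • y) := by
    rw [← smul_dist hΓ n, smul_inv_smul]
  refine ⟨by simpa using h.ne_one, fun p hp => h.domestic (n⁻¹.1.1 p) ?_,
    ⟨?_, fun x => ?_⟩, ?_⟩
  · have hq : n⁻¹ • (Sum.inl p : P ⊕ L) = Sum.inl (n⁻¹.1.1 p) := rfl
    rw [← hq, Opposite, hdist, ← mul_smul, ← mul_smul]
    exact hp
  · rintro _ ⟨p, hp, rfl⟩ _ ⟨q, hq, rfl⟩ hne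
    rw [Opposite, ← hn, ← hn, smul_dist hΓ]
    exact h.ovoid.1 p hp q hq (ne_of_apply_ne _ hne)
  · obtain ⟨p, hp, hxp⟩ := h.ovoid.2 (n⁻¹ • x)
    exact ⟨_, ⟨p, hp, rfl⟩, by rwa [← hn, ← hdist]⟩
  · rintro _ ⟨_, ⟨p, hp, rfl⟩, rfl⟩
    rw [← hn, mul_smul, mul_smul, inv_smul_smul, h.smul _ ⟨p, hp, rfl⟩]

theorem dist_eq_six {x y : P ⊕ L} (hx : x ∈ Sum.inl '' O) (hy : y ∈ Sum.inl '' O)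
    (hne : x ≠ y) : Γ.incidenceGraph.dist x y = 6 := by
  obtain ⟨p, hp, rfl⟩ := hx
  obtain ⟨q, hq, rfl⟩ := hy
  exact h.ovoid.1 p hp q hq (ne_of_apply_ne _ hne)

theorem smul_ne (hΓ : Γ.IsMoufangHexagon) {x y : P ⊕ L} (hx : x ∈ Sum.inl '' O)
    (hxy : Γ.incidenceGraph.Adj x y) : θ • y ≠ y := by
  obtain ⟨p, hp, rfl⟩ := hx
  exact fun e => h.ne_one (eq_one_of_fixes_ovoid hΓ.hexagon h.ovoid
    (fun q hq => h.smul _ ⟨q, hq, rfl⟩) hΓ.thick hp hxy e)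

theorem pow_three_eq_one (hΓ : Γ.IsMoufangHexagon) {x y : P ⊕ L} (hx : x ∈ Sum.inl '' O)
    (hxy : Γ.incidenceGraph.Adj x y) (h₃ : θ • θ • θ • y = y) : θ ^ 3 = 1 := by
  obtain ⟨p, hp, rfl⟩ := hx
  have hpow (x : P ⊕ L) : θ ^ 3 • x = θ • θ • θ • x := by
    rw [pow_succ, pow_two, mul_smul, mul_smul]
  refine eq_one_of_fixes_ovoid hΓ.hexagon h.ovoid (fun q hq => ?_) hΓ.thick hp hxy
    ((hpow y).trans h₃)
  have hq := h.smul _ ⟨q, hq, rfl⟩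
  rw [hpow, hq, hq, hq]

theorem exists_pair (hΓ : Γ.IsGeneralisedHexagon) :
    ∃ x ∈ Sum.inl '' O, ∃ y ∈ Sum.inl '' O, Γ.incidenceGraph.dist x y = 6 := by
  obtain ⟨z⟩ := hΓ.nonempty
  obtain ⟨p, hp, -⟩ := h.ovoid.2 z
  obtain ⟨A, hA, ⟨i, hi⟩, -⟩ := hΓ.exists_apartment (.inl p) (.inl p)
  obtain ⟨q, hq, hd⟩ := h.ovoid.2 (A (i + (6 : ℕ)))
  refine ⟨_, ⟨p, hp, rfl⟩, _, ⟨q, hq, rfl⟩, h.dist_eq_six ⟨p, hp, rfl⟩ ⟨q, hq, rfl⟩ fun e => ?_⟩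
  have h₆ := hA.dist_add hΓ i 6 le_rfl
  rw [← e, ← hi, SimpleGraph.dist_comm, h₆] at hd
  omega

theorem exists_isApartment (hΓ : Γ.IsMoufangHexagon) : ∃ A : ZMod 12 → P ⊕ L,
    Γ.IsApartment A ∧ A 7 ∈ Sum.inl '' O ∧ A 1 ∈ Sum.inl '' O ∧ θ • A 8 = A 6 := by
  obtain ⟨x, hx, y, hy, hxy⟩ := h.exists_pair hΓ.hexagon
  obtain ⟨A, hA, rfl, rfl⟩ := hΓ.hexagon.exists_isApartment_of_dist_eq_six hxy
  obtain ⟨B, hB, h₇, h₁, h₈, h₆⟩ := hA.exists_fold hΓ.hexagon (h.smul _ hx) (h.smul _ hy)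
    (h.smul_ne hΓ hx (hA.2 7))
  exact ⟨B, hB, h₇ ▸ hx, h₁ ▸ hy, by rw [h₈, h₆]⟩

end IsDomesticFixing

end PointLineGeometry

/-! ### Collineations in standard position -/

theorem PointLineGeometry.IsApartment.dist_smul_eq_six {P : Type u} {L : Type v}
    {Γ : PointLineGeometry P L} {A : ZMod 12 → P ⊕ L} (hA : Γ.IsApartment A)
    (hΓ : Γ.IsGeneralisedHexagon) {g : Γ.Collineation} {i : ZMod 12}
    (h₃ : g • A (i + 3) = A (i + 3)) (h₂ : g • A (i + 2) ≠ A (i + 2)) :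
    Γ.incidenceGraph.dist (g • A i) (A i) = 6 := by
  let c : ℕ → P ⊕ L := fun n => match n with
    | 0 => A i | 1 => A (i + 1) | 2 => A (i + 2) | 3 => A (i + 3) | 4 => g • A (i + 2)
    | 5 => g • A (i + 1) | _ => g • A i
  have hadj (k l : ZMod 12) (hl : l = k + 1) : Γ.incidenceGraph.Adj (A k) (A l) := hl ▸ hA.2 k
  have hne (k l : ZMod 12) (hl : l = k + 2) : A l ≠ A k := hl ▸ hA.ne_add_two k
  have hadj' (k l : ZMod 12) (hl : l = k + 1) : Γ.incidenceGraph.Adj (g • A l) (g • A k) :=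
    (smul_adj g).2 (hadj k l hl).symm
  have hne' (k l : ZMod 12) (hl : l = k + 2) : g • A k ≠ g • A l :=
    fun e => hne k l hl (smul_left_cancel g e).symm
  have hadj₃ : Γ.incidenceGraph.Adj (A (i + 3)) (g • A (i + 2)) := by
    simpa only [h₃] using hadj' (i + 2) (i + 3) (by ring)
  have hne₃ : g • A (i + 1) ≠ A (i + 3) := by
    simpa only [h₃] using hne' (i + 1) (i + 3) (by ring)
  refine hΓ.dist_of_path (c := c) (N := 6) (fun n hn => ?_) (fun n hn => ?_) 0 6 le_rfl le_rfl
  · interval_cases n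
    exacts [hadj _ _ rfl, hadj _ _ (by ring), hadj _ _ (by ring), hadj₃,
      hadj' _ _ (by ring), hadj' _ _ rfl]
  · have : n ≤ 4 := by omega
    interval_cases n
    exacts [hne _ _ rfl, hne _ _ (by ring), h₂, hne₃, hne' _ _ rfl]

namespace HexagonCoordinates

variable {P : Type u} {L : Type v} {Γ : PointLineGeometry P L}
  {F : Type w} {J : Type z} [Field F] [AddCommGroup J] [Module F J]
  {S : HexagonalSystem F J} (X : HexagonCoordinates Γ S)

/-- `θ` is a nontrivial point-domestic collineation that fixes the ovoid `O` pointwise, in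
standard position with respect to the apartment `A`. -/
structure IsNormalised (θ : Γ.Collineation) (O : Set P) : Prop extends
    Γ.IsDomesticFixing θ O where
  mem_seven : X.A 7 ∈ Sum.inl '' O
  mem_one : X.A 1 ∈ Sum.inl '' O
  smul_eight : θ • X.A 8 = X.A 6

variable (hΓ : Γ.IsMoufangHexagon)
include hΓ

theorem exists_isNormalised {θ : Γ.Collineation} {O : Set P} (h : Γ.IsDomesticFixing θ O) :
    ∃ n : Γ.Collineation, X.IsNormalised (n * θ * n⁻¹) (n.1.1 '' O) := by
  obtain ⟨B, hB, h₇, h₁, h₈⟩ := h.exists_isApartment hΓ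
  have hleft : (B 7).isLeft = (X.A 7).isLeft := by
    obtain ⟨p, -, hp⟩ := h₇
    obtain ⟨q, hq⟩ := X.isPoint
    rw [← hp, hq]
    rfl
  obtain ⟨n, hn⟩ := hΓ.exists_smul_eq hB X.isApartment hleft
  have hmem {j : ZMod 12} (hj : B j ∈ Sum.inl '' O) : X.A j ∈ Sum.inl '' (n.1.1 '' O) := by
    obtain ⟨p, hp, e⟩ := hj
    exact ⟨_, ⟨p, hp, rfl⟩, by rw [← hn, ← e]; rfl⟩
  exact ⟨n, h.conj hΓ.hexagon n, hmem h₇, hmem h₁, by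
    rw [mul_smul, mul_smul, ← hn 8, inv_smul_smul, h₈, hn]⟩

theorem exists_mul_x₁_smul {k : Γ.Collineation} (h₁ : k • X.A 1 = X.A 1) (h₆ : k • X.A 6 = X.A 6)
    (h₇ : k • X.A 7 = X.A 7) : ∃ c, ∀ j, (k * X.root.x₁ c) • X.A j = X.A j := by
  obtain ⟨c, hc⟩ := X.exists_x₁_smul hΓ (y := k⁻¹ • X.A 8)
    (by rw [← smul_adj k, smul_inv_smul, h₇]; exact X.isApartment.2 7)
    (fun e => X.isApartment.1.ne (show (8 : ZMod 12) ≠ 6 by decide) (by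
      rwa [inv_smul_eq_iff, h₆] at e))
  have hfix {j : ZMod 12} (hj : (j - 1).val ≤ 6) (hk : k • X.A j = X.A j) :
      (k * X.root.x₁ c) • X.A j = X.A j := by
    rw [mul_smul, X.x₁_smul c j hj, hk]
  have hfix₈ : (k * X.root.x₁ c) • X.A 8 = X.A 8 := by rw [mul_smul, hc, smul_inv_smul]
  have hfix₁ := hfix (by decide) h₁
  have hpath := smul_eq_between hΓ.hexagon X.isApartment (i := 8) (n := 5) le_rfl hfix₈ hfix₁
  refine ⟨c, smul_eq_of_smul_eq_on_path hΓ.hexagon X.isApartment (i := 7) (fun n hn => ?_)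
    (hfix (by decide) h₆)⟩
  rcases n with _ | n
  · rw [Nat.cast_zero, add_zero, hfix (by decide) h₇]
  · rw [show (7 : ZMod 12) + (n + 1 : ℕ) = 8 + n by push_cast; ring, hpath n (by omega)]

theorem exists_x₃_x₂_smul {q : P ⊕ L} (h₆ : Γ.incidenceGraph.dist q (X.A 7) = 6)
    (h₃ : Γ.incidenceGraph.dist (X.A 3) q ≤ 3) :
    ∃ a t, X.root.x₃ a • X.root.x₂ t • X.A 1 = q := by
  have hA := X.isApartment
  have h₃₇ : Γ.incidenceGraph.dist (X.A 3) (X.A 7) = 4 := by rw [hA.dist_eq hΓ.hexagon]; decide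
  have h₄₇ : Γ.incidenceGraph.dist (X.A 4) (X.A 7) = 3 := by rw [hA.dist_eq hΓ.hexagon]; decide
  have hd : Γ.incidenceGraph.dist (X.A 3) q = 1 + 1 := by
    have htriangle := hΓ.hexagon.connected.dist_triangle (u := q) (v := X.A 3) (w := X.A 7)
    rw [SimpleGraph.dist_comm (v := X.A 3)] at htriangle
    have hq₇ := hΓ.hexagon.even_dist_iff q (X.A 7)
    have hA₃₇ := hΓ.hexagon.even_dist_iff (X.A 3) (X.A 7)
    rw [h₆, iff_true_left (by decide)] at hq₇
    rw [h₃₇, iff_true_left (by decide)] at hA₃₇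
    have heven := (hΓ.hexagon.even_dist_iff (X.A 3) q).2 (hA₃₇.trans hq₇.symm)
    obtain ⟨k, hk⟩ := heven
    omega
  obtain ⟨m, hm, hmq⟩ := hΓ.hexagon.exists_adj_dist_eq hd
  rw [SimpleGraph.dist_eq_one_iff_adj] at hmq
  have hm₄ : m ≠ X.A 4 := by
    rintro rfl
    have := hΓ.hexagon.dist_eq_five hmq.symm h₆
    omega
  obtain ⟨y₃, hy₃, e₃⟩ := hΓ.moufang X.A hA 3 (X.A 2) m (hA.2 2).symm
    (hA.1.ne (show (2 : ZMod 12) ≠ 4 by decide)) hm hm₄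
  obtain ⟨a, rfl : X.root.x₃ a = y₃⟩ := X.param₃.exists_eq hy₃
  have hadj : Γ.incidenceGraph.Adj (X.A 2) ((X.root.x₃ a)⁻¹ • q) := by
    rwa [← smul_adj (X.root.x₃ a), e₃, smul_inv_smul]
  have hne : (X.root.x₃ a)⁻¹ • q ≠ X.A 3 := fun e => by
    rw [inv_smul_eq_iff, X.x₃_smul a 3] at e
    simp [e] at hd
  obtain ⟨y₂, hy₂, e₂⟩ := hΓ.moufang X.A hA 2 (X.A 1) _ (hA.2 1).symm
    (hA.1.ne (show (1 : ZMod 12) ≠ 3 by decide)) hadj hne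
  obtain ⟨t, rfl : X.root.x₂ t = y₂⟩ := X.param₂.exists_eq hy₂
  exact ⟨a, t, by rw [e₂, smul_inv_smul]⟩

omit hΓ in
theorem IsTorus.conj_tail {X : HexagonCoordinates Γ S} {g : Γ.Collineation} {φ ψ : J ≃ₗ[F] J}
    {l : F} (hg : X.IsTorus g φ ψ l) (t : F) (a : J) (r : F) (b : J) (u : F) :
    g * X.root.tail t a r b u * g⁻¹ =
      X.root.tail (l⁻¹ * t) (ψ a) r (l • φ b) (l * u) := by
  rw [RootData.tail, RootData.tail, ← hg.conj₂, ← hg.conj₃, ← hg.conj₅, ← hg.conj₆]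
  conv_rhs => rw [← hg.conj₄ r]
  group

namespace IsNormalised

variable {X} {θ : Γ.Collineation} {O : Set P} (h : X.IsNormalised θ O)
include h

omit hΓ in
theorem dist_ne (y : Γ.Collineation) :
    Γ.incidenceGraph.dist (y • X.A 1) (θ • y • X.A 1) ≠ 6 := by
  obtain ⟨p, -, hp⟩ := h.mem_one
  rw [← hp]
  exact h.domestic (y.1.1 p)

omit hΓ in
theorem smul_smul (y : Γ.Collineation) : θ • y • X.A 1 = (θ * y * θ⁻¹) • X.A 1 := by
  rw [mul_smul, mul_smul, inv_smul_eq_iff.2 (h.smul _ h.mem_one).symm]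

theorem conj_x₄ {r r' : F} (e : θ * X.root.x₄ r * θ⁻¹ = X.root.x₄ r') : r' = r := by
  by_contra hne
  refine h.dist_ne (X.root.x₄ r) ?_
  rw [h.smul_smul, e, show r' = r + (r' - r) by ring, X.root.add₄, mul_smul,
    smul_dist hΓ.hexagon, SimpleGraph.dist_comm]
  exact X.isApartment.dist_smul_eq_six hΓ.hexagon (X.x₄_smul _ 4) fun e =>
    hne (sub_eq_zero.1 (X.param₄.eq_zero_of_smul hΓ X.isApartment e))

theorem exists_eq_mul {s : Γ.Collineation} (hs : X.IsS₁ s) :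
    ∃ g c φ ψ l, θ = g * X.root.x₁ c * s ∧ X.IsTorus g φ ψ l := by
  have hinv (j) : (θ * s⁻¹) • X.A j = θ • X.A (2 - j) := by
    rw [mul_smul, inv_smul_eq_iff.2]
    rw [hs.2, sub_sub_cancel]
  obtain ⟨c, hc⟩ := X.exists_mul_x₁_smul hΓ (k := θ * s⁻¹)
    ((hinv 1).trans (h.smul _ h.mem_one)) ((hinv 6).trans h.smul_eight)
    ((hinv 7).trans (h.smul _ h.mem_seven))
  generalize hg : θ * s⁻¹ * X.root.x₁ c = g at hc
  have hθ : θ = g * X.root.x₁ (-c) * s := by rw [← hg, X.root.x₁_neg]; group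
  have hg₄ (t) : g * X.root.x₄ t * g⁻¹ = X.root.x₄ t := by
    obtain ⟨r, hr : X.root.x₄ r = _⟩ := X.param₄.exists_eq
      ((Subgroup.mem_normalizer_iff.1 (mem_normalizer_rootGroup hc 4) _).1 (X.param₄.mem t))
    have hconj (y : Γ.Collineation) : g * X.root.x₁ (-c) * s * y * (g * X.root.x₁ (-c) * s)⁻¹ =
        g * (X.root.x₁ (-c) * (s * y * s⁻¹) * (X.root.x₁ (-c))⁻¹) * g⁻¹ := by group
    have hθr : θ * X.root.x₄ t * θ⁻¹ = X.root.x₄ r := by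
      rw [hθ, hconj, hs.conj₄ hΓ, X.root.conj₄, ← X.root.x₄_eq_tail, hr]
      rfl
    exact hr.symm.trans (congrArg X.root.x₄ (h.conj_x₄ hΓ hθr))
  obtain ⟨φ, ψ, l, ht⟩ := X.exists_isTorus hΓ hc hg₄
  exact ⟨g, -c, φ, ψ, l, hθ, ht⟩

theorem exists_mem (b : J) (u : F) : ∃ a t,
    X.root.tail t a (-S.tr a b - t * u) b u • X.A 1 ∈ Sum.inl '' O := by
  obtain ⟨p, hp, hd⟩ := h.ovoid.2 (X.root.tail 0 0 0 b u • X.A 3)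
  generalize hn : X.root.tail 0 0 0 b u = n at hd
  have hn₇ : n • X.A 7 = X.A 7 := hn ▸ X.tail_smul 7 (by decide)
  have hdist (x : P ⊕ L) : Γ.incidenceGraph.dist x (n⁻¹ • Sum.inl p) =
      Γ.incidenceGraph.dist (n • x) (Sum.inl p) := by
    rw [← smul_dist hΓ.hexagon n, smul_inv_smul]
  have h₃₇ : Γ.incidenceGraph.dist (n • X.A 3) (X.A 7) = 4 := by
    rw [← hn₇, smul_dist hΓ.hexagon, X.isApartment.dist_eq hΓ.hexagon]
    decide
  obtain ⟨a, t, e⟩ := X.exists_x₃_x₂_smul hΓ (q := n⁻¹ • Sum.inl p)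
    (by
      rw [SimpleGraph.dist_comm, hdist, hn₇]
      refine h.dist_eq_six h.mem_seven ⟨p, hp, rfl⟩ fun e => ?_
      rw [← e] at hd
      omega)
    (by rwa [hdist])
  refine ⟨a, t, p, hp, ?_⟩
  rw [eq_inv_smul_iff, ← hn] at e
  rw [← e, ← mul_smul, ← mul_smul, X.root.tail_mul_x₃, X.root.tail_mul_x₂, zero_add, zero_add,
    zero_sub]

end IsNormalised

end HexagonCoordinates

/-- The algebraic description `θ = g x₁(c) s₁` of a collineation in standard position, where the
torus element `g` acts by `φ`, `ψ` and `l`. The last field says that `θ` fixes no line through the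
base point. -/
structure HexagonalSystem.IsFolding {F : Type w} {J : Type z} [Field F] [AddCommGroup J]
    [Module F J] (S : HexagonalSystem F J) (φ ψ : J ≃ₗ[F] J) (l : F) (c : J) : Prop extends
    S.IsSimilitude φ ψ l where
  c_ne_zero : c ≠ 0
  norm_c : S.norm c = l
  map_c : l • φ c = S.adj c
  add_eq : ∀ a, a + l • ψ (φ a) = ψ (S.cross c a)
  tr_c_adj : ∀ a, S.tr c (S.adj a) = l * S.tr a (φ a)
  map_ne : ∀ z, z ≠ 0 → φ (c - S.inv z) ≠ z

theorem HexagonalSystem.IsFolding.map_c_eq_inv {F : Type w} {J : Type z} [Field F]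
    [AddCommGroup J] [Module F J] {S : HexagonalSystem F J} {φ ψ : J ≃ₗ[F] J} {l : F} {c : J}
    (hf : S.IsFolding φ ψ l c) : φ c = S.inv c := by
  rw [HexagonalSystem.inv, hf.norm_c, ← hf.map_c, smul_smul, inv_mul_cancel₀ hf.ne_zero, one_smul]

namespace HexagonCoordinates

variable {P : Type u} {L : Type v} {Γ : PointLineGeometry P L}
  {F : Type w} {J : Type z} [Field F] [AddCommGroup J] [Module F J]
  {S : HexagonalSystem F J} {X : HexagonCoordinates Γ S}
  {θ s g : Γ.Collineation} {c : J} {φ ψ : J ≃ₗ[F] J} {l : F}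
  (hs : X.IsS₁ s) (hg : X.IsTorus g φ ψ l) (hθ : θ = g * X.root.x₁ c * s)
include hs hg hθ

theorem smul_six_of_eq_mul : θ • X.A 6 = X.root.x₁ (φ c) • X.A 8 := by
  rw [hθ, mul_smul, hs.2, show (2 - 6 : ZMod 12) = 8 by decide, ← hg.conj₁, mul_smul, mul_smul,
    mul_smul, inv_smul_eq_iff.2 (hg.fix 8).symm]

variable (hΓ : Γ.IsMoufangHexagon)
include hΓ

theorem smul_x₁_of_eq_mul {z : J} (hz : z ≠ 0) :
    θ • X.root.x₁ z • X.A 8 = X.root.x₁ (φ (c - S.inv z)) • X.A 8 := by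
  rw [hθ, mul_smul, hs.smul_x₁ hΓ hz, mul_smul, ← mul_smul (X.root.x₁ c), ← X.root.add₁,
    ← sub_eq_add_neg, ← hg.conj₁, mul_smul, mul_smul, inv_smul_eq_iff.2 (hg.fix 8).symm]

theorem conj_tail_of_eq_mul (a : J) (t : F) (b : J) (u : F) :
    θ * X.root.tail t a (-S.tr a b - t * u) b u * θ⁻¹ =
      X.root.tail (l⁻¹ * (-u - S.tr c b + S.tr (S.adj c) a - t * S.norm c))
        (ψ (-b + S.cross c a - t • S.adj c))
        (-S.tr c (S.adj a) - t ^ 2 * S.norm c + t * S.tr (S.adj c) a)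
        (l • φ (a - t • c)) (l * t) := by
  have hconj (y : Γ.Collineation) :
      θ * y * θ⁻¹ = g * (X.root.x₁ c * (s * y * s⁻¹) * (X.root.x₁ c)⁻¹) * g⁻¹ := by
    rw [hθ]; group
  rw [hconj, hs.conj_tail hΓ t a (hs.conj₃ hΓ a), X.root.conj_tail, hg.conj_tail]
  congr 1
  · rw [map_neg, sub_eq_add_neg (-u)]
  · rw [S.tr_symm b a]; ring

variable {O : Set P} (h : X.IsNormalised θ O)
include h

namespace IsNormalised

/-- The points of the ovoid opposite to `A 7` are parametrised by `a` and `t`, and `θ` fixes each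
of them. -/
theorem tail_smul_mem_and_coordinates_eq (a : J) (t : F) {b : J} (hb : b = l • φ (a - t • c)) :
    X.root.tail t a (-S.tr a b - t * (l * t)) b (l * t) • X.A 1 ∈ Sum.inl '' O ∧
    l * t = -(l * t) - S.tr c b + S.tr (S.adj c) a - t * S.norm c ∧
    a = ψ (-b + S.cross c a - t • S.adj c) ∧
    -S.tr a b - t * (l * t) = -S.tr c (S.adj a) - t ^ 2 * S.norm c + t * S.tr (S.adj c) a := by
  have hl := hg.ne_zero
  obtain ⟨a', t', hm⟩ := h.exists_mem hΓ b (l * t)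
  have hfix := h.smul _ hm
  rw [h.smul_smul, conj_tail_of_eq_mul hs hg hθ hΓ] at hfix
  obtain ⟨h₂, h₃, h₄, h₅, h₆⟩ := X.tail_smul_inj hΓ hfix
  obtain rfl : t' = t := mul_left_cancel₀ hl h₆
  obtain rfl : a' = a := by
    rw [hb] at h₅
    exact sub_left_injective (φ.injective (smul_right_injective J hl h₅))
  refine ⟨hm, ?_, h₃.symm, h₄.symm⟩
  rw [inv_mul_eq_iff_eq_mul₀ hl] at h₂
  linear_combination -h₂

/-- If `c = 0`, then `F` has characteristic `2` and `θ` maps `x₃(1) A 1` to an opposite point. -/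
theorem c_ne_zero : c ≠ 0 := by
  rintro rfl
  have htwo : (2 : F) = 0 := by
    obtain ⟨-, h₂, -, -⟩ := h.tail_smul_mem_and_coordinates_eq hs hg hθ hΓ 0 1 rfl
    simp only [S.norm_zero, S.adj_zero, map_zero, mul_one, smul_zero, sub_zero, add_zero] at h₂
    exact (mul_eq_zero.1 (by linear_combination h₂ : l * 2 = 0)).resolve_left hg.ne_zero
  generalize hb : l • φ S.one = b
  have hneg : -b = b := neg_eq_of_add_eq_zero_right (by rw [← two_smul F b, htwo, zero_smul])
  obtain ⟨hm, -, -, -⟩ :=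
    h.tail_smul_mem_and_coordinates_eq hs hg hθ hΓ S.one 0 (b := b) (by simp [hb])
  simp only [mul_zero, sub_zero] at hm
  have hopp := h.dist_eq_six hm h.mem_one fun e => S.one_ne_zero (X.tail_eq_zero hΓ e).2.1
  have hconj := conj_tail_of_eq_mul hs hg hθ hΓ S.one 0 0 0
  simp only [S.norm_zero, S.adj_zero, map_zero, LinearMap.zero_apply, mul_zero, smul_zero, neg_zero,
    sub_zero, add_zero, ← X.root.x₃_eq_tail, hb, ← X.root.x₅_eq_tail] at hconj
  refine h.dist_ne (X.root.x₃ S.one) ?_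
  rw [h.smul_smul, hconj, ← smul_dist hΓ.hexagon (X.root.x₅ b)⁻¹, inv_smul_smul, ← X.root.x₅_neg,
    hneg, ← mul_smul, ← hopp, X.root.x₅_eq_tail, X.root.tail_mul_x₃, zero_add, zero_sub]

theorem isFolding : S.IsFolding φ ψ l c := by
  obtain ⟨-, -, h₃, h₄⟩ := h.tail_smul_mem_and_coordinates_eq hs hg hθ hΓ 0 1 rfl
  simp only [map_zero, zero_sub, one_smul, map_neg, smul_neg, neg_neg, add_zero,
    S.adj_zero, LinearMap.zero_apply, mul_zero, neg_zero, one_mul, mul_one, one_pow] at h₃ h₄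
  have hall a := h.tail_smul_mem_and_coordinates_eq hs hg hθ hΓ a 0 rfl
  simp only [zero_smul, sub_zero, mul_zero, zero_mul, map_smul,
    smul_eq_mul, add_zero, ne_eq, OfNat.ofNat_ne_zero, not_false_eq_true, zero_pow] at hall
  refine ⟨hg.toIsSimilitude, h.c_ne_zero hs hg hθ hΓ, by linear_combination h₄, ?_, fun a => ?_,
    fun a => ?_, fun z hz e => ?_⟩
  · exact sub_eq_zero.1 (ψ.map_eq_zero_iff.1 h₃.symm)
  · have h₃ := (hall a).2.2.1
    rw [map_add, map_neg, map_smul] at h₃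
    nth_rw 1 [h₃]
    abel
  · linear_combination (hall a).2.2.2
  · have hsmul := smul_x₁_of_eq_mul hs hg hθ hΓ hz
    rw [e] at hsmul
    refine h.smul_ne hΓ h.mem_seven ?_ hsmul
    rw [← X.x₁_smul z 7, smul_adj]
    exact X.isApartment.2 7

theorem orderOf_eq : orderOf θ = 3 := by
  have hf := h.isFolding hs hg hθ hΓ
  refine orderOf_eq_prime (h.pow_three_eq_one hΓ h.mem_seven (X.isApartment.2 7) ?_) h.ne_one
  change θ • θ • θ • X.A 8 = X.A 8
  rw [h.smul_eight, smul_six_of_eq_mul hs hg hθ, hf.map_c_eq_inv,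
    smul_x₁_of_eq_mul hs hg hθ hΓ (S.inv_ne_zero hf.c_ne_zero), S.inv_inv hf.c_ne_zero, sub_self,
    map_zero, X.root.x₁_zero, one_smul]

end IsNormalised

end HexagonCoordinates

namespace HexagonalSystem

variable {F : Type w} {J : Type z} [Field F] [AddCommGroup J] [Module F J]
  (S : HexagonalSystem F J)

theorem inv_smul (k : F) (a : J) : S.inv (k • a) = k⁻¹ • S.inv a := by
  rcases eq_or_ne k 0 with rfl | hk
  · simp [inv, S.adj_zero]
  rw [inv, inv, S.norm_smul, S.adj_smul, smul_smul, smul_smul]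
  congr 1
  rw [mul_inv]
  field_simp

theorem inv_one : S.inv S.one = S.one := by
  rw [inv, S.norm_one, S.adj_one, _root_.inv_one, one_smul]

theorem tr_one_one : S.tr S.one S.one = 3 := by
  have h := S.tr_adj S.one
  rwa [S.adj_one, S.norm_one, mul_one] at h

theorem tr_adj_self (a : J) : S.tr (S.adj a) a = 3 * S.norm a := by rw [S.tr_symm, S.tr_adj]

theorem tr_cross_self (a b : J) : S.tr a (S.cross a b) = 2 * S.tr (S.adj a) b := by
  rw [S.tr_cross, S.cross_self, map_smul, LinearMap.smul_apply, smul_eq_mul]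

theorem eq_zero_of_forall_tr_eq_zero (h3 : (3 : F) ≠ 0) {x : J} (hx : ∀ y, S.tr x y = 0) :
    x = 0 := by
  by_contra hne
  have hcross (b : J) {y : J} (hy : ∀ z, S.tr y z = 0) (z : J) : S.tr (S.cross b y) z = 0 := by
    rw [S.cross_symm, ← S.tr_cross, hy]
  have h := hcross (S.adj x) (hcross S.one hx) S.one
  rw [S.cross_symm S.one x, S.adj_cross, map_add, map_smul, map_smul, LinearMap.add_apply,
    LinearMap.smul_apply, LinearMap.smul_apply, hx, S.tr_one_one, smul_zero, add_zero,
    smul_eq_mul] at h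
  exact mul_ne_zero (S.norm_ne_zero hne) h3 h

theorem cross_cross_cross (a b b' : J) : S.cross (S.cross a b) (S.cross a b') =
    S.tr (S.adj a) b • b' + S.tr (S.adj a) b' • b + S.tr a (S.cross b b') • a -
      S.cross (S.adj a) (S.cross b b') := by
  have hsum := S.adj_cross_adj a (b + b')
  rw [S.adj_add b b', map_add (S.cross a), S.adj_add] at hsum
  simp only [map_add] at hsum
  linear_combination (norm := module) hsum - S.adj_cross_adj a b - S.adj_cross_adj a b'

theorem cross_cross_cross_of_cross_eq {a b b' e : J} (h : S.cross b b' = S.cross a e) :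
    S.cross (S.cross a b) (S.cross a b') =
      S.tr (S.adj a) b • b' + S.tr (S.adj a) b' • b + S.tr (S.adj a) e • a - S.norm a • e := by
  rw [S.cross_cross_cross, h, S.tr_cross_self, S.adj_cross]
  module

theorem smul_eq_smul_of_cross_eq_zero (h3 : (3 : F) ≠ 0) {a₀ a₁ a₂ b₀ b₁ b₂ : J}
    (ha : a₀ + a₁ + a₂ = 0) (hb : b₀ + b₁ + b₂ = 0)
    (h₀ : S.cross a₀ b₀ + S.cross a₁ b₁ + S.cross a₂ b₂ = 0)
    (h₁ : S.cross a₀ b₁ + S.cross a₁ b₂ + S.cross a₂ b₀ = 0) (hN : S.norm a₁ = S.norm a₀)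
    (ht₀ : S.tr (S.adj a₁) b₀ = S.tr (S.adj a₀) b₂) (ht₂ : S.tr (S.adj a₁) b₂ = S.tr (S.adj a₀) b₁)
    (hta : S.tr (S.adj a₁) a₀ = S.tr (S.adj a₀) a₂) :
    S.tr (S.adj a₀) a₁ • b₁ = S.tr (S.adj a₀) a₂ • b₀ := by
  obtain rfl : a₂ = -a₀ - a₁ := by linear_combination (norm := module) ha
  obtain rfl : b₂ = -b₀ - b₁ := by linear_combination (norm := module) hb
  have h₀₁ : S.cross a₀ b₁ = S.cross a₁ b₀ := by
    refine smul_right_injective J h3 ?_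
    simp only [map_sub, map_neg, LinearMap.sub_apply, LinearMap.neg_apply] at h₀ h₁
    linear_combination (norm := module) h₀ + (2 : F) • h₁
  have h₁₁ : S.cross a₁ b₁ = S.cross a₀ (-b₀ - b₁) := by
    simp only [map_sub, map_neg, LinearMap.sub_apply, LinearMap.neg_apply] at h₁ ⊢
    linear_combination (norm := module) -h₁ + (2 : F) • h₀₁
  have h₀₀ : S.cross a₀ b₀ = S.cross a₁ (-b₀ - b₁) := by
    rw [map_sub, map_neg] at h₁₁ ⊢
    rw [h₁₁, ← h₀₁]
    abel
  have hl := S.cross_cross_cross_of_cross_eq h₁₁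
  have hr := S.cross_cross_cross_of_cross_eq h₀₀
  rw [hN, ht₀, ht₂, hta, S.cross_symm a₁ a₀, ← h₀₁, hl] at hr
  linear_combination (norm := module) hr

/-- The transformation `l ψ φ` of `J` attached to a similitude. In a folding it has order three;
for `l = 1` and an automorphism `φ = ψ = h` it is `h²`. -/
def rotation (φ ψ : J ≃ₗ[F] J) (l : F) : J →ₗ[F] J :=
  l • ψ.toLinearMap ∘ₗ φ.toLinearMap

theorem rotation_apply (φ ψ : J ≃ₗ[F] J) (l : F) (a : J) : rotation φ ψ l a = l • ψ (φ a) :=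
  rfl

variable {S} {φ ψ : J ≃ₗ[F] J} {l : F} {c : J}

namespace IsSimilitude

variable (hg : S.IsSimilitude φ ψ l)
include hg

theorem norm_right (a : J) : l * S.norm (ψ a) = S.norm a := by
  rcases eq_or_ne a 0 with rfl | ha
  · simp [S.norm_zero]
  have h := hg.adj (S.adj a)
  rw [hg.map_adj, S.adj_adj, S.adj_adj, map_smul, smul_smul] at h
  exact (smul_left_injective F (ψ.map_ne_zero_iff.2 ha) h).symm

theorem tr_rotation (a b : J) : S.tr (rotation φ ψ l a) (rotation ψ φ l b) = S.tr a b := by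
  rw [rotation_apply, rotation_apply, map_smul, map_smul, LinearMap.smul_apply, S.tr_symm,
    smul_eq_mul, smul_eq_mul, hg.tr, S.tr_symm, hg.tr]

theorem adj_rotation (a : J) : S.adj (rotation φ ψ l a) = rotation ψ φ l (S.adj a) := by
  rw [rotation_apply, rotation_apply, S.adj_smul, ← hg.map_adj, hg.adj, map_smul, smul_smul,
    pow_two]

theorem cross_rotation (a b : J) :
    S.cross (rotation φ ψ l a) (rotation φ ψ l b) = rotation ψ φ l (S.cross a b) := by
  rw [rotation_apply, rotation_apply, rotation_apply, map_smul, map_smul, LinearMap.smul_apply,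
    ← hg.map_cross, hg.cross, map_smul]

theorem norm_rotation (a : J) : S.norm (rotation φ ψ l a) = S.norm a := by
  rw [rotation_apply, S.norm_smul, ← hg.norm a, ← hg.norm_right (φ a)]
  ring

end IsSimilitude

namespace IsFolding

variable (hf : S.IsFolding φ ψ l c)
include hf

theorem sq_sub_add_one_ne_zero (k : F) : k ^ 2 - k + 1 ≠ 0 := by
  intro hk
  have hk0 : k ≠ 0 := by
    rintro rfl
    simp at hk
  have hzero : 1 - k⁻¹ - k = 0 := by
    field_simp
    linear_combination -hk
  refine hf.map_ne (k • S.inv c) (smul_ne_zero hk0 (S.inv_ne_zero hf.c_ne_zero)) (sub_eq_zero.1 ?_)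
  calc
    φ (c - S.inv (k • S.inv c)) - k • S.inv c = (1 - k⁻¹ - k) • S.inv c := by
      rw [S.inv_smul, S.inv_inv hf.c_ne_zero, map_sub, map_smul, hf.map_c_eq_inv]
      module
    _ = 0 := by rw [hzero, zero_smul]

theorem three_ne_zero : (3 : F) ≠ 0 := fun h =>
  hf.sq_sub_add_one_ne_zero (-1) (by linear_combination h)

theorem rotation_c : rotation φ ψ l c = c := by
  have h := hf.add_eq c
  rw [S.cross_self, map_smul, ← hf.map_c, map_smul, two_smul] at h
  exact (add_right_cancel h).symm

theorem rotation_adj_c : rotation ψ φ l (S.adj c) = S.adj c := by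
  rw [← hf.adj_rotation, hf.rotation_c]

theorem cross_adj_c_map (a : J) : S.cross (S.adj c) (φ a) = a + rotation φ ψ l a := by
  rw [rotation_apply, hf.add_eq, hf.cross, ← hf.map_c, map_smul, LinearMap.smul_apply]

theorem tr_adj_c_rotation (a : J) : S.tr (S.adj c) (rotation φ ψ l a) = S.tr (S.adj c) a := by
  rw [S.tr_symm, S.tr_symm _ a, ← hf.tr_rotation a, hf.rotation_adj_c]

theorem add_rotation_add_rotation (a : J) :
    a + rotation φ ψ l a + rotation φ ψ l (rotation φ ψ l a) =
      (l⁻¹ * S.tr (S.adj c) a) • c := by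
  have hl := hf.ne_zero
  generalize hb : rotation φ ψ l a = b
  have hφ : S.cross c b = l • φ (a + b) := by
    apply ψ.injective
    rw [← hf.add_eq, map_smul, map_add, map_add, smul_add, ← rotation_apply, ← rotation_apply, hb]
  have h := S.adj_cross c b
  rw [hφ, map_smul, hf.cross_adj_c_map, hf.norm_c, ← hb, hf.tr_adj_c_rotation, hb, map_add,
    hb] at h
  rw [mul_smul, eq_inv_smul_iff₀ hl]
  linear_combination (norm := module) h

theorem rotation_rotation_rotation (a : J) :
    rotation φ ψ l (rotation φ ψ l (rotation φ ψ l a)) = a := by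
  have h := hf.add_rotation_add_rotation (rotation φ ψ l a)
  rw [hf.tr_adj_c_rotation, ← hf.add_rotation_add_rotation a] at h
  linear_combination (norm := module) h

theorem dual_add_rotation_add_rotation (m : J) :
    m + rotation ψ φ l m + rotation ψ φ l (rotation ψ φ l m) =
      (l⁻¹ * S.tr c m) • S.adj c := by
  rw [← sub_eq_zero]
  refine S.eq_zero_of_forall_tr_eq_zero hf.three_ne_zero fun y => ?_
  have hadjoint (y m : J) : S.tr y (rotation ψ φ l m) =
      S.tr (rotation φ ψ l (rotation φ ψ l y)) m := by
    rw [← hf.tr_rotation _ m, hf.rotation_rotation_rotation]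
  have h := congrArg (S.tr · m) (hf.add_rotation_add_rotation y)
  simp only [map_add, LinearMap.add_apply, map_smul, LinearMap.smul_apply, smul_eq_mul] at h
  rw [S.tr_symm, map_sub, map_add, map_add, hadjoint, hadjoint, hadjoint,
    hf.rotation_rotation_rotation, map_smul (S.tr y), smul_eq_mul, S.tr_symm y (S.adj c)]
  linear_combination h

theorem eq_zero_of_smul_rotation_eq_smul {b : J}
    (hb : b + rotation φ ψ l b + rotation φ ψ l (rotation φ ψ l b) = 0) {p q : F}
    (hpq : p ≠ 0 ∨ q ≠ 0) (h : p • rotation φ ψ l b = q • b) : b = 0 := by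
  rcases eq_or_ne p 0 with rfl | hp
  · rw [zero_smul] at h
    exact (smul_eq_zero.1 h.symm).resolve_left (hpq.resolve_left fun h => h rfl)
  obtain ⟨k, hk⟩ : ∃ k : F, rotation φ ψ l b = k • b :=
    ⟨p⁻¹ * q, by rw [mul_smul, ← h, inv_smul_smul₀ hp]⟩
  rw [hk, map_smul, hk] at hb
  have hzero : ((-k) ^ 2 - -k + 1) • b = 0 := by linear_combination (norm := module) hb
  exact (smul_eq_zero.1 hzero).resolve_left (hf.sq_sub_add_one_ne_zero (-k))

theorem eq_zero_of_tr_cross_eq_zero {a b : J} (ha0 : a ≠ 0) (ha : S.tr (S.adj c) a = 0)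
    (hb : S.tr (S.adj c) b = 0) (h₀ : S.tr c (S.cross a b) = 0)
    (h₁ : S.tr c (S.cross a (rotation φ ψ l b)) = 0) : b = 0 := by
  have h3 := hf.three_ne_zero
  have hsum {x : J} (hx : S.tr (S.adj c) x = 0) :
      x + rotation φ ψ l x + rotation φ ψ l (rotation φ ψ l x) = 0 := by
    rw [hf.add_rotation_add_rotation, hx, mul_zero, zero_smul]
  have hcross {x y : J} (hxy : S.tr c (S.cross x y) = 0) : S.cross x y +
      S.cross (rotation φ ψ l x) (rotation φ ψ l y) +
        S.cross (rotation φ ψ l (rotation φ ψ l x)) (rotation φ ψ l (rotation φ ψ l y)) = 0 := by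
    rw [hf.cross_rotation, hf.cross_rotation, hf.cross_rotation, hf.dual_add_rotation_add_rotation,
      hxy, mul_zero, zero_smul]
  have htr (x : J) : S.tr (S.adj (rotation φ ψ l a)) (rotation φ ψ l x) = S.tr (S.adj a) x := by
    rw [hf.adj_rotation, S.tr_symm, hf.tr_rotation, S.tr_symm]
  have htr' (x : J) : S.tr (S.adj (rotation φ ψ l a)) x =
      S.tr (S.adj a) (rotation φ ψ l (rotation φ ψ l x)) := by
    rw [← htr, hf.rotation_rotation_rotation]
  have hprop := S.smul_eq_smul_of_cross_eq_zero h3 (hsum ha) (hsum hb) (hcross h₀)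
    (by simpa only [hf.rotation_rotation_rotation] using hcross h₁) (hf.norm_rotation a)
    (htr' b) (htr _) (htr' a)
  refine hf.eq_zero_of_smul_rotation_eq_smul (hsum hb) ?_ hprop
  by_contra! hzero
  have h := congrArg (S.tr (S.adj a)) (hsum ha)
  rw [map_add, map_add, hzero.1, hzero.2, S.tr_adj_self, map_zero, add_zero, add_zero] at h
  exact mul_ne_zero h3 (S.norm_ne_zero ha0) h

theorem exists_injective : ∃ f : J →ₗ[F] (Fin 3 → F), Function.Injective f := by
  by_cases h : ∃ a, a ≠ 0 ∧ S.tr (S.adj c) a = 0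
  · obtain ⟨a, ha0, ha⟩ := h
    refine ⟨LinearMap.pi ![S.tr (S.adj c), S.tr c ∘ₗ S.cross a,
      S.tr c ∘ₗ S.cross a ∘ₗ rotation φ ψ l], (injective_iff_map_eq_zero _).2 fun b hb => ?_⟩
    exact hf.eq_zero_of_tr_cross_eq_zero ha0 ha (congrFun hb 0) (congrFun hb 1) (congrFun hb 2)
  · push Not at h
    refine ⟨LinearMap.pi fun _ => S.tr (S.adj c), (injective_iff_map_eq_zero _).2 fun b hb => ?_⟩
    by_contra hb0
    exact h b hb0 (congrFun hb 0)

theorem moduleFinite : Module.Finite F J :=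
  let ⟨f, hf⟩ := hf.exists_injective
  .of_injective f hf

theorem finrank_le_three : Module.finrank F J ≤ 3 := by
  obtain ⟨f, hinj⟩ := hf.exists_injective
  simpa only [Module.finrank_fin_fun] using LinearMap.finrank_le_finrank_of_injective hinj

end IsFolding

end HexagonalSystem

section FinThreeBasis

variable {F : Type w} {J : Type z} [Field F] [AddCommGroup J] [Module F J]
  {x y z : J} {b : Module.Basis (Fin 3) F J} (hb : ⇑b = ![x, y, z])
include hb

theorem exists_smul_add_smul_add_smul_eq_of_basis (a : J) :
    ∃ p q r : F, p • x + q • y + r • z = a :=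
  ⟨b.repr a 0, b.repr a 1, b.repr a 2, by
    simpa [Fin.sum_univ_three, hb] using b.sum_repr a⟩

theorem constr_smul_add_smul_add_smul {K : Type*} [AddCommGroup K] [Module F K] (u v w : K)
    (p q r : F) :
    b.constr F ![u, v, w] (p • x + q • y + r • z) = p • u + q • v + r • w := by
  have h := b.constr_basis F ![u, v, w]
  have h₀ := h 0
  have h₁ := h 1
  have h₂ := h 2
  simp only [hb, Matrix.cons_val] at h₀ h₁ h₂
  rw [map_add, map_add, map_smul, map_smul, map_smul, h₀, h₁, h₂]

end FinThreeBasis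

namespace HexagonalSystem

section Subalgebra

variable {F : Type w} {J : Type z} [Field F] [AddCommGroup J] [Module F J]
  (S : HexagonalSystem F J)

theorem cross_one (a : J) : S.cross S.one a = S.tr a S.one • S.one - a := by
  linear_combination (norm := module) S.one_cross a

theorem tr_eq_mul_sub (a b : J) :
    S.tr a b = S.tr a S.one * S.tr b S.one - S.tr (S.cross a b) S.one := by
  have h : S.tr (S.tr a S.one • S.one - S.cross S.one a) b = S.tr a b := by rw [← S.one_cross]
  rw [← h, map_sub, map_smul, LinearMap.sub_apply, LinearMap.smul_apply, smul_eq_mul,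
    S.tr_symm S.one b, ← S.tr_cross, S.tr_symm S.one]

theorem tr_self (d : J) : S.tr d d = S.tr d S.one ^ 2 - 2 * S.tr (S.adj d) S.one := by
  rw [S.tr_eq_mul_sub d d, S.cross_self, map_smul, LinearMap.smul_apply, smul_eq_mul]
  ring

theorem cross_adj_self (d : J) : S.cross d (S.adj d) =
    (S.tr d S.one * S.tr (S.adj d) S.one - S.norm d) • S.one - S.tr (S.adj d) S.one • d -
      S.tr d S.one • S.adj d := by
  have h := S.adj_cross d S.one
  rw [S.cross_symm d S.one, S.cross_one, map_sub, map_smul, S.cross_symm _ S.one, S.cross_one,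
    S.cross_symm _ d] at h
  linear_combination (norm := module) -h

theorem adj_smul_add_smul_add_smul (d : J) (p q r : F) :
    S.adj (p • S.one + q • d + r • S.adj d) =
      (p ^ 2 + p * q * S.tr d S.one + p * r * S.tr (S.adj d) S.one +
        q * r * (S.tr d S.one * S.tr (S.adj d) S.one - S.norm d)) • S.one +
      (r ^ 2 * S.norm d - p * q - q * r * S.tr (S.adj d) S.one) • d +
      (q ^ 2 - p * r - q * r * S.tr d S.one) • S.adj d := by
  simp only [S.adj_add, S.adj_smul, map_add, map_smul, LinearMap.add_apply, LinearMap.smul_apply,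
    S.adj_one, S.cross_one, S.adj_adj, S.cross_adj_self]
  module

theorem adj_notMem_span {d : J} (hd : LinearIndependent F ![S.one, d]) :
    S.adj d ∉ Submodule.span F {S.one, d} := by
  rw [LinearIndependent.pair_iff' S.one_ne_zero] at hd
  intro h
  obtain ⟨α, β, h⟩ := Submodule.mem_span_pair.1 h
  -- Translating `d` by a multiple of `1` makes its adjoint, hence `d` itself, a multiple of `1`.
  have hadj : S.adj (β • S.one + d) = (β ^ 2 + β * S.tr d S.one + α) • S.one := by
    have h' := S.adj_smul_add_smul_add_smul d β 1 0
    rw [one_smul, zero_smul, add_zero, ← h] at h'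
    rw [h']
    module
  have hne : β • S.one + d ≠ 0 := fun h0 => hd (-β) (by linear_combination (norm := module) -h0)
  have hscalar := S.adj_adj (β • S.one + d)
  rw [hadj, S.adj_smul, S.adj_one, ← inv_smul_eq_iff₀ (S.norm_ne_zero hne)] at hscalar
  refine hd ((S.norm (β • S.one + d))⁻¹ * (β ^ 2 + β * S.tr d S.one + α) ^ 2 - β) ?_
  rw [sub_smul, mul_smul, hscalar, add_sub_cancel_left]

theorem linearIndependent_one_self_adj {d : J} (hd : LinearIndependent F ![S.one, d]) :
    LinearIndependent F ![S.one, d, S.adj d] := by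
  rw [show ![S.one, d, S.adj d] = Fin.snoc ![S.one, d] (S.adj d) by
    ext i; fin_cases i <;> rfl, linearIndependent_finSnoc]
  exact ⟨hd, by simpa only [Matrix.range_cons, Matrix.range_empty, Set.union_empty,
    Set.singleton_union] using S.adj_notMem_span hd⟩

end Subalgebra

/-- The bijections `M`, `M'` are similarities of the norm: they multiply it by `ν` and `ν²`, and
intertwine the adjoint. They rescale the coordinates of a hexagon. -/
structure IsIsotopy {F : Type w} {J : Type z} [Field F] [AddCommGroup J] [Module F J]
    (S : HexagonalSystem F J) (M M' : J ≃ₗ[F] J) (ν : F) : Prop where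
  ne_zero : ν ≠ 0
  adj : ∀ a, M' (S.adj a) = S.adj (M a)
  norm : ∀ a, S.norm (M a) = ν * S.norm a
  tr : ∀ a b, S.tr (M a) (M' b) = ν * S.tr a b

section Basis

variable {F : Type w} {J : Type z} [Field F] [AddCommGroup J] [Module F J]
  (S : HexagonalSystem F J) (d : J) (b : Module.Basis (Fin 3) F J)

/-- Multiplication by `d` in the cubic algebra `F[d]` with basis `b = (1, d, d^#)`, in which
`d² = d^# + T(d) d - T(d^#)` and `d d^# = N(d)`. -/
noncomputable def mulSelf : J →ₗ[F] J :=
  b.constr F ![d, S.adj d + S.tr d S.one • d - S.tr (S.adj d) S.one • S.one, S.norm d • S.one]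

/-- Multiplication by `d^#` in the cubic algebra `F[d]` with basis `b = (1, d, d^#)`. -/
noncomputable def mulAdj : J →ₗ[F] J :=
  b.constr F ![S.adj d, S.norm d • S.one, S.tr (S.adj d) S.one • S.adj d -
    (S.norm d * S.tr d S.one) • S.one + S.norm d • d]

variable {d b} (hb : ⇑b = ![S.one, d, S.adj d])
include hb

theorem mulSelf_comb (p q r : F) : S.mulSelf d b (p • S.one + q • d + r • S.adj d) =
    (r * S.norm d - q * S.tr (S.adj d) S.one) • S.one + (p + q * S.tr d S.one) • d +
      q • S.adj d := by
  rw [mulSelf, constr_smul_add_smul_add_smul hb]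
  module

theorem mulAdj_comb (p q r : F) : S.mulAdj d b (p • S.one + q • d + r • S.adj d) =
    (q * S.norm d - r * (S.norm d * S.tr d S.one)) • S.one + (r * S.norm d) • d +
      (p + r * S.tr (S.adj d) S.one) • S.adj d := by
  rw [mulAdj, constr_smul_add_smul_add_smul hb]
  module

theorem mulSelf_one : S.mulSelf d b S.one = d := by
  simpa using S.mulSelf_comb hb 1 0 0

theorem mulSelf_mulAdj (a : J) : S.mulSelf d b (S.mulAdj d b a) = S.norm d • a := by
  obtain ⟨p, q, r, rfl⟩ := exists_smul_add_smul_add_smul_eq_of_basis hb a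
  rw [S.mulAdj_comb hb, S.mulSelf_comb hb]
  module

theorem mulAdj_mulSelf (a : J) : S.mulAdj d b (S.mulSelf d b a) = S.norm d • a := by
  obtain ⟨p, q, r, rfl⟩ := exists_smul_add_smul_add_smul_eq_of_basis hb a
  rw [S.mulSelf_comb hb, S.mulAdj_comb hb]
  module

theorem mulAdj_adj (a : J) : S.mulAdj d b (S.adj a) = S.adj (S.mulSelf d b a) := by
  obtain ⟨p, q, r, rfl⟩ := exists_smul_add_smul_add_smul_eq_of_basis hb a
  rw [S.mulSelf_comb hb, S.adj_smul_add_smul_add_smul, S.mulAdj_comb hb,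
    S.adj_smul_add_smul_add_smul]
  module

theorem adj_mulAdj (a : J) : S.adj (S.mulAdj d b a) = S.norm d • S.mulSelf d b (S.adj a) := by
  obtain ⟨p, q, r, rfl⟩ := exists_smul_add_smul_add_smul_eq_of_basis hb a
  rw [S.mulAdj_comb hb, S.adj_smul_add_smul_add_smul, S.adj_smul_add_smul_add_smul,
    S.mulSelf_comb hb]
  module

theorem tr_mulSelf (a x : J) : S.tr (S.mulSelf d b a) x = S.tr a (S.mulSelf d b x) := by
  have htr_adj := S.tr_self (S.adj d)
  rw [S.adj_adj, map_smul, LinearMap.smul_apply, smul_eq_mul] at htr_adj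
  obtain ⟨p, q, r, rfl⟩ := exists_smul_add_smul_add_smul_eq_of_basis hb a
  obtain ⟨p', q', r', rfl⟩ := exists_smul_add_smul_add_smul_eq_of_basis hb x
  rw [S.mulSelf_comb hb, S.mulSelf_comb hb]
  simp only [map_add, map_smul, LinearMap.add_apply, LinearMap.smul_apply, smul_eq_mul,
    S.tr_symm S.one d, S.tr_symm S.one (S.adj d), S.tr_one_one, S.tr_self d, S.tr_adj,
    S.tr_adj_self, htr_adj]
  ring

theorem exists_isIsotopy_of_basis (hd : d ≠ 0) : ∃ M M' ν, S.IsIsotopy M M' ν ∧ M S.one = d := by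
  have hN := S.norm_ne_zero hd
  have hinv (a : J) : (S.norm d)⁻¹ • S.mulAdj d b (S.mulSelf d b a) = a := by
    rw [S.mulAdj_mulSelf hb, inv_smul_smul₀ hN]
  have hinv' (a : J) : (S.norm d)⁻¹ • S.mulSelf d b (S.mulAdj d b a) = a := by
    rw [S.mulSelf_mulAdj hb, inv_smul_smul₀ hN]
  let M : J ≃ₗ[F] J := .ofLinearMap (S.mulSelf d b) ((S.norm d)⁻¹ • S.mulAdj d b)
    (LinearMap.ext fun a => (map_smul ..).trans (hinv' a)) (LinearMap.ext hinv)
  let M' : J ≃ₗ[F] J := .ofLinearMap (S.mulAdj d b) ((S.norm d)⁻¹ • S.mulSelf d b)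
    (LinearMap.ext fun a => (map_smul ..).trans (hinv a)) (LinearMap.ext hinv')
  refine ⟨M, M', S.norm d, ⟨hN, S.mulAdj_adj hb, fun a => ?_, fun a x => ?_⟩, S.mulSelf_one hb⟩
  · rcases eq_or_ne a 0 with rfl | ha
    · rw [map_zero, S.norm_zero, mul_zero]
    have h : S.norm (M a) • M a = (S.norm d * S.norm a) • M a := by
      calc
        S.norm (M a) • M a = S.adj (M' (S.adj a)) := by
          rw [← S.adj_adj]
          exact congrArg S.adj (S.mulAdj_adj hb a).symm
        _ = S.norm d • M (S.adj (S.adj a)) := S.adj_mulAdj hb _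
        _ = _ := by rw [S.adj_adj, map_smul, smul_smul]
    exact smul_left_injective F (M.map_ne_zero_iff.2 ha) h
  · change S.tr (S.mulSelf d b a) (S.mulAdj d b x) = _
    rw [S.tr_mulSelf hb, S.mulSelf_mulAdj hb, map_smul, smul_eq_mul]

end Basis

section Isotopy

variable {F : Type w} {J : Type z} [Field F] [AddCommGroup J] [Module F J]
  (S : HexagonalSystem F J)

theorem exists_isIsotopy_of_smul_one {k : F} (hk : k ≠ 0) :
    ∃ M M' ν, S.IsIsotopy M M' ν ∧ M S.one = k • S.one := by
  refine ⟨.smulOfNeZero F J k hk, .smulOfNeZero F J (k ^ 2) (pow_ne_zero 2 hk), k ^ 3,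
    ⟨pow_ne_zero 3 hk, fun a => (S.adj_smul k a).symm, S.norm_smul k, fun a b => ?_⟩, rfl⟩
  change S.tr (k • a) (k ^ 2 • b) = _
  rw [map_smul, map_smul, LinearMap.smul_apply, smul_eq_mul, smul_eq_mul]
  ring

theorem exists_isIsotopy [Module.Finite F J] (h : Module.finrank F J ≤ 3) {d : J} (hd : d ≠ 0) :
    ∃ M M' ν, S.IsIsotopy M M' ν ∧ M S.one = d := by
  by_cases hk : LinearIndependent F ![S.one, d]
  · have hli := S.linearIndependent_one_self_adj hk
    have hcard := le_antisymm hli.fintype_card_le_finrank (by rwa [Fintype.card_fin])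
    exact S.exists_isIsotopy_of_basis
      (coe_basisOfLinearIndependentOfCardEqFinrank hli hcard) hd
  · rw [LinearIndependent.pair_iff' S.one_ne_zero] at hk
    push Not at hk
    obtain ⟨k, rfl⟩ := hk
    exact S.exists_isIsotopy_of_smul_one (left_ne_zero_of_smul hd)

end Isotopy

namespace IsIsotopy

variable {F : Type w} {J : Type z} [Field F] [AddCommGroup J] [Module F J]
  {S : HexagonalSystem F J} {M M' : J ≃ₗ[F] J} {ν : F} (hM : S.IsIsotopy M M' ν)
include hM

theorem cross (a b : J) : M' (S.cross a b) = S.cross (M a) (M b) := by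
  have h := hM.adj (a + b)
  rw [S.adj_add, map_add, map_add, hM.adj, hM.adj, map_add M, S.adj_add] at h
  exact add_left_cancel (add_right_cancel h)

theorem tr_right (a b : J) : S.tr (M' a) (M b) = ν * S.tr a b := by
  rw [S.tr_symm, hM.tr, S.tr_symm]

end IsIsotopy

end HexagonalSystem

theorem IsParametrisation.comp {G M : Type*} [Group G] [AddCommGroup M] {x : M → G}
    {U : Subgroup G} (hx : IsParametrisation x U) {f : M → M} (hadd : ∀ a b, f (a + b) = f a + f b)
    (hf : Function.Bijective f) : IsParametrisation (fun a => x (f a)) U :=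
  ⟨fun a b => by simp only [hadd, hx.1], hx.2.1.comp hf.1, (hf.2.range_comp x).trans hx.2.2⟩

namespace HexagonCoordinates

variable {P : Type u} {L : Type v} {Γ : PointLineGeometry P L}
  {F : Type w} {J : Type z} [Field F] [AddCommGroup J] [Module F J]
  {S : HexagonalSystem F J} (X : HexagonCoordinates Γ S)

/-- The coordinates obtained by rescaling those of `X` with an isotopy. They have the same
apartment and hexagonal system, but the image of `1` plays the role of `1`. -/
def twist {M M' : J ≃ₗ[F] J} {ν : F} (hM : S.IsIsotopy M M' ν) : HexagonCoordinates Γ S where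
  A := X.A
  isApartment := X.isApartment
  isPoint := X.isPoint
  x₁ a := X.x₁ (M a)
  x₂ t := X.x₂ (ν * t)
  x₃ a := X.x₃ (M' a)
  x₄ t := X.x₄ (ν * t)
  x₅ a := X.x₅ (M a)
  x₆ t := X.x₆ t
  param₁ := X.param₁.comp (map_add M) M.bijective
  param₂ := X.param₂.comp (mul_add ν) (mulLeft_bijective₀ ν hM.ne_zero)
  param₃ := X.param₃.comp (map_add M') M'.bijective
  param₄ := X.param₄.comp (mul_add ν) (mulLeft_bijective₀ ν hM.ne_zero)
  param₅ := X.param₅.comp (map_add M) M.bijective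
  param₆ := X.param₆
  comm₁₂ _ _ := X.comm₁₂ _ _
  comm₁₃ _ _ := by rw [X.comm₁₃, hM.tr]
  comm₁₄ _ _ := X.comm₁₄ _ _
  comm₁₅ _ _ := by
    rw [X.comm₁₅, ← hM.adj, ← hM.adj, hM.tr_right, hM.tr, hM.cross, mul_neg]
  comm₁₆ a t := by
    rw [X.comm₁₆, ← hM.adj, hM.norm, map_smul, map_neg, map_smul,
      show -(t * (ν * S.norm a)) = ν * -(t * S.norm a) by ring,
      show t ^ 2 * (ν * S.norm a) = ν * (t ^ 2 * S.norm a) by ring]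
  comm₂₃ _ _ := X.comm₂₃ _ _
  comm₂₄ _ _ := X.comm₂₄ _ _
  comm₂₅ _ _ := X.comm₂₅ _ _
  comm₂₆ _ _ := by rw [X.comm₂₆, mul_assoc]
  comm₃₄ _ _ := X.comm₃₄ _ _
  comm₃₅ _ _ := by rw [X.comm₃₅, hM.tr_right]
  comm₃₆ _ _ := X.comm₃₆ _ _
  comm₄₅ _ _ := X.comm₄₅ _ _
  comm₄₆ _ _ := X.comm₄₆ _ _
  comm₅₆ _ _ := X.comm₅₆ _ _

variable {X}

theorem exists_collineation_x₁_one_smul (hΓ : Γ.IsMoufangHexagon) [Module.Finite F J]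
    (hrank : Module.finrank F J ≤ 3) {d : J} (hd : d ≠ 0) :
    ∃ m : Γ.Collineation, (∀ j, m • X.A j = X.A j) ∧
      m • X.root.x₁ S.one • X.A 8 = X.root.x₁ d • X.A 8 := by
  obtain ⟨M, M', ν, hM, rfl⟩ := S.exists_isIsotopy hrank hd
  obtain ⟨m, hA, hm⟩ := exists_collineation_of_coordinates hΓ X (X.twist hM)
  exact ⟨m, hA, hm S.one 8⟩

theorem IsNormalised.conj (hΓ : Γ.IsMoufangHexagon) {θ n : Γ.Collineation} {O : Set P}
    (h : X.IsNormalised θ O) (hn : ∀ j, n • X.A j = X.A j) :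
    X.IsNormalised (n * θ * n⁻¹) (n.1.1 '' O) := by
  refine ⟨h.toIsDomesticFixing.conj hΓ.hexagon n, ?_, ?_, ?_⟩
  · obtain ⟨p, hp, e⟩ := h.mem_seven
    exact ⟨_, ⟨p, hp, rfl⟩, by rw [← hn 7, ← e]; rfl⟩
  · obtain ⟨p, hp, e⟩ := h.mem_one
    exact ⟨_, ⟨p, hp, rfl⟩, by rw [← hn 1, ← e]; rfl⟩
  · rw [mul_smul, mul_smul, inv_smul_eq_iff.2 (hn 8).symm, h.smul_eight, hn]

/-- Conjugation by a collineation that fixes the apartment moves the line `θ • A 6`, and this line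
determines the parameter `c` in `θ = g x₁(c) s`. -/
theorem IsNormalised.exists_conj_eq_mul_x₁_one (hΓ : Γ.IsMoufangHexagon) {θ s : Γ.Collineation}
    {O : Set P} (h : X.IsNormalised θ O) (hs : X.IsS₁ s) :
    ∃ n O' g φ ψ, X.IsNormalised (n * θ * n⁻¹) O' ∧ n * θ * n⁻¹ = g * X.root.x₁ S.one * s ∧
      X.IsTorus g φ ψ 1 ∧ S.IsFolding φ ψ 1 S.one := by
  obtain ⟨g, c, φ, ψ, l, hθ, hg⟩ := h.exists_eq_mul hΓ hs
  have hf := h.isFolding hs hg hθ hΓ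
  have := hf.moduleFinite
  obtain ⟨m, hm, hm₁⟩ := X.exists_collineation_x₁_one_smul hΓ hf.finrank_le_three
    (S.inv_ne_zero hf.c_ne_zero)
  have h' := h.conj hΓ fun j => inv_smul_eq_iff.2 (hm j).symm
  obtain ⟨g', c', φ', ψ', l', hθ', hg'⟩ := h'.exists_eq_mul hΓ hs
  have hf' := h'.isFolding hs hg' hθ' hΓ
  have h₆ := smul_six_of_eq_mul hs hg' hθ'
  rw [inv_inv, mul_smul, mul_smul, hm, smul_six_of_eq_mul hs hg hθ, hf.map_c_eq_inv, ← hm₁,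
    inv_smul_smul, hf'.map_c_eq_inv, X.x₁_smul_eq_iff hΓ] at h₆
  obtain rfl : c' = S.one := by rw [← S.inv_inv hf'.c_ne_zero, ← h₆, S.inv_one]
  obtain rfl : l' = 1 := by rw [← hf'.norm_c, S.norm_one]
  exact ⟨m⁻¹, _, g', φ', ψ', h', hθ', hg', hf'⟩

theorem IsTorus.isInducedBy {g : Γ.Collineation} {φ : J ≃ₗ[F] J} (hg : X.IsTorus g φ φ 1) :
    X.IsInducedBy g φ where
  fix := hg.fix
  conj₁ := hg.conj₁
  conj₂ t := by have h := hg.conj₂ t; rwa [inv_one, one_mul] at h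
  conj₃ := hg.conj₃
  conj₄ := hg.conj₄
  conj₅ a := by have h := hg.conj₅ a; rwa [one_smul] at h
  conj₆ t := by have h := hg.conj₆ t; rwa [one_mul] at h

end HexagonCoordinates

namespace HexagonalSystem.IsFolding

variable {F : Type w} {J : Type z} [Field F] [AddCommGroup J] [Module F J]
  {S : HexagonalSystem F J} {φ ψ : J ≃ₗ[F] J}

theorem eq_of_one (hf : S.IsFolding φ ψ 1 S.one) : ψ = φ := by
  have hφ1 : φ S.one = S.one := by rw [hf.map_c_eq_inv, S.inv_one]
  have hψ1 : ψ S.one = S.one := by rw [← S.adj_one, hf.adj, one_smul, hφ1]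
  have htr a : S.tr (φ a) S.one = S.tr a S.one := by
    simpa only [one_mul, hψ1] using hf.tr a S.one
  ext a
  have h := hf.cross S.one a
  rw [one_smul, hφ1, S.cross_one, S.cross_one, htr, map_sub, map_smul, hψ1] at h
  exact sub_right_injective h

variable (hf : S.IsFolding φ φ 1 S.one)
include hf

theorem map_one : φ S.one = S.one := by rw [hf.map_c_eq_inv, S.inv_one]

theorem isAutomorphism : S.IsAutomorphism φ := fun a => by rw [hf.adj, one_smul]

theorem trace_smul_one (a : J) : S.trace a • S.one = a + φ a + φ (φ a) := by
  have h := hf.add_eq a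
  rw [one_smul, S.cross_one, map_sub, map_smul, hf.map_one] at h
  rw [trace]
  linear_combination (norm := module) -h

theorem pow_three_eq_one : φ ^ 3 = 1 := by
  ext a
  have h := congrArg φ (hf.trace_smul_one a)
  rw [map_smul, hf.map_one, hf.trace_smul_one, map_add, map_add] at h
  change φ (φ (φ a)) = a
  linear_combination (norm := module) -h

theorem trace_adj (a : J) : S.trace (S.adj a) = S.tr a (φ a) := by
  rw [trace, S.tr_symm, hf.tr_c_adj, one_mul]

theorem ne_one_sub (z : J) (hz : z ≠ 0) : z ≠ S.one - φ (S.inv z) := by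
  simpa only [map_sub, hf.map_one] using (hf.map_ne z hz).symm

end HexagonalSystem.IsFolding

theorem PointLineGeometry.IsDomesticFixing.exists_isConj {P : Type u} {L : Type v}
    {Γ : PointLineGeometry P L} {F : Type w} {J : Type z} [Field F] [AddCommGroup J] [Module F J]
    {S : HexagonalSystem F J} {X : HexagonCoordinates Γ S} {θ s : Γ.Collineation} {O : Set P}
    (hΓ : Γ.IsMoufangHexagon) (h : Γ.IsDomesticFixing θ O) (hs : X.IsS₁ s) :
    ∃ g φ, IsConj θ (g * X.x₁ S.one * s) ∧ orderOf θ = 3 ∧ X.IsTorus g φ φ 1 ∧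
      S.IsFolding φ φ 1 S.one := by
  obtain ⟨n, hn⟩ := X.exists_isNormalised hΓ h
  obtain ⟨m, O', g, φ, ψ, hN, heq, hg, hf⟩ := hn.exists_conj_eq_mul_x₁_one hΓ hs
  obtain rfl := hf.eq_of_one
  have hconj : MulAut.conj (m * n) θ = m * (n * θ * n⁻¹) * m⁻¹ := by
    rw [map_mul, MulAut.mul_apply, MulAut.conj_apply, MulAut.conj_apply]
  refine ⟨g, ψ, isConj_iff.2 ⟨m * n, hconj.trans heq⟩, ?_, hg, hf⟩
  rw [← (MulAut.conj (m * n)).orderOf_eq θ, hconj, hN.orderOf_eq hs hg heq hΓ]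

theorem mainTheorem4 {P : Type u} {L : Type v} {F : Type w} {J : Type z}
    [Field F] [AddCommGroup J] [Module F J]
    (Γ : PointLineGeometry P L) (hΓ : Γ.IsMoufangHexagon)
    (S : HexagonalSystem F J) (X : HexagonCoordinates Γ S)
    (θ : Γ.Collineation) (hθ : θ ≠ 1) (hdom : Γ.IsPointDomestic θ)
    (O : Set P) (hO : Γ.IsOvoid O)
    (hfix : ∀ p ∈ O, θ • (Sum.inl p : P ⊕ L) = Sum.inl p) :
    ∃ (h : J ≃ₗ[F] J) (η s₁ : Γ.Collineation),
      S.IsAutomorphism h ∧ X.IsInducedBy η h ∧ X.IsS₁ s₁ ∧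
      IsConj θ (η * X.x₁ S.one * s₁) ∧
      h ^ 3 = 1 ∧ orderOf θ = 3 ∧
      (∀ a : J, S.trace a • S.one = a + h a + h (h a)) ∧
      (∀ a : J, S.trace (S.adj a) = S.tr a (h a)) ∧
      ∀ z : J, z ≠ 0 → z ≠ S.one - h (S.inv z) := by
  obtain ⟨s, hs⟩ := X.exists_isS₁ hΓ
  have hdf : Γ.IsDomesticFixing θ O := ⟨hθ, hdom, hO, Set.forall_mem_image.2 fun p => hfix p⟩
  obtain ⟨η, h, hconj, horder, hη, hf⟩ := hdf.exists_isConj hΓ hs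
  exact ⟨h, η, s, hf.isAutomorphism, hη.isInducedBy, hs, hconj, hf.pow_three_eq_one, horder,
    hf.trace_smul_one, hf.trace_adj, hf.ne_one_sub⟩
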